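/- Let $\rho_+>\rho_->0$, $g>0$, $T>0$, and put $$c_-(t)=\tfrac12\Big(1-\sqrt{\tfrac{\rho_-}{\rho_+}}\Big)gt^2,\qquad c_+(t)=\tfrac12\Big(\sqrt{\tfrac{\rho_+}{\rho_-}}-1\Big)gt^2,\qquad \Omega=(0,1)\times(-c_-(T),c_+(T))\subset\mathbb R^2 .$$ Let $\rho_0(x)=\rho_+$ for $x_2>0$, $\rho_0(x)=\rho_-$ for $x_2\le 0$, and $v_0\equiv 0$. For $e\ge 0$ and $t>0$, and for $\rho\in\mathbb R$, $v,u\in\mathbb R^2$, $S\in\mathbb R^{2\times2}$ symmetric and trace-free, write $(\rho,v,u,S)\in\mathcal K_{t,e}$ if $\rho\in\{\rho_-,\rho_+\}$, $u=\rho v$ and $\rho v\otimes v-S=(e-\rho g t v_2-\frac12\rho g^2t^2)\,\mathrm{id}$; and write $(\rho,v,u,S)\in\mathcal U_{t,e}$ if $\rho_-<\rho<\rho_+$, $$\frac{\rho_+}{2}\frac{|u-\rho_-v+(\rho-\rho_-)gte_2|^2}{(\rho-\rho_-)^2}<e,\qquad \frac{\rho_-}{2}\frac{|u-\rho_+v+(\rho-\rho_+)gte_2|^2}{(\rho-\rho_+)^2}<e,$$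 $$\lambda_{\max}\Big(\tfrac{\rho\rho_-\rho_+v\otimes v-\rho_-\rho_+(u\otimes v+v\otimes u)+(\rho_++\rho_--\rho)u\otimes u}{(\rho_+-\rho)(\rho-\rho_-)}-S\Big)<e-gtu_2-\tfrac12\rho g^2t^2 .$$ A *Rayleigh–Taylor subsolution* associated with a bounded function $e:\Omega\times[0,T)\to[0,\infty)$, with *mixing zone* $\mathscr U$, is a tuple $z=(\rho,v,u,S,P)$, where $(\rho,v,u,S)\in L^\infty(\Omega\times(0,T))$ takes values in $\mathbb R\times\mathbb R^2\times\mathbb R^2\times\{\text{symmetric trace-free }2\times 2\text{ matrices}\}$ and $P$ is a distribution on $\Omega\times(0,T)$, such that: * $\partial_tu+\operatorname{div}S+\nabla P=-\rho g e_2$ in the sense of distributions on $\Omega\times(0,T)$; and, for all $\Phi\in C_c^\infty(\Omega\times[0,T);\mathbb R^2)$ with $\operatorname{div}\Phi=0$, all $\Psi\in C_c^\infty(\Omega\times[0,T))$ and all $\Psi_1\in C_c^\infty(\overline\Omega\times[0,T))$, $$\int_0^T\!\!\int_\Omega\big[u\cdot\partial_t\Phi+\langle S,\nabla\Phi\rangle-g\rho\Phi_2\big]dx\,dt+\int_\Omega\rho_0v_0\cdot\Phi(\cdot,0)\,dx=0,$$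 $$\int_0^T\!\!\int_\Omega\big[\rho\,\partial_t\Psi+u\cdot\nabla\Psi\big]dx\,dt+\int_\Omega\rho_0\Psi(\cdot,0)\,dx=0,\qquad \int_0^T\!\!\int_\Omega v\cdot\nabla\Psi_1\,dx\,dt=0;$$ * $\mathscr U\subset\Omega\times(0,T)$ is open, $(\rho,v,u,S)$ and $e$ are continuous on $\mathscr U$, $(\rho,v,u,S)(x,t)\in\mathcal U_{t,e(x,t)}$ for every $(x,t)\in\mathscr U$, and $(\rho,v,u,S)(x,t)\in\mathcal K_{t,e(x,t)}$ for a.e. $(x,t)\in(\Omega\times(0,T))\setminus\mathscr U$; * (strict admissibility) with $E_{sub}(x,t)=e-gtu_2-\frac12\rho g^2t^2+\rho gx_2$ for $t>0$, and at $t=0$ with $e(x,0)=\frac12\rho_0|v_0|^2=0$ and $E_{sub}(x,0)=e(x,0)+\rho_0(x)gx_2$, the function $E_{sub}(\cdot,t)$ is integrable on $\Omega$ for every $t\in[0,T)$ and $$\int_\Omega E_{sub}(x,t)\,dx<\int_\Omega E_{sub}(x,0)\,dx\qquad\text{for every }t\in(0,T).$$ **Theorem.** If $\rho_+>\big(\frac{4+2\sqrt{10}}{3}\big)^2\rho_-$,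 then there is a Rayleigh–Taylor subsolution $z=(\rho,v,u,S,P)$ (associated with some $e$ as above) which depends only on $x_2/t^2$ up to the powers of $t$ forced by scaling, that is, on $\Omega\times(0,T)$ $$\rho=r\big(\tfrac{x_2}{t^2}\big),\quad v=0,\quad u=t\,U\big(\tfrac{x_2}{t^2}\big),\quad S=t^2\,\Sigma\big(\tfrac{x_2}{t^2}\big),\quad P=t^2\,q\big(\tfrac{x_2}{t^2}\big)$$ for some functions $r,U,\Sigma,q$ of one real variable (with $(x,t)\mapsto t^2q(x_2/t^2)$ locally integrable on $\Omega\times(0,T)$), and whose mixing zone satisfies, for every $t\in(0,T)$, $$\{x\in\Omega:(x,t)\in\mathscr U\}=(0,1)\times(-c_-(t),c_+(t)).$$ -/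

import Mathlib

open Set MeasureTheory TopologicalSpace
open scoped ContDiff Distributions

noncomputable section

namespace RayleighTaylor

/-- The plane with its Euclidean norm. The coordinates `x₁`, `x₂` are `x 0`, `x 1`. -/
abbrev Plane := EuclideanSpace ℝ (Fin 2)

/-- The upward unit vector `e₂`. -/
def e2 : Plane := EuclideanSpace.single 1 1

/-- The space-time cylinder `Ω × (0, T)`. -/
def cylinder (Ω : Opens Plane) (T : ℝ) : Opens (Plane × ℝ) :=
  ⟨(Ω : Set Plane) ×ˢ Ioo 0 T, Ω.isOpen.prod isOpen_Ioo⟩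

/-- `∂ₜ F`. -/
def dt {F : Type*} [NormedAddCommGroup F] [NormedSpace ℝ F] (f : Plane × ℝ → F)
    (p : Plane × ℝ) : F :=
  fderiv ℝ f p (0, 1)

/-- `∂F / ∂xⱼ`. -/
def dx {F : Type*} [NormedAddCommGroup F] [NormedSpace ℝ F] (j : Fin 2) (f : Plane × ℝ → F)
    (p : Plane × ℝ) : F :=
  fderiv ℝ f p (EuclideanSpace.single j 1, 0)

/-- The spatial divergence of a time-dependent vector field. -/
def divx (Φ : Plane × ℝ → Plane) (p : Plane × ℝ) : ℝ := ∑ j, dx j Φ p j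

/-- Smooth functions with compact support contained in `A ⊆ ℝ² × ℝ`.
With `A = Ω × (-∞, T)`, their restrictions to times `t ≥ 0` are the elements
of `C_c^∞(Ω × [0, T))`, which need not vanish at `t = 0`. -/
structure IsTest {F : Type*} [NormedAddCommGroup F] [NormedSpace ℝ F]
    (A : Set (Plane × ℝ)) (f : Plane × ℝ → F) : Prop where
  smooth : ContDiff ℝ ∞ f
  compact : HasCompactSupport f
  support : tsupport f ⊆ A

/-- The relaxed unknowns `z = (ρ, v, u, S, P)`: four functions of `(x, t)`, and a distribution `P`
on `Ω × (0, T)`. Only the values on `Ω × (0, T)` matter. -/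
structure State (Ω : Opens Plane) (T : ℝ) where
  rho : Plane × ℝ → ℝ
  v : Plane × ℝ → Plane
  u : Plane × ℝ → Plane
  S : Plane × ℝ → Matrix (Fin 2) (Fin 2) ℝ
  P : 𝓓'(cylinder Ω T, ℝ)

/-- `a ⊗ b`. -/
def tensor (a b : Plane) : Matrix (Fin 2) (Fin 2) ℝ := Matrix.of fun i j => a i * b j

/-- The largest eigenvalue of a (nonempty, real symmetric) matrix. -/
def lambdaMax (A : Matrix (Fin 2) (Fin 2) ℝ) : ℝ := sSup (spectrum ℝ A)

/-- The matrix `A(z)`. -/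
def matA (rm rp ρ : ℝ) (v u : Plane) (S : Matrix (Fin 2) (Fin 2) ℝ) :
    Matrix (Fin 2) (Fin 2) ℝ :=
  ((rp - ρ) * (ρ - rm))⁻¹ •
      ((ρ * rm * rp) • tensor v v - (rm * rp) • (tensor u v + tensor v u)
        + (rp + rm - ρ) • tensor u u) - S

/-- The nonlinear constraint set `𝒦_{(x,t)}` in dimension `n = 2`, where `e = e(x, t)`. -/
def InK (rm rp g t e ρ : ℝ) (v u : Plane) (S : Matrix (Fin 2) (Fin 2) ℝ) : Prop :=
  (ρ = rm ∨ ρ = rp) ∧ u = ρ • v ∧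
    ρ • tensor v v - S
      = (e - ρ * g * t * v 1 - 1 / 2 * ρ * g ^ 2 * t ^ 2) • (1 : Matrix (Fin 2) (Fin 2) ℝ)

/-- The relaxed constraint set `𝒰_{(x,t)}` in dimension `n = 2`, where `e = e(x, t)`. -/
def InU (rm rp g t e ρ : ℝ) (v u : Plane) (S : Matrix (Fin 2) (Fin 2) ℝ) : Prop :=
  (rm < ρ ∧ ρ < rp) ∧
    rp / 2 * (‖u - rm • v + ((ρ - rm) * g * t) • e2‖ ^ 2 / (ρ - rm) ^ 2) < e ∧
    rm / 2 * (‖u - rp • v + ((ρ - rp) * g * t) • e2‖ ^ 2 / (ρ - rp) ^ 2) < e ∧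
    lambdaMax (matA rm rp ρ v u S) < e - g * t * u 1 - 1 / 2 * ρ * g ^ 2 * t ^ 2

/-- Initial data `(ρ₀, v₀) ∈ L^∞(Ω) × L²(Ω; ℝ²)` with `div v₀ = 0` and `ρ₀ ∈ {ρ₋, ρ₊}` a.e. -/
structure IsInitialData (rm rp : ℝ) (Ω : Opens Plane) (rho0 : Plane → ℝ) (v0 : Plane → Plane) :
    Prop where
  rho_bdd : MemLp rho0 ⊤ (volume.restrict (Ω : Set Plane))
  v_sq : MemLp v0 2 (volume.restrict (Ω : Set Plane))
  div_free : ∀ ψ : Plane → ℝ, ContDiff ℝ ∞ ψ → HasCompactSupport ψ → tsupport ψ ⊆ (Ω : Set Plane) →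
    ∫ x in (Ω : Set Plane), fderiv ℝ ψ x (v0 x) = 0
  two_phase : ∀ᵐ x ∂(volume.restrict (Ω : Set Plane)), rho0 x = rm ∨ rho0 x = rp

/-- `z` solves `∂ₜu + div S + ∇P = -ρ g e₂`, `∂ₜρ + div u = 0`, `div v = 0` weakly on
`Ω × (0, T)`, with initial data `(ρ₀, v₀)` and the no-flux boundary condition for `v`. -/
structure SolvesLinearSystem (g : ℝ) {Ω : Opens Plane} {T : ℝ} (z : State Ω T)
    (rho0 : Plane → ℝ) (v0 : Plane → Plane) : Prop where
  /-- Test functions in `C_c^∞(Ω̄ × [0, T))`: the boundary condition `v · ν = 0` is included. -/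
  div_free : ∀ Ψ : Plane × ℝ → ℝ, IsTest (univ ×ˢ Iio T) Ψ →
    ∫ p in (cylinder Ω T : Set (Plane × ℝ)), ∑ j, z.v p j * dx j Ψ p = 0
  /-- The momentum equation against solenoidal test functions, with the initial condition. -/
  momentum : ∀ Φ : Plane × ℝ → Plane, IsTest ((Ω : Set Plane) ×ˢ Iio T) Φ →
    (∀ p ∈ (Ω : Set Plane) ×ˢ Ico 0 T, divx Φ p = 0) →
    (∫ p in (cylinder Ω T : Set (Plane × ℝ)),
        ((∑ i, z.u p i * dt Φ p i) + (∑ i, ∑ j, z.S p i j * dx j Φ p i) - g * z.rho p * Φ p 1))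
      + ∫ x in (Ω : Set Plane), rho0 x * ∑ i, v0 x i * Φ (x, 0) i = 0
  /-- The momentum equation, with the pressure, in the sense of distributions. -/
  pressure : ∀ Φ : Plane × ℝ → Plane, IsTest (cylinder Ω T : Set (Plane × ℝ)) Φ →
    ∀ ψ : 𝓓(cylinder Ω T, ℝ), (∀ p, ψ p = divx Φ p) →
    (∫ p in (cylinder Ω T : Set (Plane × ℝ)),
        ((∑ i, z.u p i * dt Φ p i) + (∑ i, ∑ j, z.S p i j * dx j Φ p i) - g * z.rho p * Φ p 1))
      + z.P ψ = 0
  /-- The continuity equation with the initial condition. -/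
  continuity : ∀ Ψ : Plane × ℝ → ℝ, IsTest ((Ω : Set Plane) ×ˢ Iio T) Ψ →
    (∫ p in (cylinder Ω T : Set (Plane × ℝ)),
        (z.rho p * dt Ψ p + ∑ j, z.u p j * dx j Ψ p))
      + ∫ x in (Ω : Set Plane), rho0 x * Ψ (x, 0) = 0

/-- `z` is a subsolution on `Ω × (0, T)` associated with `e` and the initial data `(ρ₀, v₀)`, and
`mix` is its mixing zone. -/
structure IsSubsolution (rm rp g : ℝ) {Ω : Opens Plane} {T : ℝ} (e : Plane × ℝ → ℝ)
    (z : State Ω T) (rho0 : Plane → ℝ) (v0 : Plane → Plane) (mix : Set (Plane × ℝ)) : Prop where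
  initial : IsInitialData rm rp Ω rho0 v0
  e_nonneg : ∀ p ∈ (Ω : Set Plane) ×ˢ Ico 0 T, 0 ≤ e p
  e_bdd : ∃ C : ℝ, ∀ p ∈ (Ω : Set Plane) ×ˢ Ico 0 T, e p ≤ C
  /-- `S` takes values in the symmetric trace-free matrices. -/
  S_symm : ∀ p ∈ cylinder Ω T, (z.S p).IsSymm ∧ (z.S p).trace = 0
  /-- `(ρ, v, u, S) ∈ L^∞(Ω × (0, T))`. -/
  rho_bdd : MemLp z.rho ⊤ (volume.restrict (cylinder Ω T : Set (Plane × ℝ)))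
  v_bdd : MemLp z.v ⊤ (volume.restrict (cylinder Ω T : Set (Plane × ℝ)))
  u_bdd : MemLp z.u ⊤ (volume.restrict (cylinder Ω T : Set (Plane × ℝ)))
  S_bdd : ∀ i j, MemLp (fun p => z.S p i j) ⊤ (volume.restrict (cylinder Ω T : Set (Plane × ℝ)))
  solves : SolvesLinearSystem g z rho0 v0
  mix_open : IsOpen mix
  mix_subset : mix ⊆ (cylinder Ω T : Set (Plane × ℝ))
  e_cont : ContinuousOn e mix
  rho_cont : ContinuousOn z.rho mix
  v_cont : ContinuousOn z.v mix
  u_cont : ContinuousOn z.u mix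
  S_cont : ContinuousOn z.S mix
  in_mix : ∀ p ∈ mix, InU rm rp g p.2 (e p) (z.rho p) (z.v p) (z.u p) (z.S p)
  off_mix : ∀ᵐ p ∂(volume.restrict ((cylinder Ω T : Set (Plane × ℝ)) \ mix)),
    InK rm rp g p.2 (e p) (z.rho p) (z.v p) (z.u p) (z.S p)

/-- The energy density `E_sub` of a subsolution at `(x, t)`, `t > 0`, in dimension `n = 2`. -/
def energySub (g : ℝ) {Ω : Opens Plane} {T : ℝ} (e : Plane × ℝ → ℝ) (z : State Ω T)
    (x : Plane) (t : ℝ) : ℝ :=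
  e (x, t) - g * t * z.u (x, t) 1 - 1 / 2 * z.rho (x, t) * g ^ 2 * t ^ 2
    + z.rho (x, t) * g * x 1

/-- Strict admissibility at every time `t ∈ (0, T)`. At time `0` the state is given by the initial
data: `e(x, 0) = ρ₀|v₀|² / 2` and `E_sub(x, 0) = e(x, 0) + ρ₀ g x₂`, which is the energy density of
`(ρ₀, v₀)`. -/
structure IsStrictlyAdmissible (g : ℝ) {Ω : Opens Plane} {T : ℝ} (e : Plane × ℝ → ℝ)
    (z : State Ω T) (rho0 : Plane → ℝ) (v0 : Plane → Plane) : Prop where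
  e_zero : ∀ x ∈ Ω, e (x, 0) = 1 / 2 * rho0 x * ‖v0 x‖ ^ 2
  integrable_zero :
    IntegrableOn (fun x : Plane => e (x, 0) + rho0 x * g * x 1) (Ω : Set Plane) volume
  integrable : ∀ t ∈ Ioo 0 T, IntegrableOn (fun x => energySub g e z x t) (Ω : Set Plane) volume
  energy_lt : ∀ t ∈ Ioo 0 T,
    ∫ x in (Ω : Set Plane), energySub g e z x t
      < ∫ x in (Ω : Set Plane), (e (x, 0) + rho0 x * g * x 1)

/-- The Rayleigh–Taylor initial density: heavy fluid above light fluid. -/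
def rtDensity (rm rp : ℝ) (x : Plane) : ℝ := if 0 < x 1 then rp else rm

/-- `z` is a Rayleigh–Taylor subsolution associated with `e`, with mixing zone `mix`. -/
def IsRTSubsolution (rm rp g : ℝ) {Ω : Opens Plane} {T : ℝ} (e : Plane × ℝ → ℝ)
    (z : State Ω T) (mix : Set (Plane × ℝ)) : Prop :=
  IsSubsolution rm rp g e z (rtDensity rm rp) (fun _ => 0) mix ∧
    IsStrictlyAdmissible g e z (rtDensity rm rp) (fun _ => 0)

/-- `z` depends only on `x₂ / t²` (up to the powers of `t` that the scaling of the equations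
forces on `u`, `S` and `P`), and the velocity vanishes:
`ρ = r(x₂/t²)`, `v = 0`, `u = t U(x₂/t²)`, `S = t² Σ(x₂/t²)`, `P = t² q(x₂/t²)`. -/
def IsSelfSimilar {Ω : Opens Plane} {T : ℝ} (z : State Ω T) : Prop :=
  ∃ (r : ℝ → ℝ) (U : ℝ → Plane) (Sig : ℝ → Matrix (Fin 2) (Fin 2) ℝ) (q : ℝ → ℝ),
    (∀ p ∈ cylinder Ω T,
      z.rho p = r (p.1 1 / p.2 ^ 2) ∧ z.v p = 0 ∧ z.u p = p.2 • U (p.1 1 / p.2 ^ 2) ∧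
        z.S p = p.2 ^ 2 • Sig (p.1 1 / p.2 ^ 2)) ∧
    LocallyIntegrableOn (fun p : Plane × ℝ => p.2 ^ 2 * q (p.1 1 / p.2 ^ 2))
      (cylinder Ω T : Set (Plane × ℝ)) volume ∧
    ∀ ψ : 𝓓(cylinder Ω T, ℝ),
      z.P ψ = ∫ p in (cylinder Ω T : Set (Plane × ℝ)), p.2 ^ 2 * q (p.1 1 / p.2 ^ 2) * ψ p

/-- `c₋(t)`. -/
def cMinus (rm rp g t : ℝ) : ℝ := 1 / 2 * (1 - √(rm / rp)) * g * t ^ 2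

/-- `c₊(t)`. -/
def cPlus (rm rp g t : ℝ) : ℝ := 1 / 2 * (√(rp / rm) - 1) * g * t ^ 2

/-- The open rectangle `(0, 1) × (-c₋(t), c₊(t))`. -/
def rect (rm rp g t : ℝ) : Opens Plane :=
  ⟨{x | (0 < x 0 ∧ x 0 < 1) ∧ (-cMinus rm rp g t < x 1 ∧ x 1 < cPlus rm rp g t)}, by
    have h0 : Continuous fun x : Plane => x 0 := by fun_prop
    have h1 : Continuous fun x : Plane => x 1 := by fun_prop
    exact ((isOpen_lt continuous_const h0).inter (isOpen_lt h0 continuous_const)).inter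
      ((isOpen_lt continuous_const h1).inter (isOpen_lt h1 continuous_const))⟩

end RayleighTaylor

end

/-!
Put `a = √ρ₊` and `b = √ρ₋`, and look for a state with `v = 0` that is a function of `y = x₂ / t²`.
With a potential `H` and `r = H' / 2`, the choice `ρ = r(y)`, `u₂ = -t (H - y H')(y)` solves the
continuity equation for every `H`: `W = t² H(y) / 2` satisfies `∂₂W = ρ` and `∂ₜW = -u₂`, and
`W(·, 0)` is a primitive of the initial density. The momentum equation only fixes the pressure,
since everything depends on `x₂` and `t` alone: a stream function `V` with `∂₂V = ∂ₜW` moves the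
time derivative of `u₂` into the pressure, and `W` does the same for gravity. Because `W` and `V` are
continuous up to `t = 0`, both equations hold for test functions that do not vanish there
(`IsStream.integral_eq`, `IsProfile.weak_continuity`, `IsProfile.weak_momentum`).

The stress is diagonal and chosen so that the matrix in the eigenvalue constraint is a multiple of
the identity. That constraint is then a convex combination of the two kinetic ones
(`IsProfile.convex_combination`). The kinetic constraint involving `ρ₋` is implied by the one
involving `ρ₊` as long as the flux `H - y H'` stays below an explicit concave function of the
density, which is the field `flux_le` of `IsProfile`. For such a profile
`e = t² (kinBound + δ)` satisfies all three constraints strictly for every `δ > 0`, and the only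
question left is that of the energy.

There is one profile on which all three constraints are tight. It is rational in
`ν = √(a b (1 + 2 y / g))`, which runs from `b` to `a` over the mixing interval, and in the limit
`δ → 0` it conserves the energy exactly, so it is not admissible. Lower its potential by `η ψ²`. The
flux stays below the bound because the gain `η ψ²` in the flux beats the quadratic effect
`(η ψ ψ')²` of the changed density (`flux_le_of_square`). After an integration by parts the energy
changes to first order in `η` by
`η ∫ g / (a + b) (ν² / (ν - b) + 3 (ν - a - b) / 2) ψ² dy`.
The bracket has the sign of `5 ν² - 3 (a + 2 b) ν + 3 b (a + b)`, which is negative near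
`ν = 3 (a + 2 b) / 10` exactly when `3 a² - 8 a b - 8 b² > 0`, that is, when
`a / b > (4 + 2 √10) / 3`. A bump `ψ` concentrated there (`exists_isUnstableBump`) and small `η`
give a profile that strictly dissipates energy (`exists_profile`), and a small `δ` keeps this.
-/

noncomputable section

namespace RayleighTaylor

section

/-! ### Self-similar profiles -/

/-- The lower end of the mixing interval, in the variable `y = x₂ / t²`, is `-edgeMinus a b g`.
Here and below `a = √ρ₊` and `b = √ρ₋`. -/
def edgeMinus (a b g : ℝ) : ℝ := 1 / 2 * (1 - b / a) * g

/-- The upper end of the mixing interval, in the variable `y = x₂ / t²`. -/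
def edgePlus (a b g : ℝ) : ℝ := 1 / 2 * (a / b - 1) * g

/-- The mixing interval in the variable `y = x₂ / t²`. -/
def mixInterval (a b g : ℝ) : Set ℝ := Ioo (-edgeMinus a b g) (edgePlus a b g)

/-- The downward flux belonging to a density profile `r` with potential `H`. -/
def flux (r H : ℝ → ℝ) (y : ℝ) : ℝ := H y - 2 * y * r y

/-- `r` is an admissible density profile in the variable `y = x₂ / t²`. Writing `r = H' / 2`, the
functions `ρ = r(x₂/t²)` and `u₂ = -t (H - y H')(x₂/t²)` solve the continuity equation, whatever
`H` is. The upper bound `flux_le` for the flux says that, of the two kinetic constraints of the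
relaxed set, the one involving `ρ₋` is the weaker one. -/
structure IsProfile (a b g : ℝ) (r H : ℝ → ℝ) : Prop where
  cont : Continuous r
  hasDerivAt : ∀ y, HasDerivAt H (2 * r y) y
  below : ∀ y ≤ -edgeMinus a b g, r y = b ^ 2 ∧ H y = 2 * b ^ 2 * y
  above : ∀ y, edgePlus a b g ≤ y → r y = a ^ 2 ∧ H y = 2 * a ^ 2 * y
  mem : ∀ y ∈ mixInterval a b g, b ^ 2 < r y ∧ r y < a ^ 2
  flux_nonneg : ∀ y ∈ mixInterval a b g, 0 ≤ flux r H y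
  flux_le : ∀ y ∈ mixInterval a b g,
    flux r H y * (a * (a ^ 2 - r y) + b * (r y - b ^ 2))
      ≤ g * (a - b) * ((r y - b ^ 2) * (a ^ 2 - r y))

/-- The smallest value of `e / t²` that the constraint involving `ρ₊` admits. -/
def kinBound (a b g : ℝ) (r H : ℝ → ℝ) (y : ℝ) : ℝ :=
  1 / 2 * a ^ 2 * (g - flux r H y / (r y - b ^ 2)) ^ 2

/-- The rescaled energy density of a profile for `e = t² * kinBound`. -/
def energyDensity (a b g : ℝ) (r H : ℝ → ℝ) (y : ℝ) : ℝ :=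
  kinBound a b g r H y + g * flux r H y - 1 / 2 * g ^ 2 * r y + g * y * r y

variable {a b g : ℝ} {r H : ℝ → ℝ}

lemma edgeMinus_pos (hb : 0 < b) (hab : b < a) (hg : 0 < g) : 0 < edgeMinus a b g := by
  have : b / a < 1 := (div_lt_one (hb.trans hab)).2 hab
  have : 0 < 1 - b / a := by linarith
  unfold edgeMinus; positivity

lemma edgePlus_pos (hb : 0 < b) (hab : b < a) (hg : 0 < g) : 0 < edgePlus a b g := by
  have : 1 < a / b := (one_lt_div hb).2 hab
  have : 0 < a / b - 1 := by linarith
  unfold edgePlus; positivity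

namespace IsProfile

lemma continuous_potential (h : IsProfile a b g r H) : Continuous H :=
  continuous_iff_continuousAt.2 fun y => (h.hasDerivAt y).continuousAt

lemma continuous_flux (h : IsProfile a b g r H) : Continuous (flux r H) := by
  have := h.cont
  have := h.continuous_potential
  unfold flux; fun_prop

lemma flux_eq_zero (h : IsProfile a b g r H) {y : ℝ} (hy : y ∉ mixInterval a b g) :
    flux r H y = 0 := by
  unfold flux
  rcases lt_or_ge (-edgeMinus a b g) y with h1 | h1
  · have h2 : edgePlus a b g ≤ y := not_lt.1 fun h2 => hy ⟨h1, h2⟩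
    rw [(h.above y h2).1, (h.above y h2).2]; ring
  · rw [(h.below y h1).1, (h.below y h1).2]; ring

lemma flux_div_nonneg (h : IsProfile a b g r H) {y : ℝ} (hy : y ∈ mixInterval a b g) :
    0 ≤ flux r H y / (r y - b ^ 2) :=
  div_nonneg (h.flux_nonneg y hy) (by linarith [(h.mem y hy).1])

lemma flux_div_le (h : IsProfile a b g r H) (hb : 0 < b) (hab : b < a) (hg : 0 < g) {y : ℝ}
    (hy : y ∈ mixInterval a b g) : flux r H y / (r y - b ^ 2) ≤ g := by
  obtain ⟨h1, h2⟩ := h.mem y hy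
  have hα : 0 < r y - b ^ 2 := by linarith
  have hβ : 0 < a ^ 2 - r y := by linarith
  have ha : 0 < a := hb.trans hab
  rw [div_le_iff₀ hα]
  have hD : 0 < a * (a ^ 2 - r y) + b * (r y - b ^ 2) := by positivity
  refine le_of_mul_le_mul_right ((h.flux_le y hy).trans ?_) hD
  have e1 : 0 ≤ g * b * ((r y - b ^ 2) * (a ^ 2 - r y)) := by positivity
  have e2 : 0 ≤ g * b * ((r y - b ^ 2) * (r y - b ^ 2)) := by positivity
  nlinarith

lemma continuousOn_kinBound (h : IsProfile a b g r H) :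
    ContinuousOn (kinBound a b g r H) (mixInterval a b g) := by
  have h1 := h.continuous_flux.continuousOn (s := mixInterval a b g)
  have h2 := h.cont.continuousOn (s := mixInterval a b g)
  unfold kinBound
  refine continuousOn_const.mul
    ((continuousOn_const.sub (h1.div (h2.sub continuousOn_const) ?_)).pow 2)
  intro y hy
  exact sub_ne_zero.2 (h.mem y hy).1.ne'

lemma kinBound_nonneg (y : ℝ) : 0 ≤ kinBound a b g r H y := by unfold kinBound; positivity

lemma kinBound_le (h : IsProfile a b g r H) (hb : 0 < b) (hab : b < a) (hg : 0 < g) {y : ℝ}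
    (hy : y ∈ mixInterval a b g) : kinBound a b g r H y ≤ 1 / 2 * a ^ 2 * g ^ 2 := by
  unfold kinBound
  have h1 := h.flux_div_nonneg hy
  have h2 := h.flux_div_le hb hab hg hy
  have : (g - flux r H y / (r y - b ^ 2)) ^ 2 ≤ g ^ 2 := by
    apply pow_le_pow_left₀ <;> linarith
  gcongr

lemma integrableOn_kinBound (h : IsProfile a b g r H) (hb : 0 < b) (hab : b < a) (hg : 0 < g) :
    IntegrableOn (kinBound a b g r H) (mixInterval a b g) := by
  refine IntegrableOn.of_bound (C := 1 / 2 * a ^ 2 * g ^ 2)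
    (by simp [mixInterval]) (h.continuousOn_kinBound.aestronglyMeasurable measurableSet_Ioo) ?_
  refine (ae_restrict_iff' measurableSet_Ioo).2 (.of_forall fun y hy => ?_)
  rw [Real.norm_of_nonneg (kinBound_nonneg y)]
  exact h.kinBound_le hb hab hg hy

lemma integrableOn_energyDensity (h : IsProfile a b g r H) (hb : 0 < b) (hab : b < a)
    (hg : 0 < g) : IntegrableOn (energyDensity a b g r H) (mixInterval a b g) := by
  have h1 := h.continuous_flux
  have h2 := h.cont
  have h3 : Continuous fun y => g * flux r H y - 1 / 2 * g ^ 2 * r y + g * y * r y := by fun_prop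
  have h4 : IntegrableOn (fun y => g * flux r H y - 1 / 2 * g ^ 2 * r y + g * y * r y)
      (mixInterval a b g) :=
    (h3.continuousOn.integrableOn_compact isCompact_Icc).mono_set Ioo_subset_Icc_self
  refine ((h.integrableOn_kinBound hb hab hg).add h4).congr (.of_forall fun y => ?_)
  simp only [energyDensity, Pi.add_apply]; ring

end IsProfile

/-! ### The profile on which all constraints are tight -/

/-- In terms of `ν` the extremal profile is rational; `ν` increases from `b` to `a` on the mixing
interval. -/
def nu (a b g y : ℝ) : ℝ := √(a * b * (1 + 2 * y / g))

/-- `ν`, frozen at its end values outside the mixing interval. -/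
def nuClamp (a b g y : ℝ) : ℝ := max b (min a (nu a b g y))

/-- The density of the extremal profile. -/
def baseDensity (a b g y : ℝ) : ℝ := (a + b) ^ 2 - a * b - (a + b) * (a * b) / nuClamp a b g y

/-- The potential of the extremal profile. -/
def basePotential (a b g y : ℝ) : ℝ :=
  g * (a + b) * (a + b - a * b / nuClamp a b g y - nuClamp a b g y) + 2 * y * baseDensity a b g y

lemma continuous_nu : Continuous (nu a b g) := by unfold nu; fun_prop

lemma nu_sq (hb : 0 < b) (ha : 0 < a) (hg : 0 < g) {y : ℝ} (hy : -g / 2 ≤ y) :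
    nu a b g y ^ 2 = a * b * (1 + 2 * y / g) := by
  unfold nu
  rw [Real.sq_sqrt]
  have : 0 ≤ 1 + 2 * y / g := by
    have : 1 + 2 * y / g = (g + 2 * y) / g := by field_simp
    rw [this]; apply div_nonneg <;> linarith
  positivity

lemma nu_le_iff (hb : 0 < b) (ha : 0 < a) (hg : 0 < g) {y c : ℝ} (hc : 0 ≤ c) :
    nu a b g y ≤ c ↔ y ≤ g / 2 * (c ^ 2 / (a * b) - 1) := by
  unfold nu
  rw [Real.sqrt_le_left hc,
    show g / 2 * (c ^ 2 / (a * b) - 1) = (c ^ 2 / (a * b) - 1) * g / 2 by ring,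
    le_div_iff₀ two_pos, ← div_le_iff₀ hg, le_sub_iff_add_le, le_div_iff₀ (by positivity)]
  rw [show 1 + 2 * y / g = y * 2 / g + 1 by ring, mul_comm (a * b)]

lemma neg_edgeMinus_eq :
    -edgeMinus a b g = g / 2 * (b ^ 2 / (a * b) - 1) := by
  unfold edgeMinus; field_simp; ring

lemma edgePlus_eq :
    edgePlus a b g = g / 2 * (a ^ 2 / (a * b) - 1) := by
  unfold edgePlus; field_simp

lemma nu_le_b (hb : 0 < b) (ha : 0 < a) (hg : 0 < g) {y : ℝ} :
    nu a b g y ≤ b ↔ y ≤ -edgeMinus a b g := by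
  rw [nu_le_iff hb ha hg hb.le, neg_edgeMinus_eq]

lemma nu_le_a (hb : 0 < b) (ha : 0 < a) (hg : 0 < g) {y : ℝ} :
    nu a b g y ≤ a ↔ y ≤ edgePlus a b g := by
  rw [nu_le_iff hb ha hg ha.le, edgePlus_eq]

lemma nu_value (hb : 0 < b) (ha : 0 < a) (hg : 0 < g) {c : ℝ} (hc : 0 ≤ c) :
    nu a b g (g / 2 * (c ^ 2 / (a * b) - 1)) = c := by
  unfold nu
  rw [← Real.sqrt_sq hc]; congr 1; rw [Real.sqrt_sq hc]; field_simp; ring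

lemma mem_mixInterval_iff (hb : 0 < b) (ha : 0 < a) (hg : 0 < g) {y : ℝ} :
    y ∈ mixInterval a b g ↔ b < nu a b g y ∧ nu a b g y < a := by
  rw [← not_le, nu_le_b hb ha hg, not_le, mixInterval, mem_Ioo]
  refine and_congr_right fun h1 => ?_
  constructor
  · intro h2
    refine lt_of_le_of_ne ((nu_le_a hb ha hg).2 h2.le) fun h3 => ?_
    have h4 := nu_sq (a := a) (b := b) (g := g) hb ha hg (y := y) (by
      have := neg_edgeMinus_eq (a := a) (b := b) (g := g)
      have : 0 ≤ g / 2 * (b ^ 2 / (a * b)) := by positivity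
      linarith)
    rw [h3] at h4
    rw [edgePlus_eq, h4] at h2
    apply h2.ne; field_simp; ring
  · intro h2
    refine lt_of_le_of_ne ((nu_le_a hb ha hg).1 h2.le) fun h3 => ?_
    rw [h3, edgePlus_eq, nu_value hb ha hg ha.le] at h2
    exact lt_irrefl _ h2

lemma nuClamp_of_le (hb : 0 < b) (hab : b < a) (hg : 0 < g) {y : ℝ} (hy : y ≤ -edgeMinus a b g) :
    nuClamp a b g y = b := by
  rw [nuClamp, max_eq_left]
  exact (min_le_right _ _).trans ((nu_le_b hb (hb.trans hab) hg).2 hy)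

lemma nuClamp_of_ge (hb : 0 < b) (hab : b < a) (hg : 0 < g) {y : ℝ} (hy : edgePlus a b g ≤ y) :
    nuClamp a b g y = a := by
  have ha := hb.trans hab
  rw [nuClamp, min_eq_left, max_eq_right hab.le]
  by_contra h
  rw [not_le] at h
  have h1 := (nu_le_a hb ha hg).1 h.le
  rw [le_antisymm h1 hy, edgePlus_eq, nu_value hb ha hg ha.le] at h
  exact lt_irrefl _ h

lemma nuClamp_of_mem (hb : 0 < b) (hab : b < a) (hg : 0 < g) {y : ℝ}
    (hy : y ∈ mixInterval a b g) : nuClamp a b g y = nu a b g y := by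
  obtain ⟨h1, h2⟩ := (mem_mixInterval_iff hb (hb.trans hab) hg).1 hy
  rw [nuClamp, min_eq_right h2.le, max_eq_right h1.le]

lemma le_nuClamp (y : ℝ) : b ≤ nuClamp a b g y := le_max_left _ _

lemma continuous_nuClamp : Continuous (nuClamp a b g) :=
  continuous_const.max (continuous_const.min continuous_nu)

lemma continuous_baseDensity (hb : 0 < b) : Continuous (baseDensity a b g) := by
  unfold baseDensity
  exact continuous_const.sub (continuous_const.div continuous_nuClamp
    fun y => (hb.trans_le (le_nuClamp y)).ne')

lemma continuous_basePotential (hb : 0 < b) : Continuous (basePotential a b g) := by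
  have h1 := continuous_baseDensity (a := a) (g := g) hb
  have h2 := continuous_nuClamp (a := a) (b := b) (g := g)
  have h3 : Continuous fun y => a * b / nuClamp a b g y :=
    continuous_const.div h2 fun y => (hb.trans_le (le_nuClamp y)).ne'
  unfold basePotential
  fun_prop

lemma self_eq_of_nu (hb : 0 < b) (hab : b < a) (hg : 0 < g) {y : ℝ} (hy : y ∈ mixInterval a b g) :
    y = g / 2 * (nu a b g y ^ 2 / (a * b) - 1) := by
  have ha := hb.trans hab
  have h1 : -g / 2 ≤ y := by
    have := neg_edgeMinus_eq (a := a) (b := b) (g := g)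
    have : 0 ≤ g / 2 * (b ^ 2 / (a * b)) := by positivity
    linarith [hy.1]
  rw [nu_sq hb ha hg h1]; field_simp; ring

lemma hasDerivAt_nu (hb : 0 < b) (hab : b < a) (hg : 0 < g) {y : ℝ}
    (hy : y ∈ mixInterval a b g) : HasDerivAt (nu a b g) (a * b / (g * nu a b g y)) y := by
  have ha := hb.trans hab
  have h0 : 0 < nu a b g y := hb.trans ((mem_mixInterval_iff hb ha hg).1 hy).1
  have h1 : HasDerivAt (fun y : ℝ => a * b * (1 + 2 * y / g)) (a * b * (2 / g)) y := by
    have := (((hasDerivAt_id y).const_mul 2).div_const g).const_add 1 |>.const_mul (a * b)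
    simpa using this
  have h2 := h1.sqrt (by
    intro h; simp [nu, h] at h0)
  refine h2.congr_deriv ?_
  change a * b * (2 / g) / (2 * nu a b g y) = _
  field_simp

/-- A continuous function differentiable off a countable set, with a continuous candidate
derivative, is differentiable everywhere. -/
lemma hasDerivAt_of_off_countable {f f' : ℝ → ℝ} (hf : Continuous f) (hf' : Continuous f')
    {S : Set ℝ} (hS : S.Countable) (h : ∀ x ∉ S, HasDerivAt f (f' x) x) (x : ℝ) :
    HasDerivAt f (f' x) x := by
  have h1 : f = fun z => f 0 + ∫ y in (0 : ℝ)..z, f' y := by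
    funext z
    rw [MeasureTheory.integral_eq_of_hasDerivAt_off_countable f f' hS hf.continuousOn
      (fun y hy => h y hy.2) (hf'.intervalIntegrable _ _)]
    ring
  rw [h1]
  exact (intervalIntegral.integral_hasDerivAt_right (hf'.intervalIntegrable _ _)
    hf'.stronglyMeasurable.stronglyMeasurableAtFilter hf'.continuousAt).const_add _

lemma hasDerivAt_basePotential (hb : 0 < b) (hab : b < a) (hg : 0 < g) (y : ℝ) :
    HasDerivAt (basePotential a b g) (2 * baseDensity a b g y) y := by
  have ha := hb.trans hab
  refine hasDerivAt_of_off_countable (f' := fun y => 2 * baseDensity a b g y)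
    (continuous_basePotential hb) (continuous_const.mul (continuous_baseDensity hb))
    (S := {-edgeMinus a b g, edgePlus a b g}) (Set.toFinite _).countable ?_ y
  intro y hy
  simp only [mem_insert_iff, mem_singleton_iff, not_or] at hy
  by_cases hm : y ∈ mixInterval a b g
  · have hN : mixInterval a b g ∈ nhds y := isOpen_Ioo.mem_nhds hm
    have h0 : 0 < nu a b g y := hb.trans ((mem_mixInterval_iff hb ha hg).1 hm).1
    have hν := hasDerivAt_nu hb hab hg hm
    have hinv := hν.fun_inv h0.ne'
    have key : HasDerivAt (fun y => g * (a + b) * (a + b - a * b * (nu a b g y)⁻¹ - nu a b g y)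
        + 2 * y * ((a + b) ^ 2 - a * b - (a + b) * (a * b) * (nu a b g y)⁻¹)) _ y :=
      ((((hinv.const_mul (a * b)).const_sub (a + b)).sub hν).const_mul (g * (a + b))).add
        (((hasDerivAt_id y).const_mul 2).mul
          ((hinv.const_mul ((a + b) * (a * b))).const_sub ((a + b) ^ 2 - a * b)))
    refine (key.congr_of_eventuallyEq ?_).congr_deriv ?_
    · filter_upwards [hN] with z hz
      simp only [basePotential, baseDensity, nuClamp_of_mem hb hab hg hz, div_eq_mul_inv]
    · simp only [baseDensity, nuClamp_of_mem hb hab hg hm, id]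
      have hy2 : y = _ := self_eq_of_nu hb hab hg hm
      generalize nu a b g y = n at *
      subst hy2
      field_simp
      ring
  · rcases lt_or_gt_of_ne hy.1 with h1 | h1
    · have hd : HasDerivAt (fun z : ℝ => 2 * b ^ 2 * z) (2 * b ^ 2) y := by
        simpa using (hasDerivAt_id y).const_mul (2 * b ^ 2)
      refine (hd.congr_of_eventuallyEq ?_).congr_deriv ?_
      · filter_upwards [Iio_mem_nhds h1] with z hz
        simp only [basePotential, baseDensity, nuClamp_of_le hb hab hg (le_of_lt hz)]
        field_simp; ring
      · simp only [baseDensity, nuClamp_of_le hb hab hg h1.le]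
        field_simp; ring
    · have h2 : edgePlus a b g < y := lt_of_le_of_ne (not_lt.1 fun h2 => hm ⟨h1, h2⟩) (Ne.symm hy.2)
      have hd : HasDerivAt (fun z : ℝ => 2 * a ^ 2 * z) (2 * a ^ 2) y := by
        simpa using (hasDerivAt_id y).const_mul (2 * a ^ 2)
      refine (hd.congr_of_eventuallyEq ?_).congr_deriv ?_
      · filter_upwards [Ioi_mem_nhds h2] with z hz
        simp only [basePotential, baseDensity, nuClamp_of_ge hb hab hg (le_of_lt hz)]
        field_simp; ring
      · simp only [baseDensity, nuClamp_of_ge hb hab hg h2.le]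
        field_simp; ring

end

section

variable {a b g : ℝ} {r H : ℝ → ℝ}

/-! ### Perturbing the extremal profile -/

/-- The density after subtracting `η ψ²` from the potential. -/
def pertDensity (a b g η : ℝ) (ψ : ℝ → ℝ) (y : ℝ) : ℝ :=
  baseDensity a b g y - η * (ψ y * deriv ψ y)

/-- The extremal potential lowered by `η ψ²`. -/
def pertPotential (a b g η : ℝ) (ψ : ℝ → ℝ) (y : ℝ) : ℝ :=
  basePotential a b g y - η * ψ y ^ 2

/-- Lowering the potential by a square keeps the flux below the extremal one: the gain `η ψ²` is of
first order, while the loss from the concavity of the extremal flux is quadratic in `η ψ ψ'`. Here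
`n = ν`, `q = ψ`, `q' = ψ'`, and the density enters through
`a b / ν + η ψ ψ' / (a + b) = b + (ρ₊ - ρ) / (a + b)`. -/
lemma flux_le_of_square {n η q q' : ℝ} (hb : 0 < b) (hab : b < a) (hg : 0 < g) (hbn : b < n)
    (hna : n < a) (hη : 0 ≤ η) (hβ : b < a * b / n + η * (q * q') / (a + b))
    (hsmall : η * (g * a ^ 2 * q' ^ 2) ≤ (a + b) * (a * b) * b) :
    (g * (a + b) * (a + b - a * b / n - n) - η * q ^ 2 + g * (n ^ 2 / (a * b) - 1) * (η * (q * q')))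
        * (a * b / n + η * (q * q') / (a + b))
      ≤ g * (a + b) * ((a - (a * b / n + η * (q * q') / (a + b)))
          * (a * b / n + η * (q * q') / (a + b) - b)) := by
  have ha := hb.trans hab
  have hn := hb.trans hbn
  have key : g * (a + b) * ((a - (a * b / n + η * (q * q') / (a + b)))
          * (a * b / n + η * (q * q') / (a + b) - b))
      - (g * (a + b) * (a + b - a * b / n - n) - η * q ^ 2
          + g * (n ^ 2 / (a * b) - 1) * (η * (q * q'))) * (a * b / n + η * (q * q') / (a + b))
      = η * q ^ 2 * (a * b / n + η * (q * q') / (a + b)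
          - η * (g * n ^ 2 * q' ^ 2) / ((a + b) * (a * b))) := by
    field_simp; ring
  have h1 : η * (g * n ^ 2 * q' ^ 2) / ((a + b) * (a * b)) ≤ b := by
    rw [div_le_iff₀ (by positivity)]
    calc η * (g * n ^ 2 * q' ^ 2) ≤ η * (g * a ^ 2 * q' ^ 2) := by gcongr
      _ ≤ _ := by linarith
  have h2 : 0 ≤ η * q ^ 2 * (a * b / n + η * (q * q') / (a + b)
          - η * (g * n ^ 2 * q' ^ 2) / ((a + b) * (a * b))) := by
    apply mul_nonneg (by positivity); linarith
  linarith

/-- The rescaled energy density of the extremal profile as a function of `n = ν`. -/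
def baseEnergy (a b g n : ℝ) : ℝ :=
  g ^ 2 * (a * b - 3 / 2 * (a + b) * n + (a + b) ^ 2 / (2 * (a * b)) * n ^ 2)

/-- The coefficient of the exact derivative in the first variation of the energy. -/
def bdryCoeff (a b g n : ℝ) : ℝ := g ^ 2 / (4 * (a * b)) * (n ^ 2 - 2 * n ^ 3 / (a + b))

/-- The numerator of the perturbation of `g - flux / (ρ - ρ₋)`: its value `g ν / a` on the extremal
profile changes by `η * kinVar / α`, where `α` is the perturbed value of `ρ - ρ₋`. -/
def kinVar (a b g n f f' : ℝ) : ℝ := f - f' * (g * n * (n - b) / (2 * (a * b)))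

/-- Second order expansion of the energy density in the size `η` of the perturbation; here
`n = ν`, `f` is the perturbation of the potential, `f'` its derivative, and `α`, `α₀` are the
perturbed and the extremal values of `ρ - ρ₋`. -/
lemma energy_expansion {n η f f' α α₀ y : ℝ} (hb : 0 < b) (hab : b < a) (hg : 0 < g) (hbn : b < n)
    (hα₀ : α₀ = (a + b) * a * (n - b) / n) (hα : α = α₀ - η * f' / 2) (hα' : 0 < α)
    (hy : y = g / 2 * (n ^ 2 / (a * b) - 1)) :
    1 / 2 * a ^ 2 * (g - (g * (a + b) * (a + b - a * b / n - n) - η * f + y * (η * f')) / α) ^ 2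
        + g * (g * (a + b) * (a + b - a * b / n - n) - η * f + y * (η * f'))
        - 1 / 2 * g ^ 2 * (α + b ^ 2) + g * y * (α + b ^ 2)
      = baseEnergy a b g n
        + η * ((g * n ^ 2 / ((a + b) * (n - b)) - g) * f + bdryCoeff a b g n * f')
        + η ^ 2 * (a * g * n * kinVar a b g n f f' * f' / (2 * (α * α₀))
          + 1 / 2 * a ^ 2 * kinVar a b g n f f' ^ 2 / α ^ 2) := by
  have ha := hb.trans hab
  have hn := hb.trans hbn
  have hnb : 0 < n - b := by linarith
  have hα₀' : 0 < α₀ := by rw [hα₀]; positivity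
  have hu : g * (a + b) * (a + b - a * b / n - n) = g * (a - n) / a * α₀ := by
    rw [hα₀]; field_simp; ring
  have hm : g - (g * (a + b) * (a + b - a * b / n - n) - η * f + y * (η * f')) / α
      = g * n / a + η * kinVar a b g n f f' / α := by
    rw [hu, eq_comm, ← sub_eq_zero, kinVar]
    have : g * n / a + η * (f - f' * (g * n * (n - b) / (2 * (a * b)))) / α
        - (g - (g * (a - n) / a * α₀ - η * f + y * (η * f')) / α)
        = (η * (f - f' * (g * n * (n - b) / (2 * (a * b)))) + (g * n / a - g) * α
          + (g * (a - n) / a * α₀ - η * f + y * (η * f'))) / α := by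
      field_simp; ring
    rw [this, hα, hy, div_eq_zero_iff]; left
    field_simp; ring
  have hinv : 1 / α = 1 / α₀ + η * f' / (2 * (α * α₀)) := by
    field_simp; rw [hα]; ring
  have hcross : a * g * n * kinVar a b g n f f' / α
      = a * g * n * kinVar a b g n f f' / α₀
        + η * (a * g * n * kinVar a b g n f f' * f' / (2 * (α * α₀))) := by
    rw [div_eq_mul_one_div, hinv]; ring
  have hsq : 1 / 2 * a ^ 2 * (g * n / a + η * kinVar a b g n f f' / α) ^ 2
      = 1 / 2 * g ^ 2 * n ^ 2 + η * (a * g * n * kinVar a b g n f f' / α)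
        + η ^ 2 * (1 / 2 * a ^ 2 * kinVar a b g n f f' ^ 2 / α ^ 2) := by
    field_simp; ring
  rw [hm, hsq, hcross, hu, hα]
  have hlin : 1 / 2 * g ^ 2 * n ^ 2 + η * (a * g * n * kinVar a b g n f f' / α₀)
      + g * (g * (a - n) / a * α₀ - η * f + y * (η * f'))
      - 1 / 2 * g ^ 2 * (α₀ - η * f' / 2 + b ^ 2) + g * y * (α₀ - η * f' / 2 + b ^ 2)
      = baseEnergy a b g n
        + η * ((g * n ^ 2 / ((a + b) * (n - b)) - g) * f + bdryCoeff a b g n * f') := by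
    rw [hα₀, hy, baseEnergy, bdryCoeff, kinVar]
    field_simp; ring
  linear_combination hlin

end

section

variable {a b g : ℝ} {r H : ℝ → ℝ}

/-- `ψ` is a bump supported where the first variation of the energy under a decrease of the
potential is negative, with room `c` to the ends of the mixing interval. -/
structure IsUnstableBump (a b g c κ M : ℝ) (ψ : ℝ → ℝ) : Prop where
  smooth : ContDiff ℝ ∞ ψ
  nonneg : ∀ y, 0 ≤ ψ y
  le_one : ∀ y, ψ y ≤ 1
  deriv_le : ∀ y, |deriv ψ y| ≤ M
  supp : ∀ y, (ψ y = 0 ∧ deriv ψ y = 0) ∨ (b + c < nu a b g y ∧ nu a b g y < a - c ∧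
    nu a b g y ^ 2 / (nu a b g y - b) + 3 / 2 * (nu a b g y - (a + b)) < -κ)
  exists_one : ∃ y ∈ mixInterval a b g, ψ y = 1

/-- The threshold on the density ratio enters here: `ν² / (ν - b) + 3 (ν - a - b) / 2` takes a
negative value on `(b, a)` as soon as `5 ν² - 3 (a + 2 b) ν + 3 b (a + b)` has positive
discriminant, that is, `3 a² - 8 a b - 8 b² > 0`. The bump is centred at `ν = 3 (a + 2 b) / 10`,
where this quadratic polynomial is smallest. -/
lemma exists_isUnstableBump (hb : 0 < b) (hab : b < a) (hg : 0 < g)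
    (hthr : 8 * a * b + 8 * b ^ 2 < 3 * a ^ 2) :
    ∃ c κ M ψ, 0 < c ∧ 0 < κ ∧ 0 < M ∧ IsUnstableBump a b g c κ M ψ := by
  have ha := hb.trans hab
  set n := 3 * (a + 2 * b) / 10 with hn
  have h3 : 3 * b < a := by nlinarith
  have hbn : b < n := by rw [hn]; linarith
  have hna : n < a := by rw [hn]; linarith
  set κ := -(n ^ 2 / (n - b) + 3 / 2 * (n - (a + b))) / 2 with hκ
  have hnb : 0 < n - b := by linarith
  have hκ0 : 0 < κ := by
    have : n ^ 2 / (n - b) + 3 / 2 * (n - (a + b))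
        = -(3 / 40 * (3 * a ^ 2 - 8 * a * b - 8 * b ^ 2) / (n - b)) := by
      field_simp; rw [hn]; ring
    have h4 : 0 < 3 / 40 * (3 * a ^ 2 - 8 * a * b - 8 * b ^ 2) / (n - b) := by
      apply div_pos _ hnb; linarith
    rw [hκ, this]; linarith
  set c := min ((n - b) / 2) ((a - n) / 2) with hc
  have hc0 : 0 < c := lt_min (by linarith) (by linarith)
  have hc1 : b + c < n := by have := min_le_left ((n - b) / 2) ((a - n) / 2); linarith
  have hc2 : n < a - c := by have := min_le_right ((n - b) / 2) ((a - n) / 2); linarith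
  set y := g / 2 * (n ^ 2 / (a * b) - 1) with hy
  have hνy : nu a b g y = n := nu_value hb ha hg (by linarith)
  have hν : ContinuousAt (nu a b g) y := continuous_nu.continuousAt
  have hQ : ContinuousAt (fun z => nu a b g z ^ 2 / (nu a b g z - b)
      + 3 / 2 * (nu a b g z - (a + b))) y := by
    refine ((hν.pow 2).div (hν.sub continuousAt_const) ?_).add
      (continuousAt_const.mul (hν.sub continuousAt_const))
    rw [Pi.sub_apply, hνy]; exact hnb.ne'
  have hmem : {z | b + c < nu a b g z ∧ nu a b g z < a - c ∧
      nu a b g z ^ 2 / (nu a b g z - b) + 3 / 2 * (nu a b g z - (a + b)) < -κ} ∈ nhds y := by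
    refine Filter.inter_mem (hν.eventually_const_lt (by rwa [hνy]))
      (Filter.inter_mem (hν.eventually_lt_const (by rwa [hνy])) (hQ.eventually_lt_const ?_))
    simp only [hνy]; linarith
  obtain ⟨ψ, h1, h2, h3, h4, h5⟩ := exists_contDiff_tsupport_subset (n := ⊤) hmem
  obtain ⟨M, hM⟩ := (h2.deriv.exists_bound_of_continuous
    (h3.continuous_deriv (by simp)) : ∃ C, ∀ x, ‖deriv ψ x‖ ≤ C)
  refine ⟨c, κ, max M 1, ψ, hc0, hκ0, by positivity, h3, ?_, ?_, ?_, ?_, y, ?_, h5⟩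
  · exact fun z => (h4 (mem_range_self z)).1
  · exact fun z => (h4 (mem_range_self z)).2
  · exact fun z => (hM z).trans (le_max_left _ _)
  · intro z
    by_cases hz : z ∈ tsupport ψ
    · exact .inr (h1 hz)
    · refine .inl ⟨image_eq_zero_of_notMem_tsupport hz, ?_⟩
      exact image_eq_zero_of_notMem_tsupport fun h => hz (closure_minimal (support_deriv_subset)
        (isClosed_tsupport ψ) h)
  · rw [mem_mixInterval_iff hb ha hg, hνy]; exact ⟨hbn, hna⟩

/-- The size `η` of the perturbation is small compared with the data of the bump: `lower` and
`upper` keep the density between `ρ₋` and `ρ₊`, `flux` keeps the flux nonnegative, and `square` is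
what `flux_le_of_square` asks for. -/
structure IsSmallAmplitude (a b g c M η : ℝ) : Prop where
  pos : 0 < η
  lower : η * M ≤ (a + b) * c / 2
  upper : η * M < (a + b) * (b * c / a)
  flux : η * (1 + g * (a / b) * M) ≤ g * (a + b) * (c ^ 2 / a)
  square : η * (g * a ^ 2 * M ^ 2) ≤ (a + b) * (a * b) * b

variable {c κ M η : ℝ} {ψ : ℝ → ℝ}

lemma exists_isSmallAmplitude (hb : 0 < b) (hab : b < a) (hg : 0 < g) (hc : 0 < c)
    {C d : ℝ} (hd : 0 < d) :
    ∃ η, IsSmallAmplitude a b g c M η ∧ η * C < d := by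
  have ha := hb.trans hab
  have ev : ∀ A e : ℝ, 0 < e → ∀ᶠ η in nhdsWithin (0 : ℝ) (Ioi 0), η * A < e := by
    intro A e he
    have : ContinuousAt (fun η : ℝ => η * A) 0 := by fun_prop
    exact nhdsWithin_le_nhds (this.eventually_lt_const (by simpa using he))
  have h := (((ev M ((a + b) * c / 2) (by positivity)).and
    (ev M ((a + b) * (b * c / a)) (by positivity))).and
    ((ev (1 + g * (a / b) * M) (g * (a + b) * (c ^ 2 / a)) (by positivity)).and
    (ev (g * a ^ 2 * M ^ 2) ((a + b) * (a * b) * b) (by positivity)))).and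
    ((ev C d hd).and self_mem_nhdsWithin)
  obtain ⟨η, ⟨⟨h1, h2⟩, h3, h4⟩, h5, h6⟩ := h.exists
  exact ⟨η, ⟨h6, h1.le, h2, h3.le, h4.le⟩, h5⟩

lemma flux_pert_eq (hb : 0 < b) (hab : b < a) (hg : 0 < g) {y : ℝ} (hy : y ∈ mixInterval a b g) :
    flux (pertDensity a b g η ψ) (pertPotential a b g η ψ) y
      = g * (a + b) * (a + b - a * b / nu a b g y - nu a b g y) - η * ψ y ^ 2
        + 2 * y * (η * (ψ y * deriv ψ y)) := by
  simp only [flux, pertDensity, pertPotential, basePotential, nuClamp_of_mem hb hab hg hy]; ring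

lemma pertDensity_sub (hb : 0 < b) (hab : b < a) (hg : 0 < g) {y : ℝ}
    (hy : y ∈ mixInterval a b g) :
    pertDensity a b g η ψ y - b ^ 2
      = (a + b) * a * (nu a b g y - b) / nu a b g y - η * (ψ y * deriv ψ y) := by
  have hn := hb.trans ((mem_mixInterval_iff hb (hb.trans hab) hg).1 hy).1
  simp only [pertDensity, baseDensity, nuClamp_of_mem hb hab hg hy]
  field_simp; ring

namespace IsUnstableBump

lemma abs_mul_deriv_le (h : IsUnstableBump a b g c κ M ψ) (y : ℝ) : |ψ y * deriv ψ y| ≤ M := by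
  rw [abs_mul, abs_of_nonneg (h.nonneg y)]
  calc ψ y * |deriv ψ y| ≤ 1 * |deriv ψ y| := by gcongr; exact h.le_one y
    _ ≤ M := by rw [one_mul]; exact h.deriv_le y

lemma mul_abs_le (h : IsUnstableBump a b g c κ M ψ) (hη : 0 < η) (y : ℝ) :
    |η * (ψ y * deriv ψ y)| ≤ η * M := by
  rw [abs_mul, abs_of_pos hη]
  exact mul_le_mul_of_nonneg_left (h.abs_mul_deriv_le y) hη.le

lemma eq_zero_of_notMem (h : IsUnstableBump a b g c κ M ψ) (hb : 0 < b) (hab : b < a)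
    (hg : 0 < g) (hc : 0 < c) {y : ℝ} (hy : y ∉ mixInterval a b g) :
    ψ y = 0 ∧ deriv ψ y = 0 := by
  refine (h.supp y).resolve_right fun h1 => hy ?_
  rw [mem_mixInterval_iff hb (hb.trans hab) hg]
  exact ⟨by linarith [h1.1], by linarith [h1.2.1]⟩

/-- On the support of the bump, `ρ - ρ₋` stays away from zero. -/
lemma le_pertDensity_sub (h : IsUnstableBump a b g c κ M ψ) (hb : 0 < b) (hab : b < a)
    (hg : 0 < g) (hη : IsSmallAmplitude a b g c M η) {y : ℝ}
    (hy : y ∈ mixInterval a b g) (h1 : b + c < nu a b g y) :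
    (a + b) * c / 2 ≤ pertDensity a b g η ψ y - b ^ 2 := by
  have ha := hb.trans hab
  obtain ⟨h2, h3⟩ := (mem_mixInterval_iff hb ha hg).1 hy
  have hn := hb.trans h2
  rw [pertDensity_sub hb hab hg hy]
  have h4 := (abs_le.1 (h.mul_abs_le hη.pos y)).2
  have h5 : (a + b) * c ≤ (a + b) * a * (nu a b g y - b) / nu a b g y := by
    rw [le_div_iff₀ hn]
    calc (a + b) * c * nu a b g y ≤ (a + b) * (nu a b g y - b) * a := by
          gcongr; linarith
      _ = _ := by ring
  linarith [hη.lower]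

lemma pert_density_gt (h : IsUnstableBump a b g c κ M ψ) (hb : 0 < b) (hab : b < a)
    (hg : 0 < g) (hc : 0 < c) (hη : IsSmallAmplitude a b g c M η) {y : ℝ}
    (hy : y ∈ mixInterval a b g) : 0 < pertDensity a b g η ψ y - b ^ 2 := by
  have ha := hb.trans hab
  obtain ⟨h2, h3⟩ := (mem_mixInterval_iff hb ha hg).1 hy
  have hn := hb.trans h2
  rcases h.supp y with ⟨h0, -⟩ | ⟨h1, -⟩
  · rw [pertDensity_sub hb hab hg hy, h0]
    have : 0 < nu a b g y - b := by linarith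
    simp only [zero_mul, mul_zero, sub_zero]; positivity
  · refine lt_of_lt_of_le ?_ (h.le_pertDensity_sub hb hab hg hη hy h1)
    positivity

lemma lt_frac_add (h : IsUnstableBump a b g c κ M ψ) (hb : 0 < b) (hab : b < a)
    (hg : 0 < g) (hη : IsSmallAmplitude a b g c M η) {y : ℝ}
    (hy : y ∈ mixInterval a b g) :
    b < a * b / nu a b g y + η * (ψ y * deriv ψ y) / (a + b) := by
  have ha := hb.trans hab
  obtain ⟨h2, h3⟩ := (mem_mixInterval_iff hb ha hg).1 hy
  have hn := hb.trans h2
  have e : a * b / nu a b g y - b = b * (a - nu a b g y) / nu a b g y := by field_simp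
  rcases h.supp y with ⟨h0, -⟩ | ⟨-, h1, -⟩
  · have : 0 < a - nu a b g y := by linarith
    have : 0 < b * (a - nu a b g y) / nu a b g y := by positivity
    rw [h0]; simp only [zero_mul, mul_zero, zero_div, add_zero]; linarith
  · have h4 := (abs_le.1 (h.mul_abs_le hη.pos y)).1
    have h5 : b * c / a ≤ b * (a - nu a b g y) / nu a b g y := by
      gcongr
      linarith
    have h6 : -(b * c / a) < η * (ψ y * deriv ψ y) / (a + b) := by
      rw [lt_div_iff₀ (by positivity)]; linarith [hη.upper]
    linarith

/-- A small perturbation of the extremal profile by a squared bump is an admissible profile. -/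
theorem isProfile (h : IsUnstableBump a b g c κ M ψ) (hb : 0 < b) (hab : b < a)
    (hg : 0 < g) (hc : 0 < c) (hη : IsSmallAmplitude a b g c M η) :
    IsProfile a b g (pertDensity a b g η ψ) (pertPotential a b g η ψ) := by
  have ha := hb.trans hab
  have hψ := h.smooth.continuous
  have hψ' : Continuous (deriv ψ) := h.smooth.continuous_deriv (by simp)
  have hout {y : ℝ} (hy : y ∉ mixInterval a b g) := h.eq_zero_of_notMem hb hab hg hc hy
  refine ⟨?_, ?_, ?_, ?_, ?_, ?_, ?_⟩
  · have := continuous_baseDensity (a := a) (g := g) hb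
    unfold pertDensity; fun_prop
  · intro y
    have h1 : HasDerivAt ψ (deriv ψ y) y :=
      (h.smooth.differentiable (by simp) y).hasDerivAt
    refine ((hasDerivAt_basePotential hb hab hg y).sub ((h1.pow 2).const_mul η)).congr_deriv ?_
    simp only [pertDensity]; push_cast; ring
  · intro y hy
    obtain ⟨h1, h2⟩ := hout (y := y) fun h => not_lt.2 hy h.1
    simp only [pertDensity, pertPotential, basePotential, baseDensity, h1,
      nuClamp_of_le hb hab hg hy]
    constructor <;> field_simp <;> ring
  · intro y hy
    obtain ⟨h1, h2⟩ := hout (y := y) fun h => not_lt.2 hy h.2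
    simp only [pertDensity, pertPotential, basePotential, baseDensity, h1,
      nuClamp_of_ge hb hab hg hy]
    constructor <;> field_simp <;> ring
  · intro y hy
    have h1 := h.pert_density_gt hb hab hg hc hη hy
    have h2 := h.lt_frac_add hb hab hg hη hy
    refine ⟨by linarith, ?_⟩
    simp only [pertDensity, baseDensity, nuClamp_of_mem hb hab hg hy]
    have h3 : (a + b) * b < (a + b) * (a * b / nu a b g y + η * (ψ y * deriv ψ y) / (a + b)) :=
      mul_lt_mul_of_pos_left h2 (by positivity)
    have h4 : (a + b) * (a * b / nu a b g y + η * (ψ y * deriv ψ y) / (a + b))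
        = (a + b) * (a * b) / nu a b g y + η * (ψ y * deriv ψ y) := by field_simp
    nlinarith
  · intro y hy
    obtain ⟨h2, h3⟩ := (mem_mixInterval_iff hb ha hg).1 hy
    have hn := hb.trans h2
    rw [flux_pert_eq hb hab hg hy]
    have e : g * (a + b) * (a + b - a * b / nu a b g y - nu a b g y)
        = g * (a + b) * ((a - nu a b g y) * (nu a b g y - b) / nu a b g y) := by field_simp; ring
    rw [e]
    rcases h.supp y with ⟨h0, -⟩ | ⟨h1, h1', -⟩
    · have h4 : 0 < a - nu a b g y := by linarith
      have h5 : 0 < nu a b g y - b := by linarith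
      simp only [h0]
      have : 0 < g * (a + b) * ((a - nu a b g y) * (nu a b g y - b) / nu a b g y) := by positivity
      linarith
    · have h5 : c ^ 2 / a ≤ (a - nu a b g y) * (nu a b g y - b) / nu a b g y := by
        rw [sq]; gcongr <;> linarith
      have h6 : g * (a + b) * (c ^ 2 / a)
          ≤ g * (a + b) * ((a - nu a b g y) * (nu a b g y - b) / nu a b g y) := by gcongr
      have h7 : ψ y ^ 2 ≤ 1 := pow_le_one₀ (h.nonneg y) (h.le_one y)
      have h8 : |2 * y| ≤ g * (a / b) := by
        have e1 := neg_edgeMinus_eq (a := a) (b := b) (g := g)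
        have e2 := hy.1
        have e3 := hy.2
        simp only [edgeMinus, edgePlus] at e2 e3
        have : 0 < g * (b / a) := by positivity
        have : 1 ≤ a / b := (one_le_div hb).2 hab.le
        have : g ≤ g * (a / b) := le_mul_of_one_le_right hg.le this
        rw [abs_le]; constructor <;> nlinarith
      have h9 : |2 * y * (η * (ψ y * deriv ψ y))| ≤ g * (a / b) * (η * M) := by
        rw [abs_mul]
        exact mul_le_mul h8 (h.mul_abs_le hη.pos y) (abs_nonneg _) (by positivity)
      have h10 := (abs_le.1 h9).1
      have h11 : η * ψ y ^ 2 ≤ η := mul_le_of_le_one_right hη.pos.le h7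
      have := hη.flux
      nlinarith
  · intro y hy
    obtain ⟨h2, h3⟩ := (mem_mixInterval_iff hb ha hg).1 hy
    have hn := hb.trans h2
    have hsm : η * (g * a ^ 2 * deriv ψ y ^ 2) ≤ (a + b) * (a * b) * b := by
      refine le_trans ?_ hη.square
      have := hη.pos
      have : deriv ψ y ^ 2 ≤ M ^ 2 :=
        sq_le_sq' (abs_le.1 (h.deriv_le y)).1 (abs_le.1 (h.deriv_le y)).2
      gcongr
    have key := flux_le_of_square hb hab hg h2 h3 hη.pos.le (h.lt_frac_add hb hab hg hη hy) hsm
    have hy2 : 2 * y = g * (nu a b g y ^ 2 / (a * b) - 1) := by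
      linarith [self_eq_of_nu hb hab hg hy]
    rw [flux_pert_eq hb hab hg hy, hy2]
    simp only [pertDensity, baseDensity, nuClamp_of_mem hb hab hg hy]
    set n := nu a b g y
    set d := a * b / n + η * (ψ y * deriv ψ y) / (a + b) with hd
    have e1 : (a + b) ^ 2 - a * b - (a + b) * (a * b) / n - η * (ψ y * deriv ψ y)
        = (a + b) ^ 2 - a * b - (a + b) * d := by rw [hd]; field_simp; ring
    rw [e1]
    have := mul_le_mul_of_nonneg_left key (a := (a - b) * (a + b)) (by
      apply mul_nonneg <;> linarith)
    linear_combination this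

end IsUnstableBump

end

section

variable {a b g : ℝ} {r H : ℝ → ℝ}
variable {c κ M η : ℝ} {ψ : ℝ → ℝ}

/-! ### The energy of the perturbed profile -/

/-- A bound for `kinVar` along a bump with `0 ≤ ψ ≤ 1` and `|ψ'| ≤ M`. -/
def kinVarBound (a b g M : ℝ) : ℝ := 1 + 2 * M * (g * a ^ 2 / (2 * (a * b)))

/-- The constant in the quadratic remainder of the energy expansion. -/
def remainderConst (a b g c M : ℝ) : ℝ :=
  a * g * a * kinVarBound a b g M * (2 * M) / (2 * ((a + b) * c / 2 * ((a + b) * c / 2)))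
    + 1 / 2 * a ^ 2 * kinVarBound a b g M ^ 2 / ((a + b) * c / 2) ^ 2

/-- The part of the energy density, up to first order in `η`, that has an explicit primitive. -/
def exactDensity (a b g η : ℝ) (ψ : ℝ → ℝ) (y : ℝ) : ℝ :=
  baseEnergy a b g (nu a b g y)
    + η * (g * (1 / 2 - 3 * nu a b g y / (2 * (a + b))) * ψ y ^ 2
      + bdryCoeff a b g (nu a b g y) * (2 * ψ y * deriv ψ y))

lemma remainderConst_nonneg (hb : 0 < b) (hab : b < a) (hg : 0 < g) (hM : 0 < M) (hc : 0 < c) :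
    0 ≤ remainderConst a b g c M := by
  have ha := hb.trans hab
  unfold remainderConst kinVarBound
  positivity

lemma remainder_le {n η f f' α α₀ d : ℝ} (hb : 0 < b) (hab : b < a) (hg : 0 < g) (hbn : b < n)
    (hna : n < a) (hf : |f| ≤ 1) (hf' : |f'| ≤ 2 * M) (hd : 0 < d) (hα : d ≤ α) (hα₀ : d ≤ α₀) :
    η ^ 2 * (a * g * n * kinVar a b g n f f' * f' / (2 * (α * α₀))
          + 1 / 2 * a ^ 2 * kinVar a b g n f f' ^ 2 / α ^ 2)
      ≤ η ^ 2 * (a * g * a * kinVarBound a b g M * (2 * M) / (2 * (d * d))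
          + 1 / 2 * a ^ 2 * kinVarBound a b g M ^ 2 / d ^ 2) := by
  have ha := hb.trans hab
  have hn := hb.trans hbn
  have hM : 0 ≤ 2 * M := (abs_nonneg _).trans hf'
  have hB : |kinVar a b g n f f'| ≤ kinVarBound a b g M := by
    unfold kinVar kinVarBound
    refine (abs_sub _ _).trans (add_le_add hf ?_)
    rw [abs_mul]
    have h0 : 0 ≤ n - b := by linarith
    have h1 : |g * n * (n - b) / (2 * (a * b))| ≤ g * a ^ 2 / (2 * (a * b)) := by
      rw [abs_of_nonneg (by positivity)]
      refine div_le_div_of_nonneg_right ?_ (by positivity)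
      calc g * n * (n - b) ≤ g * a * a := by gcongr; linarith
        _ = g * a ^ 2 := by ring
    gcongr
  have hB0 : 0 ≤ kinVarBound a b g M := (abs_nonneg _).trans hB
  have hsq : kinVar a b g n f f' ^ 2 ≤ kinVarBound a b g M ^ 2 :=
    sq_le_sq' (abs_le.1 hB).1 (abs_le.1 hB).2
  have hprod : a * g * n * kinVar a b g n f f' * f'
      ≤ a * g * a * kinVarBound a b g M * (2 * M) := by
    refine (le_abs_self _).trans ?_
    rw [abs_mul, abs_mul, abs_of_pos (show 0 < a * g * n by positivity)]
    gcongr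
  have hα' : 0 ≤ α := hd.le.trans hα
  gcongr

lemma energyDensity_pert_le (h : IsUnstableBump a b g c κ M ψ) (hb : 0 < b) (hab : b < a)
    (hg : 0 < g) (hc : 0 < c) (hM : 0 < M) (hη : IsSmallAmplitude a b g c M η) {y : ℝ}
    (hy : y ∈ mixInterval a b g) :
    energyDensity a b g (pertDensity a b g η ψ) (pertPotential a b g η ψ) y
      ≤ exactDensity a b g η ψ y - η * (g * κ / (a + b) * ψ y ^ 2)
        + η ^ 2 * remainderConst a b g c M := by
  have ha := hb.trans hab
  obtain ⟨h2, h3⟩ := (mem_mixInterval_iff hb ha hg).1 hy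
  have hn := hb.trans h2
  have hα := pertDensity_sub (η := η) (ψ := ψ) hb hab hg hy
  have hpos := h.pert_density_gt hb hab hg hc hη hy
  have hy2 := self_eq_of_nu hb hab hg hy
  have hexp := energy_expansion (η := η) (f := ψ y ^ 2) (f' := 2 * ψ y * deriv ψ y)
    (α := pertDensity a b g η ψ y - b ^ 2) hb hab hg h2 rfl (by rw [hα]; ring) hpos hy2
  rw [show energyDensity a b g (pertDensity a b g η ψ) (pertPotential a b g η ψ) y = _ by
    refine Eq.trans ?_ hexp
    simp only [energyDensity, kinBound, flux_pert_eq hb hab hg hy]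
    ring, exactDensity]
  have hR : η ^ 2 * (a * g * nu a b g y
        * kinVar a b g (nu a b g y) (ψ y ^ 2) (2 * ψ y * deriv ψ y) * (2 * ψ y * deriv ψ y)
        / (2 * ((pertDensity a b g η ψ y - b ^ 2)
          * ((a + b) * a * (nu a b g y - b) / nu a b g y)))
      + 1 / 2 * a ^ 2 * kinVar a b g (nu a b g y) (ψ y ^ 2) (2 * ψ y * deriv ψ y) ^ 2
        / (pertDensity a b g η ψ y - b ^ 2) ^ 2) ≤ η ^ 2 * remainderConst a b g c M := by
    rcases h.supp y with ⟨h0, h0'⟩ | ⟨h1, -⟩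
    · have := remainderConst_nonneg hb hab hg hM hc
      simp only [h0, h0', kinVar]
      norm_num
      positivity
    · have hd : (a + b) * c / 2 ≤ (a + b) * a * (nu a b g y - b) / nu a b g y := by
        rw [le_div_iff₀ hn]
        calc (a + b) * c / 2 * nu a b g y ≤ (a + b) * c * nu a b g y := by
              have : 0 < (a + b) * c * nu a b g y := by positivity
              linarith
          _ ≤ (a + b) * (nu a b g y - b) * a := by gcongr; linarith
          _ = _ := by ring
      refine remainder_le hb hab hg h2 h3 ?_ ?_ (by positivity)
        (h.le_pertDensity_sub hb hab hg hη hy h1) hd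
      · rw [abs_of_nonneg (sq_nonneg _)]
        exact pow_le_one₀ (h.nonneg y) (h.le_one y)
      · rw [mul_assoc, abs_mul, abs_two]
        linarith [h.abs_mul_deriv_le y]
  have hL : (g * nu a b g y ^ 2 / ((a + b) * (nu a b g y - b)) - g) * ψ y ^ 2
      ≤ g * (1 / 2 - 3 * nu a b g y / (2 * (a + b))) * ψ y ^ 2
        - g * κ / (a + b) * ψ y ^ 2 := by
    rcases h.supp y with ⟨h0, h0'⟩ | ⟨-, -, h1⟩
    · simp [h0]
    · rw [← sub_mul]
      refine mul_le_mul_of_nonneg_right ?_ (sq_nonneg _)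
      have hnb : 0 < nu a b g y - b := by linarith
      have e : g * (1 / 2 - 3 * nu a b g y / (2 * (a + b))) - g * κ / (a + b)
          - (g * nu a b g y ^ 2 / ((a + b) * (nu a b g y - b)) - g)
          = g / (a + b) * (-κ - (nu a b g y ^ 2 / (nu a b g y - b)
            + 3 / 2 * (nu a b g y - (a + b)))) := by
        field_simp; ring
      have : 0 ≤ g / (a + b) * (-κ - (nu a b g y ^ 2 / (nu a b g y - b)
            + 3 / 2 * (nu a b g y - (a + b)))) := mul_nonneg (by positivity) (by linarith)
      linarith
  have := mul_le_mul_of_nonneg_left hL hη.pos.le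
  linarith

lemma continuous_exactDensity (hψ : ContDiff ℝ ∞ ψ) : Continuous (exactDensity a b g η ψ) := by
  have h1 := hψ.continuous
  have h2 : Continuous (deriv ψ) := hψ.continuous_deriv (by simp)
  have h3 := continuous_nu (a := a) (b := b) (g := g)
  unfold exactDensity baseEnergy bdryCoeff
  fun_prop

/-- The extremal profile conserves the energy exactly, and the exact part of the first variation
integrates to zero. -/
lemma integral_exactDensity (h : IsUnstableBump a b g c κ M ψ) (hb : 0 < b) (hab : b < a)
    (hg : 0 < g) (hc : 0 < c) :
    ∫ y in mixInterval a b g, exactDensity a b g η ψ y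
      = g / 2 * (a ^ 2 * edgePlus a b g ^ 2 - b ^ 2 * edgeMinus a b g ^ 2) := by
  have ha := hb.trans hab
  have hle : -edgeMinus a b g ≤ edgePlus a b g := by
    linarith [edgeMinus_pos hb hab hg, edgePlus_pos hb hab hg]
  have h1 := h.smooth.continuous
  have h2 : Continuous (deriv ψ) := h.smooth.continuous_deriv (by simp)
  have h3 := continuous_nu (a := a) (b := b) (g := g)
  -- A primitive of `exactDensity`. The bump vanishes at both ends, so only the first term, the
  -- energy of the extremal profile, contributes to the boundary values.
  set F : ℝ → ℝ := fun y =>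
    g ^ 3 / (8 * (a * b) ^ 2) * (nu a b g y ^ 2 * ((a + b) * nu a b g y - 2 * (a * b)) ^ 2)
      + η * (bdryCoeff a b g (nu a b g y) * ψ y ^ 2) with hF
  have hFc : Continuous F := by rw [hF]; unfold bdryCoeff; fun_prop
  have hderiv : ∀ y ∈ Ioo (-edgeMinus a b g) (edgePlus a b g),
      HasDerivAt F (exactDensity a b g η ψ y) y := by
    intro y hy
    have hn := hb.trans ((mem_mixInterval_iff hb ha hg).1 hy).1
    have hν := hasDerivAt_nu hb hab hg hy
    have hψ : HasDerivAt ψ (deriv ψ y) y := (h.smooth.differentiable (by simp) y).hasDerivAt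
    have hT : HasDerivAt (fun y => g ^ 2 / (4 * (a * b)) *
        (nu a b g y ^ 2 - 2 * nu a b g y ^ 3 / (a + b))) _ y :=
      ((hν.fun_pow 2).sub (((hν.fun_pow 3).const_mul 2).div_const (a + b))).const_mul
        (g ^ 2 / (4 * (a * b)))
    have hd := (((hν.fun_pow 2).mul
      (((hν.const_mul (a + b)).sub_const (2 * (a * b))).fun_pow 2)).const_mul
        (g ^ 3 / (8 * (a * b) ^ 2))).add ((hT.mul (hψ.fun_pow 2)).const_mul η)
    refine hd.congr_deriv ?_
    simp only [exactDensity, baseEnergy, bdryCoeff]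
    generalize nu a b g y = n at *
    push_cast
    field_simp
    ring
  rw [mixInterval, ← integral_Ioc_eq_integral_Ioo, ← intervalIntegral.integral_of_le hle,
    intervalIntegral.integral_eq_sub_of_hasDerivAt_of_le hle hFc.continuousOn hderiv
      ((continuous_exactDensity h.smooth).intervalIntegrable _ _)]
  have e1 : nu a b g (edgePlus a b g) = a := by
    rw [edgePlus_eq]; exact nu_value hb ha hg ha.le
  have e2 : nu a b g (-edgeMinus a b g) = b := by
    rw [neg_edgeMinus_eq]; exact nu_value hb ha hg hb.le
  have z1 := (h.eq_zero_of_notMem hb hab hg hc (y := edgePlus a b g) fun h => h.2.false).1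
  have z2 := (h.eq_zero_of_notMem hb hab hg hc (y := -edgeMinus a b g) fun h => h.1.false).1
  simp only [hF, e1, e2, z1, z2]
  unfold edgePlus edgeMinus
  field_simp
  ring

/-- There is an admissible profile whose energy lies strictly below that of the initial state. -/
theorem exists_profile (hb : 0 < b) (hab : b < a) (hg : 0 < g)
    (hthr : 8 * a * b + 8 * b ^ 2 < 3 * a ^ 2) :
    ∃ r H, IsProfile a b g r H ∧ ∫ y in mixInterval a b g, energyDensity a b g r H y
      < g / 2 * (a ^ 2 * edgePlus a b g ^ 2 - b ^ 2 * edgeMinus a b g ^ 2) := by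
  have ha := hb.trans hab
  obtain ⟨c, κ, M, ψ, hc, hκ, hM, h⟩ := exists_isUnstableBump hb hab hg hthr
  have hle : -edgeMinus a b g ≤ edgePlus a b g := by
    linarith [edgeMinus_pos hb hab hg, edgePlus_pos hb hab hg]
  have hψ := h.smooth.continuous
  set I := ∫ y in mixInterval a b g, ψ y ^ 2 with hI
  set len := edgePlus a b g + edgeMinus a b g with hlen
  have hIpos : 0 < I := by
    obtain ⟨y, hy, h1⟩ := h.exists_one
    rw [hI, mixInterval, ← integral_Ioc_eq_integral_Ioo, ← intervalIntegral.integral_of_le hle]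
    exact intervalIntegral.integral_pos (by linarith [edgeMinus_pos hb hab hg, edgePlus_pos hb hab hg])
      (by fun_prop) (fun z _ => sq_nonneg _) ⟨y, Ioo_subset_Icc_self hy, by simp [h1]⟩
  obtain ⟨η, hη, hη'⟩ := exists_isSmallAmplitude (M := M) hb hab hg hc
    (C := remainderConst a b g c M * len) (d := g * κ / (a + b) * I) (by positivity)
  have hp := h.isProfile hb hab hg hc hη
  refine ⟨_, _, hp, ?_⟩
  have integ {f : ℝ → ℝ} (hf : Continuous f) : IntegrableOn f (mixInterval a b g) :=
    (hf.continuousOn.integrableOn_compact isCompact_Icc).mono_set Ioo_subset_Icc_self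
  have hex := continuous_exactDensity (a := a) (b := b) (g := g) (η := η) h.smooth
  have i1 := integ hex
  have i2 : IntegrableOn (fun y => η * (g * κ / (a + b) * ψ y ^ 2)) (mixInterval a b g) :=
    integ (by fun_prop)
  have i3 : IntegrableOn (fun _ => η ^ 2 * remainderConst a b g c M) (mixInterval a b g) :=
    integ continuous_const
  calc _ ≤ ∫ y in mixInterval a b g, (exactDensity a b g η ψ y
        - η * (g * κ / (a + b) * ψ y ^ 2) + η ^ 2 * remainderConst a b g c M) :=
      setIntegral_mono_on (hp.integrableOn_energyDensity hb hab hg) ((i1.sub i2).add i3)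
        measurableSet_Ioo fun y hy => energyDensity_pert_le h hb hab hg hc hM hη hy
    _ = g / 2 * (a ^ 2 * edgePlus a b g ^ 2 - b ^ 2 * edgeMinus a b g ^ 2)
        - η * (g * κ / (a + b) * I) + η ^ 2 * remainderConst a b g c M * len := by
      have e := integral_add (i1.sub i2) i3
      simp only [Pi.sub_apply] at e
      rw [e, integral_sub i1 i2, integral_exactDensity h hb hab hg hc,
        integral_const_mul, integral_const_mul, setIntegral_const, ← hI]
      have : volume.real (mixInterval a b g) = len := by
        rw [mixInterval, Real.volume_real_Ioo_of_le hle, hlen]; ring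
      rw [this, smul_eq_mul]; ring
    _ < _ := by
      have := mul_lt_mul_of_pos_left hη' hη.pos
      linarith

end

section

/-! ### Calculus of test functions -/

/-- The point of the plane with coordinates `x₁`, `x₂`. -/
def pt (x₁ x₂ : ℝ) : Plane := !₂[x₁, x₂]

@[simp] lemma pt_zero (x₁ x₂ : ℝ) : pt x₁ x₂ 0 = x₁ := rfl
@[simp] lemma pt_one (x₁ x₂ : ℝ) : pt x₁ x₂ 1 = x₂ := rfl

lemma hasDerivAt_pt_fst (x₁ x₂ : ℝ) :
    HasDerivAt (fun x => pt x x₂) (EuclideanSpace.single 0 1) x₁ := by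
  have : (fun x => pt x x₂) = fun x => pt 0 x₂ + x • EuclideanSpace.single 0 (1 : ℝ) := by
    funext x; ext i; fin_cases i <;> simp [pt]
  rw [this]
  simpa using ((hasDerivAt_id x₁).smul_const (EuclideanSpace.single 0 (1 : ℝ))).const_add (pt 0 x₂)

lemma hasDerivAt_pt_snd (x₁ x₂ : ℝ) :
    HasDerivAt (fun x => pt x₁ x) (EuclideanSpace.single 1 1) x₂ := by
  have : (fun x => pt x₁ x) = fun x => pt x₁ 0 + x • EuclideanSpace.single 1 (1 : ℝ) := by
    funext x; ext i; fin_cases i <;> simp [pt]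
  rw [this]
  simpa using ((hasDerivAt_id x₂).smul_const (EuclideanSpace.single 1 (1 : ℝ))).const_add (pt x₁ 0)

lemma continuous_pt : Continuous fun q : ℝ × ℝ => pt q.1 q.2 := by
  unfold pt
  refine (PiLp.continuous_toLp 2 _).comp (continuous_pi fun i => ?_)
  fin_cases i
  · exact continuous_fst
  · exact continuous_snd

namespace IsTest

variable {A : Set (Plane × ℝ)} {Ψ : Plane × ℝ → ℝ} {Φ : Plane × ℝ → Plane}

lemma fderiv_apply {F : Type*} [NormedAddCommGroup F] [NormedSpace ℝ F] {f : Plane × ℝ → F}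
    (h : IsTest A f) (w : Plane × ℝ) : IsTest A fun p => fderiv ℝ f p w where
  smooth := (h.smooth.fderiv_right (m := ∞) (by simp)).clm_apply contDiff_const
  compact := (h.compact.fderiv ℝ).comp_left (g := fun L : Plane × ℝ →L[ℝ] F => L w) (by simp)
  support := by
    refine (closure_mono fun p hp => ?_).trans ((tsupport_fderiv_subset ℝ).trans h.support)
    rw [Function.mem_support] at hp ⊢
    intro h0; apply hp; simp [h0]

lemma dt {F : Type*} [NormedAddCommGroup F] [NormedSpace ℝ F] {f : Plane × ℝ → F}
    (h : IsTest A f) : IsTest A (dt f) := h.fderiv_apply _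

lemma dx {F : Type*} [NormedAddCommGroup F] [NormedSpace ℝ F] {f : Plane × ℝ → F}
    (h : IsTest A f) (j : Fin 2) : IsTest A (dx j f) := h.fderiv_apply _

lemma coord (h : IsTest A Φ) (i : Fin 2) : IsTest A fun p => Φ p i where
  smooth := (contDiff_piLp_apply (p := 2) (i := i)).comp h.smooth
  compact := h.compact.comp_left (g := fun v : Plane => v i) (by simp)
  support := (closure_mono fun p hp => by
    rw [Function.mem_support] at hp ⊢
    intro h0; apply hp; simp [h0]).trans h.support

lemma fderiv_coord (h : IsTest A Φ) (i : Fin 2) (p w : Plane × ℝ) :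
    fderiv ℝ Φ p w i = fderiv ℝ (fun p => Φ p i) p w := by
  have h1 : HasFDerivAt Φ (fderiv ℝ Φ p) p := (h.smooth.differentiable (by simp) p).hasFDerivAt
  have h2 := ((EuclideanSpace.proj (𝕜 := ℝ) i).hasFDerivAt (x := Φ p)).comp p h1
  have h3 : HasFDerivAt (fun p => Φ p i) _ p := h2
  rw [h3.fderiv]; rfl

lemma eq_zero (h : IsTest A Ψ) {p : Plane × ℝ} (hp : p ∉ A) : Ψ p = 0 :=
  image_eq_zero_of_notMem_tsupport fun h1 => hp (h.support h1)

lemma exists_bound (h : IsTest A Ψ) : ∃ C, ∀ p, |Ψ p| ≤ C :=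
  h.compact.exists_bound_of_continuous h.smooth.continuous

lemma hasDerivAt_t (h : IsTest A Ψ) (x : Plane) (t : ℝ) :
    HasDerivAt (fun t => Ψ (x, t)) (RayleighTaylor.dt Ψ (x, t)) t := by
  have h1 : HasFDerivAt Ψ (fderiv ℝ Ψ (x, t)) (x, t) :=
    (h.smooth.differentiable (by simp) _).hasFDerivAt
  exact h1.comp_hasDerivAt t ((hasDerivAt_const t x).prodMk (hasDerivAt_id t))

lemma hasDerivAt_x₁ (h : IsTest A Ψ) (x₁ x₂ t : ℝ) :
    HasDerivAt (fun x => Ψ (pt x x₂, t)) (RayleighTaylor.dx 0 Ψ (pt x₁ x₂, t)) x₁ := by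
  have h1 : HasFDerivAt Ψ (fderiv ℝ Ψ (pt x₁ x₂, t)) (pt x₁ x₂, t) :=
    (h.smooth.differentiable (by simp) _).hasFDerivAt
  exact h1.comp_hasDerivAt x₁ ((hasDerivAt_pt_fst x₁ x₂).prodMk (hasDerivAt_const x₁ t))

lemma hasDerivAt_x₂ (h : IsTest A Ψ) (x₁ x₂ t : ℝ) :
    HasDerivAt (fun x => Ψ (pt x₁ x, t)) (RayleighTaylor.dx 1 Ψ (pt x₁ x₂, t)) x₂ := by
  have h1 : HasFDerivAt Ψ (fderiv ℝ Ψ (pt x₁ x₂, t)) (pt x₁ x₂, t) :=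
    (h.smooth.differentiable (by simp) _).hasFDerivAt
  exact h1.comp_hasDerivAt x₂ ((hasDerivAt_pt_snd x₁ x₂).prodMk (hasDerivAt_const x₂ t))

lemma dt_dx_comm (h : IsTest A Ψ) (j : Fin 2) (p : Plane × ℝ) :
    RayleighTaylor.dt (RayleighTaylor.dx j Ψ) p = RayleighTaylor.dx j (RayleighTaylor.dt Ψ) p := by
  have hs : IsSymmSndFDerivAt ℝ Ψ p :=
    (contDiff_infty.1 h.smooth 2).contDiffAt.isSymmSndFDerivAt (by simp)
  have hd : DifferentiableAt ℝ (fderiv ℝ Ψ) p :=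
    (h.smooth.fderiv_right (m := ∞) (by simp)).differentiable (by simp) p
  have e (w w' : Plane × ℝ) :
      fderiv ℝ (fun q => fderiv ℝ Ψ q w) p w' = fderiv ℝ (fderiv ℝ Ψ) p w' w := by
    have h1 := hd.hasFDerivAt.clm_apply (hasFDerivAt_const w p)
    rw [h1.fderiv]; simp
  change fderiv ℝ (fun q => fderiv ℝ Ψ q _) p _ = fderiv ℝ (fun q => fderiv ℝ Ψ q _) p _
  rw [e, e]
  exact hs.eq _ _

end IsTest

/-! ### Integration over the rectangle and the cylinder -/

/-- Space-time in the coordinates `(x₁, (x₂, t))`. -/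
def coords : ℝ × ℝ × ℝ ≃ᵐ Plane × ℝ :=
  MeasurableEquiv.prodAssoc.symm.trans
    ((MeasurableEquiv.finTwoArrow.symm.trans (MeasurableEquiv.toLp 2 (Fin 2 → ℝ))).prodCongr
      (MeasurableEquiv.refl ℝ))

lemma coords_apply (q : ℝ × ℝ × ℝ) : coords q = (pt q.1 q.2.1, q.2.2) := by
  have : MeasurableEquiv.finTwoArrow.symm (q.1, q.2.1) = ![q.1, q.2.1] := rfl
  simp [coords, MeasurableEquiv.prodCongr, pt]
  rfl

/-- The plane in coordinates. -/
def planeCoords : ℝ × ℝ ≃ᵐ Plane :=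
  MeasurableEquiv.finTwoArrow.symm.trans (MeasurableEquiv.toLp 2 (Fin 2 → ℝ))

lemma planeCoords_apply (q : ℝ × ℝ) : planeCoords q = pt q.1 q.2 := rfl

lemma measurePreserving_planeCoords : MeasurePreserving planeCoords volume volume :=
  ((volume_preserving_finTwoArrow ℝ).symm).trans (PiLp.volume_preserving_toLp (Fin 2))

lemma measurePreserving_coords : MeasurePreserving coords volume volume :=
  (volume_preserving_prodAssoc.symm).trans
    (measurePreserving_planeCoords.prod (MeasurePreserving.id volume))

variable {Ω : Opens Plane} {l m T : ℝ}

/-- `Ω` is the rectangle `(0, 1) × (l, m)`. -/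
def IsBox (Ω : Opens Plane) (l m : ℝ) : Prop :=
  ∀ x, x ∈ Ω ↔ (0 < x 0 ∧ x 0 < 1) ∧ (l < x 1 ∧ x 1 < m)

lemma IsBox.preimage (h : IsBox Ω l m) :
    planeCoords ⁻¹' (Ω : Set Plane) = Ioo 0 1 ×ˢ Ioo l m := by
  ext q
  simp only [mem_preimage, SetLike.mem_coe, planeCoords_apply, h _, pt_zero, pt_one, mem_prod,
    mem_Ioo]

lemma IsBox.integral_eq (h : IsBox Ω l m) (f : Plane → ℝ) :
    ∫ x in (Ω : Set Plane), f x = ∫ q in Ioo 0 1 ×ˢ Ioo l m, f (pt q.1 q.2) := by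
  rw [← measurePreserving_planeCoords.setIntegral_preimage_emb planeCoords.measurableEmbedding]
  rw [h.preimage]; rfl

lemma IsBox.cylinder_integral_eq (h : IsBox Ω l m) (f : Plane × ℝ → ℝ) :
    ∫ p in (cylinder Ω T : Set (Plane × ℝ)), f p
      = ∫ q in Ioo 0 1 ×ˢ (Ioo l m ×ˢ Ioo 0 T), f (pt q.1 q.2.1, q.2.2) := by
  rw [← measurePreserving_coords.setIntegral_preimage_emb coords.measurableEmbedding]
  have : coords ⁻¹' (cylinder Ω T : Set (Plane × ℝ)) = Ioo 0 1 ×ˢ (Ioo l m ×ˢ Ioo 0 T) := by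
    ext q
    simp only [mem_preimage, coords_apply, cylinder, Opens.coe_mk, mem_prod, SetLike.mem_coe, h _,
      pt_zero, pt_one, mem_Ioo, and_assoc]
  rw [this]; simp only [coords_apply]

lemma IsBox.volume_lt_top (h : IsBox Ω l m) : volume (Ω : Set Plane) < ⊤ := by
  rw [← measurePreserving_planeCoords.measure_preimage_equiv, h.preimage, Measure.volume_eq_prod,
    Measure.prod_prod]
  exact ENNReal.mul_lt_top (by simp) (by simp)

lemma IsBox.cylinder_volume_lt_top (h : IsBox Ω l m) :
    volume (cylinder Ω T : Set (Plane × ℝ)) < ⊤ := by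
  change volume ((Ω : Set Plane) ×ˢ Ioo 0 T) < ⊤
  rw [Measure.volume_eq_prod, Measure.prod_prod]
  exact ENNReal.mul_lt_top h.volume_lt_top (by simp)

lemma setIntegral_prod_eq_zero_of_fst {s : Set ℝ} {u : Set (ℝ × ℝ)}
    {f : ℝ × ℝ × ℝ → ℝ} (h : ∀ y ∈ u, ∫ x in s, f (x, y) = 0) : ∫ q in s ×ˢ u, f q = 0 := by
  by_cases hf : IntegrableOn f (s ×ˢ u)
  · rw [Measure.volume_eq_prod, ← Measure.prod_restrict, integral_prod_symm]
    · exact setIntegral_eq_zero_of_forall_eq_zero fun y hy => h y hy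
    · rwa [Measure.prod_restrict]
  · exact integral_undef hf

lemma setIntegral_prod_eq_zero_of_mid {s t u : Set ℝ}
    {f : ℝ × ℝ × ℝ → ℝ} (h : ∀ x, ∀ z ∈ u, ∫ y in t, f (x, y, z) = 0) :
    ∫ q in s ×ˢ (t ×ˢ u), f q = 0 := by
  by_cases hf : IntegrableOn f (s ×ˢ (t ×ˢ u))
  · rw [Measure.volume_eq_prod, setIntegral_prod _ hf]
    refine integral_eq_zero_of_ae (.of_forall fun x => ?_)
    change ∫ y in t ×ˢ u, f (x, y) = 0
    by_cases hx : IntegrableOn (fun y => f (x, y)) (t ×ˢ u)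
    · rw [Measure.volume_eq_prod, ← Measure.prod_restrict, integral_prod_symm]
      · exact setIntegral_eq_zero_of_forall_eq_zero fun z hz => h x z hz
      · rwa [Measure.prod_restrict]
    · exact integral_undef hx
  · exact integral_undef hf

lemma setIntegral_prod_eq_of_last {s t u : Set ℝ} (hs : MeasurableSet s) (ht : MeasurableSet t)
    {f : ℝ × ℝ × ℝ → ℝ} {F : ℝ × ℝ → ℝ} (hf : IntegrableOn f (s ×ˢ (t ×ˢ u)))
    (h : ∀ x ∈ s, ∀ y ∈ t, ∫ z in u, f (x, y, z) = F (x, y)) :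
    ∫ q in s ×ˢ (t ×ˢ u), f q = ∫ q in s ×ˢ t, F q := by
  have e := (MeasureTheory.volume_preserving_prodAssoc (α₁ := ℝ) (β₁ := ℝ) (γ₁ := ℝ))
  rw [← e.setIntegral_preimage_emb MeasurableEquiv.prodAssoc.measurableEmbedding]
  have e1 : (MeasurableEquiv.prodAssoc ⁻¹' (s ×ˢ (t ×ˢ u)) : Set ((ℝ × ℝ) × ℝ)) = (s ×ˢ t) ×ˢ u := by
    ext q; simp [MeasurableEquiv.prodAssoc, and_assoc]
  have hf' := (e.integrableOn_comp_preimage MeasurableEquiv.prodAssoc.measurableEmbedding).2 hf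
  rw [e1] at hf' ⊢
  rw [Measure.volume_eq_prod (ℝ × ℝ) ℝ]
  refine (setIntegral_prod _ hf').trans ?_
  exact setIntegral_congr_fun (hs.prod ht) fun q hq => h q.1 hq.1 q.2 hq.2

end

section

variable {Ω : Opens Plane} {l m T : ℝ}

/-! ### Stream functions and the weak formulation -/

/-- A function bounded and continuous on the open cylinder is integrable there. -/
lemma integrableOn_coords {f : ℝ × ℝ × ℝ → ℝ}
    (hf : ContinuousOn f (Ioo 0 1 ×ˢ (Ioo l m ×ˢ Ioo 0 T)))
    (hb : ∃ C, ∀ q ∈ Ioo (0 : ℝ) 1 ×ˢ (Ioo l m ×ˢ Ioo 0 T), |f q| ≤ C) :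
    IntegrableOn f (Ioo 0 1 ×ˢ (Ioo l m ×ˢ Ioo 0 T)) := by
  obtain ⟨C, hC⟩ := hb
  have hm : MeasurableSet (Ioo (0 : ℝ) 1 ×ˢ (Ioo l m ×ˢ Ioo 0 T)) :=
    measurableSet_Ioo.prod (measurableSet_Ioo.prod measurableSet_Ioo)
  refine IntegrableOn.of_bound (C := C) ?_ (hf.aestronglyMeasurable hm)
    ((ae_restrict_iff' hm).2 (.of_forall hC))
  rw [Measure.volume_eq_prod, Measure.prod_prod, Measure.volume_eq_prod, Measure.prod_prod]
  exact ENNReal.mul_lt_top (by simp) (ENNReal.mul_lt_top (by simp) (by simp))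

/-- `F`, a function of `(x₂, t)`, has the partial derivatives `F₂`, `Fₜ` for positive times, all
bounded on `(l, m) × (0, T)`, and is continuous in time up to `t = 0`. -/
structure IsStream (l m T : ℝ) (F F₂ Ft : ℝ × ℝ → ℝ) : Prop where
  deriv_x : ∀ x t, 0 < t → HasDerivAt (fun x => F (x, t)) (F₂ (x, t)) x
  deriv_t : ∀ x t, 0 < t → HasDerivAt (fun t => F (x, t)) (Ft (x, t)) t
  cont : ContinuousOn F (univ ×ˢ Ioi 0)
  cont_x : ContinuousOn F₂ (univ ×ˢ Ioi 0)
  cont_t : ContinuousOn Ft (univ ×ˢ Ioi 0)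
  cont_zero : ∀ x, ContinuousWithinAt (fun t => F (x, t)) (Ici 0) 0
  bdd : ∃ C, ∀ x ∈ Ioo l m, ∀ t ∈ Ioo 0 T, |F (x, t)| ≤ C ∧ |F₂ (x, t)| ≤ C ∧ |Ft (x, t)| ≤ C

/-- A function of `(x₂, t)` times a test function is integrable on the cylinder. -/
lemma integrableOn_mul_test {A : Set (Plane × ℝ)} {f : ℝ × ℝ → ℝ} {Ψ : Plane × ℝ → ℝ}
    (hΨ : IsTest A Ψ) (hf : ContinuousOn f (univ ×ˢ Ioi 0))
    (hb : ∃ C, ∀ x ∈ Ioo l m, ∀ t ∈ Ioo 0 T, |f (x, t)| ≤ C) :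
    IntegrableOn (fun q : ℝ × ℝ × ℝ => f q.2 * Ψ (pt q.1 q.2.1, q.2.2))
      (Ioo 0 1 ×ˢ (Ioo l m ×ˢ Ioo 0 T)) := by
  obtain ⟨C, hC⟩ := hb
  obtain ⟨D, hD⟩ := hΨ.exists_bound
  refine integrableOn_coords ?_ ⟨C * D, ?_⟩
  · refine (hf.comp continuous_snd.continuousOn fun q hq => ⟨trivial, hq.2.2.1⟩).mul ?_
    refine (hΨ.smooth.continuous.comp ?_).continuousOn
    exact (continuous_pt.comp (continuous_fst.prodMk continuous_snd.fst)).prodMk continuous_snd.snd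
  · rintro ⟨x₁, x₂, t⟩ ⟨-, h2, h3⟩
    rw [abs_mul]
    have := hC x₂ h2 t h3
    exact mul_le_mul this (hD _) (abs_nonneg _) ((abs_nonneg _).trans this)

/-- A stream function turns `(F₂, -Fₜ)` into a weakly divergence-free field in `(t, x₂)`, with the
trace of `F` at `t = 0` as boundary term. Only second derivatives of the test function enter, so no
regularity of `F₂`, `Fₜ` beyond continuity is needed. -/
theorem IsStream.integral_eq {F F₂ Ft : ℝ × ℝ → ℝ} (hF : IsStream l m T F F₂ Ft)
    (hΩ : IsBox Ω l m) (hlm : l ≤ m) (hT : 0 < T) {Ψ : Plane × ℝ → ℝ}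
    (hΨ : IsTest ((Ω : Set Plane) ×ˢ Iio T) Ψ) :
    ∫ p in (cylinder Ω T : Set (Plane × ℝ)),
        (F₂ (p.1 1, p.2) * dt Ψ p - Ft (p.1 1, p.2) * dx 1 Ψ p)
      = ∫ x in (Ω : Set Plane), F (x 1, 0) * dx 1 Ψ (x, 0) := by
  obtain ⟨C, hC⟩ := hF.bdd
  have hbF : ∃ C, ∀ x ∈ Ioo l m, ∀ t ∈ Ioo 0 T, |F (x, t)| ≤ C :=
    ⟨C, fun x hx t ht => (hC x hx t ht).1⟩
  have hbF₂ : ∃ C, ∀ x ∈ Ioo l m, ∀ t ∈ Ioo 0 T, |F₂ (x, t)| ≤ C :=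
    ⟨C, fun x hx t ht => (hC x hx t ht).2.1⟩
  have hbFt : ∃ C, ∀ x ∈ Ioo l m, ∀ t ∈ Ioo 0 T, |Ft (x, t)| ≤ C :=
    ⟨C, fun x hx t ht => (hC x hx t ht).2.2⟩
  have i1 := integrableOn_mul_test hΨ.dt hF.cont_x hbF₂
  have i2 := integrableOn_mul_test (hΨ.dt.dx 1) hF.cont hbF
  have i3 := integrableOn_mul_test (hΨ.dx 1) hF.cont_t hbFt
  have i4 := integrableOn_mul_test (hΨ.dx 1).dt hF.cont hbF
  -- Integration by parts in `x₂`, without boundary terms, and then in `t`, with one at `t = 0`. The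
  -- two terms with `F` times a mixed second derivative of `Ψ` cancel.
  have e1 : ∫ q in Ioo 0 1 ×ˢ (Ioo l m ×ˢ Ioo 0 T), (F₂ q.2 * dt Ψ (pt q.1 q.2.1, q.2.2)
      + F q.2 * dx 1 (dt Ψ) (pt q.1 q.2.1, q.2.2)) = 0 := by
    refine setIntegral_prod_eq_zero_of_mid fun x₁ t ht => ?_
    have ht0 : 0 < t := ht.1
    rw [← integral_Ioc_eq_integral_Ioo, ← intervalIntegral.integral_of_le hlm,
      intervalIntegral.integral_eq_sub_of_hasDerivAt
        (f := fun x => F (x, t) * dt Ψ (pt x₁ x, t))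
        (fun x _ => (hF.deriv_x x t ht0).mul (hΨ.dt.hasDerivAt_x₂ x₁ x t))]
    · rw [hΨ.dt.eq_zero, hΨ.dt.eq_zero]
      · simp
      · rintro ⟨h, -⟩; exact ((hΩ _).1 h).2.1.false
      · rintro ⟨h, -⟩; exact ((hΩ _).1 h).2.2.false
    · refine Continuous.intervalIntegrable ?_ _ _
      have c0 : Continuous fun x : ℝ => (x, t) := by fun_prop
      have c1 : Continuous fun x => F (x, t) :=
        hF.cont.comp_continuous c0 fun x => ⟨trivial, ht0⟩
      have c2 : Continuous fun x => F₂ (x, t) :=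
        hF.cont_x.comp_continuous c0 fun x => ⟨trivial, ht0⟩
      have c3 : Continuous fun x => (pt x₁ x, t) :=
        (continuous_pt.comp (Continuous.prodMk_right x₁)).prodMk continuous_const
      exact (c2.mul (hΨ.dt.smooth.continuous.comp c3)).add
        (c1.mul ((hΨ.dt.dx 1).smooth.continuous.comp c3))
  have e2 : ∫ q in Ioo 0 1 ×ˢ (Ioo l m ×ˢ Ioo 0 T), (Ft q.2 * dx 1 Ψ (pt q.1 q.2.1, q.2.2)
      + F q.2 * dt (dx 1 Ψ) (pt q.1 q.2.1, q.2.2))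
      = ∫ q in Ioo 0 1 ×ˢ Ioo l m, -(F (q.2, 0) * dx 1 Ψ (pt q.1 q.2, 0)) := by
    refine setIntegral_prod_eq_of_last measurableSet_Ioo measurableSet_Ioo (i3.add i4)
      fun x₁ _ x₂ hx₂ => ?_
    have c3 : Continuous fun t : ℝ => (pt x₁ x₂, t) := by fun_prop
    rw [← integral_Ioc_eq_integral_Ioo, ← intervalIntegral.integral_of_le hT.le,
      intervalIntegral.integral_eq_sub_of_hasDerivAt_of_le hT.le
        (f := fun t => F (x₂, t) * dx 1 Ψ (pt x₁ x₂, t)) ?_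
        (fun t ht => (hF.deriv_t x₂ t ht.1).mul ((hΨ.dx 1).hasDerivAt_t (pt x₁ x₂) t))]
    · rw [(hΨ.dx 1).eq_zero (p := (pt x₁ x₂, T)) fun h => lt_irrefl T h.2]
      simp
    · rw [intervalIntegrable_iff_integrableOn_Ioo_of_le hT.le]
      obtain ⟨D, hD⟩ := (hΨ.dx 1).exists_bound
      obtain ⟨D', hD'⟩ := (hΨ.dx 1).dt.exists_bound
      have c0 : Continuous fun t : ℝ => (x₂, t) := by fun_prop
      refine IntegrableOn.of_bound (C := C * D + C * D') (by simp)
        (ContinuousOn.aestronglyMeasurable ?_ measurableSet_Ioo)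
        ((ae_restrict_iff' measurableSet_Ioo).2 (.of_forall fun t ht => ?_))
      · exact ((hF.cont_t.comp c0.continuousOn fun t ht => ⟨trivial, ht.1⟩).mul
          ((hΨ.dx 1).smooth.continuous.comp c3).continuousOn).add
          ((hF.cont.comp c0.continuousOn fun t ht => ⟨trivial, ht.1⟩).mul
          ((hΨ.dx 1).dt.smooth.continuous.comp c3).continuousOn)
      · obtain ⟨b1, -, b3⟩ := hC x₂ hx₂ t ht
        refine (norm_add_le _ _).trans (add_le_add ?_ ?_)
        · rw [norm_mul]
          exact mul_le_mul b3 (hD _) (norm_nonneg _) ((abs_nonneg _).trans b3)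
        · rw [norm_mul]
          exact mul_le_mul b1 (hD' _) (norm_nonneg _) ((abs_nonneg _).trans b1)
    · refine ContinuousOn.mul (fun t ht => ?_) ((hΨ.dx 1).smooth.continuous.comp c3).continuousOn
      rcases ht.1.eq_or_lt with rfl | h
      · exact (hF.cont_zero x₂).mono Icc_subset_Ici_self
      · exact (hF.deriv_t x₂ t h).continuousAt.continuousWithinAt
  rw [hΩ.cylinder_integral_eq, hΩ.integral_eq]
  have e3 := integral_sub (i1.add i2) (i3.add i4)
  simp only [Pi.add_apply] at e3
  rw [e1, e2, integral_neg, zero_sub, neg_neg] at e3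
  simp only [pt_one]
  rw [← e3]
  refine integral_congr_ae (.of_forall fun q => ?_)
  simp only [hΨ.dt_dx_comm]
  ring

/-- Functions of `(x₂, t)` are weakly constant in `x₁`. -/
theorem integral_mul_dx_zero (hΩ : IsBox Ω l m) {Ψ : Plane × ℝ → ℝ}
    (hΨ : IsTest ((Ω : Set Plane) ×ˢ Iio T) Ψ) (f : ℝ × ℝ → ℝ) :
    ∫ p in (cylinder Ω T : Set (Plane × ℝ)), f (p.1 1, p.2) * dx 0 Ψ p = 0 := by
  rw [hΩ.cylinder_integral_eq]
  refine setIntegral_prod_eq_zero_of_fst fun y _ => ?_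
  obtain ⟨x₂, t⟩ := y
  simp only [pt_one]
  rw [integral_const_mul, ← integral_Ioc_eq_integral_Ioo,
    ← intervalIntegral.integral_of_le zero_le_one,
    intervalIntegral.integral_eq_sub_of_hasDerivAt (f := fun x => Ψ (pt x x₂, t))
      (fun x _ => hΨ.hasDerivAt_x₁ x x₂ t), hΨ.eq_zero, hΨ.eq_zero]
  · simp
  · rintro ⟨h, -⟩; exact ((hΩ _).1 h).1.1.false
  · rintro ⟨h, -⟩; exact ((hΩ _).1 h).1.2.false
  · refine Continuous.intervalIntegrable ?_ _ _
    exact (hΨ.dx 0).smooth.continuous.comp ((continuous_pt.comp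
      (Continuous.prodMk_left x₂)).prodMk continuous_const)

/-- Integration by parts in `x₂`. -/
theorem integral_deriv_x_mul (hΩ : IsBox Ω l m) (hlm : l ≤ m) {Ψ : Plane × ℝ → ℝ}
    (hΨ : IsTest ((Ω : Set Plane) ×ˢ Iio T) Ψ) {F F₂ : ℝ × ℝ → ℝ}
    (hd : ∀ x t, 0 < t → HasDerivAt (fun x => F (x, t)) (F₂ (x, t)) x)
    (hc : ∀ t, 0 < t → Continuous fun x => F₂ (x, t)) :
    ∫ p in (cylinder Ω T : Set (Plane × ℝ)),
      (F₂ (p.1 1, p.2) * Ψ p + F (p.1 1, p.2) * dx 1 Ψ p) = 0 := by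
  rw [hΩ.cylinder_integral_eq]
  refine setIntegral_prod_eq_zero_of_mid fun x₁ t ht => ?_
  have ht0 : 0 < t := ht.1
  simp only [pt_one]
  rw [← integral_Ioc_eq_integral_Ioo, ← intervalIntegral.integral_of_le hlm,
    intervalIntegral.integral_eq_sub_of_hasDerivAt
      (f := fun x => F (x, t) * Ψ (pt x₁ x, t))
      (fun x _ => (hd x t ht0).mul (hΨ.hasDerivAt_x₂ x₁ x t))]
  · rw [hΨ.eq_zero, hΨ.eq_zero]
    · simp
    · rintro ⟨h, -⟩; exact ((hΩ _).1 h).2.1.false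
    · rintro ⟨h, -⟩; exact ((hΩ _).1 h).2.2.false
  · refine Continuous.intervalIntegrable ?_ _ _
    have c1 : Continuous fun x => F (x, t) :=
      continuous_iff_continuousAt.2 fun x => (hd x t ht0).continuousAt
    have c3 : Continuous fun x => (pt x₁ x, t) :=
      (continuous_pt.comp (Continuous.prodMk_right x₁)).prodMk continuous_const
    exact ((hc t ht0).mul (hΨ.smooth.continuous.comp c3)).add
      (c1.mul ((hΨ.dx 1).smooth.continuous.comp c3))

end

section

variable {a b g : ℝ} {r H : ℝ → ℝ}
variable {Ω : Opens Plane} {l m T : ℝ}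

/-! ### The stream functions of a profile -/

/-- The initial density as a function of `x₂`. -/
def stepDensity (rm rp x : ℝ) : ℝ := if 0 < x then rp else rm

/-- The stream function of the continuity equation: `∂₂ W = ρ` and `∂ₜ W = -u₂`. At `t = 0` it is
a primitive of the initial density. -/
def massStream (a b : ℝ) (H : ℝ → ℝ) (z : ℝ × ℝ) : ℝ :=
  if 0 < z.2 then 1 / 2 * z.2 ^ 2 * H (z.1 / z.2 ^ 2) else z.1 * stepDensity (b ^ 2) (a ^ 2) z.1

/-- The primitive of the flux. -/
def fluxPrimitive (r H : ℝ → ℝ) (y : ℝ) : ℝ := ∫ s in (0 : ℝ)..y, flux r H s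

/-- A primitive in `x₂` of `-u₂`. Its time derivative is the part of the pressure that balances
the acceleration. -/
def fluxStream (r H : ℝ → ℝ) (z : ℝ × ℝ) : ℝ := z.2 ^ 3 * fluxPrimitive r H (z.1 / z.2 ^ 2)

lemma measurable_selfSimilar {f : ℝ → ℝ} (hf : Measurable f) :
    Measurable fun z : ℝ × ℝ => f (z.1 / z.2 ^ 2) := by fun_prop

lemma continuousOn_selfSimilar {f : ℝ → ℝ} (hf : Continuous f) :
    ContinuousOn (fun z : ℝ × ℝ => f (z.1 / z.2 ^ 2)) (univ ×ˢ Ioi 0) := by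
  refine hf.comp_continuousOn (continuous_fst.continuousOn.div (by fun_prop) fun z hz => ?_)
  have : 0 < z.2 := hz.2
  positivity

lemma hasDerivAt_selfSimilar_x {f f' : ℝ → ℝ} (hf : ∀ y, HasDerivAt f (f' y) y) (x t : ℝ) :
    HasDerivAt (fun x => f (x / t ^ 2)) (f' (x / t ^ 2) * (1 / t ^ 2)) x :=
  (hf _).comp x ((hasDerivAt_id x).div_const (t ^ 2))

lemma hasDerivAt_selfSimilar_t {f f' : ℝ → ℝ} (hf : ∀ y, HasDerivAt f (f' y) y) (x : ℝ) {t : ℝ}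
    (ht : 0 < t) :
    HasDerivAt (fun t => f (x / t ^ 2)) (f' (x / t ^ 2) * (-2 * x / t ^ 3)) t := by
  have h : HasDerivAt (fun t : ℝ => x / t ^ 2) (-2 * x / t ^ 3) t := by
    refine ((hasDerivAt_const t x).div (hasDerivAt_pow 2 t) (by positivity)).congr_deriv ?_
    push_cast; field_simp; ring
  exact (hf _).comp t h

namespace IsProfile

lemma sq_le_density (h : IsProfile a b g r H) (hb : 0 < b) (hab : b < a) (y : ℝ) :
    b ^ 2 ≤ r y ∧ r y ≤ a ^ 2 := by
  have h0 : b ^ 2 ≤ a ^ 2 := pow_le_pow_left₀ hb.le hab.le 2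
  rcases le_or_gt y (-edgeMinus a b g) with h1 | h1
  · rw [(h.below y h1).1]; exact ⟨le_rfl, h0⟩
  rcases le_or_gt (edgePlus a b g) y with h2 | h2
  · rw [(h.above y h2).1]; exact ⟨h0, le_rfl⟩
  · exact ⟨(h.mem y ⟨h1, h2⟩).1.le, (h.mem y ⟨h1, h2⟩).2.le⟩

lemma abs_density_le (h : IsProfile a b g r H) (hb : 0 < b) (hab : b < a) (y : ℝ) :
    |r y| ≤ a ^ 2 := by
  obtain ⟨h1, h2⟩ := h.sq_le_density hb hab y
  rw [abs_of_nonneg ((sq_nonneg b).trans h1)]; exact h2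

lemma hasCompactSupport_flux (h : IsProfile a b g r H) : HasCompactSupport (flux r H) :=
  HasCompactSupport.intro (isCompact_Icc (a := -edgeMinus a b g) (b := edgePlus a b g))
    fun _ hy => h.flux_eq_zero fun hy' => hy (Ioo_subset_Icc_self hy')

lemma exists_bound_flux (h : IsProfile a b g r H) : ∃ C, ∀ y, |flux r H y| ≤ C :=
  h.hasCompactSupport_flux.exists_bound_of_continuous h.continuous_flux

lemma exists_bound_mul_flux (h : IsProfile a b g r H) : ∃ C, ∀ y, |y * flux r H y| ≤ C :=
  (h.hasCompactSupport_flux.mul_left (f := fun y : ℝ => y)).exists_bound_of_continuous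
    (continuous_id.mul h.continuous_flux)

lemma hasDerivAt_fluxPrimitive (h : IsProfile a b g r H) (y : ℝ) :
    HasDerivAt (fluxPrimitive r H) (flux r H y) y :=
  intervalIntegral.integral_hasDerivAt_right (h.continuous_flux.intervalIntegrable _ _)
    h.continuous_flux.stronglyMeasurable.stronglyMeasurableAtFilter h.continuous_flux.continuousAt

lemma continuous_fluxPrimitive (h : IsProfile a b g r H) : Continuous (fluxPrimitive r H) :=
  continuous_iff_continuousAt.2 fun y => (h.hasDerivAt_fluxPrimitive y).continuousAt

lemma exists_bound_fluxPrimitive (h : IsProfile a b g r H) :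
    ∃ C, ∀ y, |fluxPrimitive r H y| ≤ C := by
  refine ⟨∫ s, ‖flux r H s‖, fun y => ?_⟩
  have hi := h.continuous_flux.integrable_of_hasCompactSupport (μ := volume) h.hasCompactSupport_flux
  exact intervalIntegral.norm_integral_le_integral_norm_uIoc.trans
    (setIntegral_le_integral hi.norm (.of_forall fun _ => norm_nonneg _))

lemma massStream_eq {x t : ℝ} (ht : 0 < t) :
    massStream a b H (x, t) = 1 / 2 * t ^ 2 * flux r H (x / t ^ 2) + x * r (x / t ^ 2) := by
  simp only [massStream, ht, if_true, flux]; field_simp; ring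

/-- The mass stream function approaches its initial value at rate `t²`. -/
lemma exists_massStream_sub_le (h : IsProfile a b g r H) (hb : 0 < b) (hab : b < a)
    (hg : 0 < g) : ∃ C, ∀ x t, 0 < t →
      |massStream a b H (x, t) - x * stepDensity (b ^ 2) (a ^ 2) x| ≤ C * t ^ 2 := by
  obtain ⟨C, hC⟩ := h.exists_bound_flux
  have hp := edgePlus_pos hb hab hg
  have hm := edgeMinus_pos hb hab hg
  have hab2 : b ^ 2 ≤ a ^ 2 := pow_le_pow_left₀ hb.le hab.le 2
  have key : ∀ y, |y * (r y - stepDensity (b ^ 2) (a ^ 2) y)|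
      ≤ (edgePlus a b g + edgeMinus a b g) * a ^ 2 := by
    intro y
    obtain ⟨r1, r2⟩ := h.sq_le_density hb hab y
    rcases le_or_gt y (-edgeMinus a b g) with h1 | h1
    · rw [(h.below y h1).1, stepDensity, if_neg (by linarith)]; simp; positivity
    rcases le_or_gt (edgePlus a b g) y with h2 | h2
    · rw [(h.above y h2).1, stepDensity, if_pos (by linarith)]; simp; positivity
    rw [abs_mul]
    refine mul_le_mul (abs_le.2 ⟨by linarith, by linarith⟩) ?_ (abs_nonneg _) (by positivity)
    unfold stepDensity
    have := sq_nonneg b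
    split_ifs <;> rw [abs_le] <;> constructor <;> linarith
  refine ⟨1 / 2 * C + (edgePlus a b g + edgeMinus a b g) * a ^ 2, fun x t ht => ?_⟩
  have hs : stepDensity (b ^ 2) (a ^ 2) x = stepDensity (b ^ 2) (a ^ 2) (x / t ^ 2) := by
    have : 0 < x / t ^ 2 ↔ 0 < x := div_pos_iff_of_pos_right (by positivity)
    simp only [stepDensity, this]
  have e : massStream a b H (x, t) - x * stepDensity (b ^ 2) (a ^ 2) x
      = t ^ 2 * (1 / 2 * flux r H (x / t ^ 2)
        + x / t ^ 2 * (r (x / t ^ 2) - stepDensity (b ^ 2) (a ^ 2) (x / t ^ 2))) := by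
    rw [massStream_eq (r := r) ht, hs]; field_simp; ring
  rw [e, abs_mul, abs_of_pos (show 0 < t ^ 2 by positivity), mul_comm]
  refine mul_le_mul_of_nonneg_right ((abs_add_le _ _).trans (add_le_add ?_ (key _))) (by positivity)
  rw [abs_mul, abs_of_pos (by norm_num : (0 : ℝ) < 1 / 2)]
  exact mul_le_mul_of_nonneg_left (hC _) (by norm_num)

end IsProfile

lemma continuousWithinAt_zero_of_le {f : ℝ → ℝ} {C : ℝ}
    (h : ∀ t, 0 < t → |f t - f 0| ≤ C * t ^ 2) : ContinuousWithinAt f (Ici 0) 0 := by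
  rw [ContinuousWithinAt, tendsto_iff_dist_tendsto_zero]
  have h1 : Filter.Tendsto (fun t : ℝ => C * t ^ 2) (nhdsWithin 0 (Ici 0)) (nhds 0) := by
    have : Continuous fun t : ℝ => C * t ^ 2 := by fun_prop
    simpa [ContinuousWithinAt] using this.continuousWithinAt (s := Ici 0) (x := 0)
  refine squeeze_zero' (.of_forall fun _ => dist_nonneg) ?_ h1
  filter_upwards [self_mem_nhdsWithin] with t ht
  rw [Real.dist_eq]
  rcases (mem_Ici.1 ht).eq_or_lt with rfl | h0
  · simp
  · exact h t h0

namespace IsProfile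

theorem isStream_massStream (h : IsProfile a b g r H) (hb : 0 < b) (hab : b < a) (hg : 0 < g)
    (hT : 0 < T) :
    IsStream l m T (massStream a b H) (fun z => r (z.1 / z.2 ^ 2))
      (fun z => z.2 * flux r H (z.1 / z.2 ^ 2)) where
  deriv_x x t ht := by
    have h1 := (hasDerivAt_selfSimilar_x h.hasDerivAt x t).const_mul (1 / 2 * t ^ 2)
    refine (h1.congr_of_eventuallyEq (.of_forall fun x => ?_)).congr_deriv ?_
    · simp only [massStream, ht, if_true]
    · field_simp
  deriv_t x t ht := by
    have h1 := (((hasDerivAt_pow 2 t).const_mul (1 / 2)).mul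
      (hasDerivAt_selfSimilar_t h.hasDerivAt x ht))
    refine (h1.congr_of_eventuallyEq ?_).congr_deriv ?_
    · filter_upwards [lt_mem_nhds ht] with s hs
      simp only [massStream, hs, if_true, Pi.mul_apply]
    · simp only [flux]; push_cast; field_simp; ring
  cont := by
    have h1 := continuousOn_selfSimilar h.continuous_potential
    refine ContinuousOn.congr (f := fun z : ℝ × ℝ => 1 / 2 * z.2 ^ 2 * H (z.1 / z.2 ^ 2))
      ((by fun_prop : Continuous fun z : ℝ × ℝ => 1 / 2 * z.2 ^ 2).continuousOn.mul h1)
      fun z hz => ?_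
    simp only [massStream, show 0 < z.2 from hz.2, if_true]
  cont_x := continuousOn_selfSimilar h.cont
  cont_t := continuous_snd.continuousOn.mul (continuousOn_selfSimilar h.continuous_flux)
  cont_zero x := by
    obtain ⟨C, hC⟩ := h.exists_massStream_sub_le hb hab hg
    refine continuousWithinAt_zero_of_le (C := C) fun t ht => ?_
    simpa [massStream, ht] using hC x t ht
  bdd := by
    obtain ⟨C, hC⟩ := h.exists_bound_flux
    have hC0 : 0 ≤ C := (abs_nonneg _).trans (hC 0)
    refine ⟨1 / 2 * T ^ 2 * C + max |l| |m| * a ^ 2 + a ^ 2 + T * C, fun x hx t ht => ?_⟩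
    have hx' : |x| ≤ max |l| |m| := abs_le_max_abs_abs hx.1.le hx.2.le
    have hmax : 0 ≤ max |l| |m| := (abs_nonneg _).trans hx'
    have t0 : 0 < t := ht.1
    have tT : t ≤ T := ht.2.le
    have hr := h.abs_density_le hb hab (x / t ^ 2)
    have hf := hC (x / t ^ 2)
    have p1 : 0 ≤ 1 / 2 * T ^ 2 * C := by positivity
    have p2 : 0 ≤ max |l| |m| * a ^ 2 := by positivity
    have p3 : 0 ≤ T * C := by positivity
    refine ⟨?_, ?_, ?_⟩
    · rw [massStream_eq (r := r) t0]
      have q1 : |1 / 2 * t ^ 2 * flux r H (x / t ^ 2)| ≤ 1 / 2 * T ^ 2 * C := by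
        rw [abs_mul, abs_of_pos (show 0 < 1 / 2 * t ^ 2 by positivity)]; gcongr
      have q2 : |x * r (x / t ^ 2)| ≤ max |l| |m| * a ^ 2 := by
        rw [abs_mul]; gcongr
      linarith [abs_add_le (1 / 2 * t ^ 2 * flux r H (x / t ^ 2)) (x * r (x / t ^ 2)), sq_nonneg a]
    · linarith
    · have : |t * flux r H (x / t ^ 2)| ≤ T * C := by
        rw [abs_mul, abs_of_pos t0]; gcongr
      linarith [sq_nonneg a]

theorem isStream_fluxStream (h : IsProfile a b g r H) (hT : 0 < T) :
    IsStream l m T (fluxStream r H) (fun z => z.2 * flux r H (z.1 / z.2 ^ 2))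
      (fun z => z.2 ^ 2 * (3 * fluxPrimitive r H (z.1 / z.2 ^ 2)
        - 2 * (z.1 / z.2 ^ 2 * flux r H (z.1 / z.2 ^ 2)))) where
  deriv_x x t ht := by
    refine ((hasDerivAt_selfSimilar_x h.hasDerivAt_fluxPrimitive x t).const_mul
      (t ^ 3)).congr_deriv ?_
    field_simp
  deriv_t x t ht := by
    refine ((hasDerivAt_pow 3 t).mul
      (hasDerivAt_selfSimilar_t h.hasDerivAt_fluxPrimitive x ht)).congr_deriv ?_
    push_cast; field_simp; ring
  cont := by
    have h1 := continuousOn_selfSimilar h.continuous_fluxPrimitive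
    unfold fluxStream; fun_prop
  cont_x := continuous_snd.continuousOn.mul (continuousOn_selfSimilar h.continuous_flux)
  cont_t := by
    have h1 := continuousOn_selfSimilar h.continuous_fluxPrimitive
    have h2 := continuousOn_selfSimilar (continuous_id.mul h.continuous_flux)
    simp only [Pi.mul_apply, id] at h2
    fun_prop
  cont_zero x := by
    have h1 : ContinuousAt (fun t : ℝ => t ^ 3) 0 := by fun_prop
    obtain ⟨C, hC⟩ := h.exists_bound_fluxPrimitive
    refine ContinuousAt.continuousWithinAt ?_
    have h2 : Filter.Tendsto (fun t : ℝ => t ^ 3 * fluxPrimitive r H (x / t ^ 2)) (nhds 0)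
        (nhds 0) := by
      refine Filter.Tendsto.zero_mul_isBoundedUnder_le (by simpa [ContinuousAt] using h1) ?_
      exact Filter.isBoundedUnder_of ⟨C, fun t => hC _⟩
    simpa [ContinuousAt, fluxStream] using h2
  bdd := by
    obtain ⟨C, hC⟩ := h.exists_bound_flux
    obtain ⟨C', hC'⟩ := h.exists_bound_mul_flux
    obtain ⟨D, hD⟩ := h.exists_bound_fluxPrimitive
    have hC0 : 0 ≤ C := (abs_nonneg _).trans (hC 0)
    have hC0' : 0 ≤ C' := (abs_nonneg _).trans (hC' 0)
    have hD0 : 0 ≤ D := (abs_nonneg _).trans (hD 0)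
    refine ⟨T ^ 3 * D + T * C + T ^ 2 * (3 * D + 2 * C'), fun x hx t ht => ?_⟩
    have t0 : 0 < t := ht.1
    have tT : t ≤ T := ht.2.le
    have p1 : 0 ≤ T ^ 3 * D := by positivity
    have p2 : 0 ≤ T * C := by positivity
    have p3 : 0 ≤ T ^ 2 * (3 * D + 2 * C') := by positivity
    have q1 : |t ^ 3 * fluxPrimitive r H (x / t ^ 2)| ≤ T ^ 3 * D := by
      rw [abs_mul, abs_of_pos (pow_pos t0 3)]; gcongr; exact hD _
    have q2 : |t * flux r H (x / t ^ 2)| ≤ T * C := by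
      rw [abs_mul, abs_of_pos t0]; gcongr; exact hC _
    have q3 : |t ^ 2 * (3 * fluxPrimitive r H (x / t ^ 2)
        - 2 * (x / t ^ 2 * flux r H (x / t ^ 2)))| ≤ T ^ 2 * (3 * D + 2 * C') := by
      rw [abs_mul, abs_of_pos (pow_pos t0 2)]
      gcongr
      refine (abs_sub _ _).trans (add_le_add ?_ ?_)
      · rw [abs_mul, abs_of_pos three_pos]; gcongr; exact hD _
      · rw [abs_mul, abs_two]; gcongr; exact hC' _
    refine ⟨?_, ?_, ?_⟩
    · unfold fluxStream; linarith
    · linarith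
    · linarith

end IsProfile

end

section

variable {a b g : ℝ} {r H : ℝ → ℝ}
variable {Ω : Opens Plane} {l m T : ℝ}

/-! ### The weak equations for a profile -/

/-- The rescaled stress: half of the kinetic term of the relaxed set for `v = 0`, so that the
matrix in the eigenvalue constraint becomes a multiple of the identity. Off the mixing interval the
denominator vanishes, and the value is `0`. -/
def stress (a b : ℝ) (r H : ℝ → ℝ) (y : ℝ) : ℝ :=
  1 / 2 * (a ^ 2 + b ^ 2 - r y) * flux r H y ^ 2 / ((a ^ 2 - r y) * (r y - b ^ 2))

/-- The rescaled pressure. -/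
def pressureProfile (a b g : ℝ) (r H : ℝ → ℝ) (y : ℝ) : ℝ :=
  3 * fluxPrimitive r H y - 2 * (y * flux r H y) - g * (1 / 2 * H y) - stress a b r H y

namespace IsProfile

/-- The kinetic term of the eigenvalue constraint is the mean of those of the other two
constraints with weights `(ρ - ρ₋) / (ρ₊ - ρ₋)` and `(ρ₊ - ρ) / (ρ₊ - ρ₋)`. -/
lemma convex_combination {α β u : ℝ} (hα : 0 < α) (hβ : 0 < β) (hs : a ^ 2 = b ^ 2 + α + β) :
    (α + β) * (1 / 2 * (a ^ 2 + b ^ 2 - (b ^ 2 + α)) * u ^ 2 / (β * α))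
      = α * (1 / 2 * a ^ 2 * (g - u / α) ^ 2) + β * (1 / 2 * b ^ 2 * (g + u / β) ^ 2)
        + (α + β) * (g * u - 1 / 2 * (b ^ 2 + α) * g ^ 2) := by
  field_simp
  rw [hs]
  ring

lemma upper_kinBound_le (h : IsProfile a b g r H) (hb : 0 < b) (hg : 0 < g) {y : ℝ}
    (hy : y ∈ mixInterval a b g) :
    1 / 2 * b ^ 2 * (g + flux r H y / (a ^ 2 - r y)) ^ 2 ≤ kinBound a b g r H y := by
  obtain ⟨h1, h2⟩ := h.mem y hy
  have hα : 0 < r y - b ^ 2 := by linarith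
  have hβ : 0 < a ^ 2 - r y := by linarith
  have hu := h.flux_nonneg y hy
  have key : b * (g + flux r H y / (a ^ 2 - r y)) ≤ a * (g - flux r H y / (r y - b ^ 2)) := by
    have e : a * (g - flux r H y / (r y - b ^ 2)) - b * (g + flux r H y / (a ^ 2 - r y))
        = (g * (a - b) * ((r y - b ^ 2) * (a ^ 2 - r y))
          - flux r H y * (a * (a ^ 2 - r y) + b * (r y - b ^ 2)))
          / ((r y - b ^ 2) * (a ^ 2 - r y)) := by
      field_simp; ring
    have : 0 ≤ a * (g - flux r H y / (r y - b ^ 2)) - b * (g + flux r H y / (a ^ 2 - r y)) := by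
      rw [e]; exact div_nonneg (by linarith [h.flux_le y hy]) (by positivity)
    linarith
  have h0 : 0 ≤ b * (g + flux r H y / (a ^ 2 - r y)) := by positivity
  have := pow_le_pow_left₀ h0 key 2
  unfold kinBound
  linarith

lemma stress_le (h : IsProfile a b g r H) (hb : 0 < b) (hg : 0 < g) {y : ℝ}
    (hy : y ∈ mixInterval a b g) :
    stress a b r H y ≤ kinBound a b g r H y + g * flux r H y - 1 / 2 * r y * g ^ 2 := by
  obtain ⟨h1, h2⟩ := h.mem y hy
  have hα : 0 < r y - b ^ 2 := by linarith
  have hβ : 0 < a ^ 2 - r y := by linarith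
  have e := convex_combination (a := a) (b := b) (g := g) (u := flux r H y) hα hβ (by ring)
  have h3 := mul_le_mul_of_nonneg_left (h.upper_kinBound_le hb hg hy) hβ.le
  rw [show b ^ 2 + (r y - b ^ 2) = r y by ring] at e
  refine le_of_mul_le_mul_left ?_ (add_pos hα hβ)
  rw [stress, e]
  have : kinBound a b g r H y = 1 / 2 * a ^ 2 * (g - flux r H y / (r y - b ^ 2)) ^ 2 := rfl
  rw [← this]
  linarith

lemma stress_nonneg (h : IsProfile a b g r H) (hb : 0 < b) (hab : b < a) (y : ℝ) :
    0 ≤ stress a b r H y := by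
  obtain ⟨h1, h2⟩ := h.sq_le_density hb hab y
  unfold stress
  have e1 : 0 ≤ a ^ 2 + b ^ 2 - r y := by linarith [sq_nonneg b]
  have e2 : 0 ≤ a ^ 2 - r y := by linarith
  have e3 : 0 ≤ r y - b ^ 2 := by linarith
  positivity

lemma stress_eq_zero (h : IsProfile a b g r H) {y : ℝ} (hy : y ∉ mixInterval a b g) :
    stress a b r H y = 0 := by
  rw [stress, h.flux_eq_zero hy]; simp

lemma exists_bound_stress (h : IsProfile a b g r H) (hb : 0 < b) (hab : b < a) (hg : 0 < g) :
    ∃ C, ∀ y, |stress a b r H y| ≤ C := by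
  obtain ⟨C, hC⟩ := h.exists_bound_flux
  have hC0 : 0 ≤ C := (abs_nonneg _).trans (hC 0)
  refine ⟨1 / 2 * a ^ 2 * g ^ 2 + g * C, fun y => ?_⟩
  rw [abs_of_nonneg (h.stress_nonneg hb hab y)]
  by_cases hy : y ∈ mixInterval a b g
  · have h1 := h.stress_le hb hg hy
    have h2 := h.kinBound_le hb hab hg hy
    have h3 : g * flux r H y ≤ g * C := by gcongr; exact (le_abs_self _).trans (hC y)
    have h4 : 0 ≤ 1 / 2 * r y * g ^ 2 := by
      have := (sq_nonneg b).trans (h.sq_le_density hb hab y).1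
      positivity
    linarith
  · rw [h.stress_eq_zero hy]; positivity

lemma measurable_stress (h : IsProfile a b g r H) : Measurable (stress a b r H) := by
  have h1 := h.continuous_flux.measurable
  have h2 := h.cont.measurable
  unfold stress
  fun_prop

lemma continuousOn_stress (h : IsProfile a b g r H) :
    ContinuousOn (stress a b r H) (mixInterval a b g) := by
  have h1 := h.continuous_flux
  have h2 := h.cont
  unfold stress
  refine ContinuousOn.div (by fun_prop) (by fun_prop) fun y hy => ?_
  obtain ⟨h3, h4⟩ := h.mem y hy
  exact mul_ne_zero (by linarith) (by linarith)

lemma measurable_pressureProfile (h : IsProfile a b g r H) :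
    Measurable (pressureProfile a b g r H) := by
  have h1 := h.continuous_flux.measurable
  have h2 := h.continuous_fluxPrimitive.measurable
  have h3 := h.continuous_potential.measurable
  have h4 := h.measurable_stress
  unfold pressureProfile
  fun_prop

end IsProfile

lemma IsBox.cylinder_mem (hΩ : IsBox Ω l m) {p : Plane × ℝ} (hp : p ∈ cylinder Ω T) :
    p.1 1 ∈ Ioo l m ∧ p.2 ∈ Ioo 0 T :=
  ⟨((hΩ p.1).1 hp.1).2, hp.2⟩

lemma continuous_coords : Continuous fun p : Plane × ℝ => (p.1 1, p.2) := by fun_prop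

/-- A bounded measurable function of `(x₂, t)` times a test function is integrable on the
cylinder. -/
lemma IsBox.integrableOn_mul (hΩ : IsBox Ω l m) {A : Set (Plane × ℝ)} {f : ℝ × ℝ → ℝ}
    {Ψ : Plane × ℝ → ℝ} (hΨ : IsTest A Ψ) (hf : Measurable f)
    (hb : ∃ C, ∀ x ∈ Ioo l m, ∀ t ∈ Ioo 0 T, |f (x, t)| ≤ C) :
    IntegrableOn (fun p : Plane × ℝ => f (p.1 1, p.2) * Ψ p)
      (cylinder Ω T : Set (Plane × ℝ)) := by
  obtain ⟨C, hC⟩ := hb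
  obtain ⟨D, hD⟩ := hΨ.exists_bound
  refine IntegrableOn.of_bound (C := C * D) hΩ.cylinder_volume_lt_top
    ((hf.comp continuous_coords.measurable).mul
      hΨ.smooth.continuous.measurable).aestronglyMeasurable
    ((ae_restrict_iff' (cylinder Ω T).isOpen.measurableSet).2 (.of_forall fun p hp => ?_))
  obtain ⟨h1, h2⟩ := hΩ.cylinder_mem hp
  rw [norm_mul]
  exact mul_le_mul (hC _ h1 _ h2) (hD p) (norm_nonneg _) ((abs_nonneg _).trans (hC _ h1 _ h2))

lemma continuous_mul_stepDensity (rm rp : ℝ) : Continuous fun x : ℝ => x * stepDensity rm rp x := by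
  have : (fun x : ℝ => x * stepDensity rm rp x) = fun x => rp * max x 0 + rm * min x 0 := by
    funext x
    unfold stepDensity
    split_ifs with hx
    · rw [max_eq_left hx.le, min_eq_right hx.le]; ring
    · rw [max_eq_right (not_lt.1 hx), min_eq_left (not_lt.1 hx)]; ring
  rw [this]; fun_prop

lemma stepDensity_eventually_eq (rm rp : ℝ) {y : ℝ} (hy : y ≠ 0) :
    ∀ᶠ x in nhds y, stepDensity rm rp x = stepDensity rm rp y := by
  rcases lt_or_gt_of_ne hy with h | h
  · filter_upwards [Iio_mem_nhds h] with x hx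
    rw [stepDensity, stepDensity, if_neg (not_lt.2 (le_of_lt hx)), if_neg (not_lt.2 h.le)]
  · filter_upwards [Ioi_mem_nhds h] with x hx
    rw [stepDensity, stepDensity, if_pos (mem_Ioi.1 hx), if_pos h]

/-- Integration by parts in `x₂` for the initial datum. -/
lemma integral_initial (hΩ : IsBox Ω l m) (hlm : l ≤ m) {Ψ : Plane × ℝ → ℝ}
    (hΨ : IsTest ((Ω : Set Plane) ×ˢ Iio T) Ψ) (rm rp : ℝ) :
    (∫ x in (Ω : Set Plane), x 1 * stepDensity rm rp (x 1) * dx 1 Ψ (x, 0))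
      + ∫ x in (Ω : Set Plane), stepDensity rm rp (x 1) * Ψ (x, 0) = 0 := by
  have hstep : Measurable (stepDensity rm rp) :=
    Measurable.ite measurableSet_Ioi measurable_const measurable_const
  have hsb : ∀ x, |stepDensity rm rp x| ≤ max |rm| |rp| := by
    intro x; unfold stepDensity; split_ifs
    · exact le_max_right _ _
    · exact le_max_left _ _
  have c0 : Continuous fun x : Plane => (x, (0 : ℝ)) := by fun_prop
  have c1 : Measurable fun x : Plane => x 1 := by fun_prop
  obtain ⟨D, hD⟩ := hΨ.exists_bound
  obtain ⟨D', hD'⟩ := (hΨ.dx 1).exists_bound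
  have hmax : 0 ≤ max |l| |m| := (abs_nonneg _).trans (le_max_left _ _)
  have i1 : IntegrableOn (fun x : Plane => x 1 * stepDensity rm rp (x 1) * dx 1 Ψ (x, 0)) Ω := by
    refine IntegrableOn.of_bound (C := max |l| |m| * max |rm| |rp| * D') hΩ.volume_lt_top
      ((c1.mul (hstep.comp c1)).mul
        ((hΨ.dx 1).smooth.continuous.comp c0).measurable).aestronglyMeasurable
      ((ae_restrict_iff' Ω.isOpen.measurableSet).2 (.of_forall fun x hx => ?_))
    have hx' := ((hΩ x).1 hx).2
    rw [norm_mul, norm_mul]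
    exact mul_le_mul (mul_le_mul (abs_le_max_abs_abs hx'.1.le hx'.2.le) (hsb _) (norm_nonneg _)
      hmax) (hD' _) (norm_nonneg _) (mul_nonneg hmax ((abs_nonneg _).trans (le_max_left _ _)))
  have i2 : IntegrableOn (fun x : Plane => stepDensity rm rp (x 1) * Ψ (x, 0)) Ω := by
    refine IntegrableOn.of_bound (C := max |rm| |rp| * D) hΩ.volume_lt_top
      ((hstep.comp c1).mul (hΨ.smooth.continuous.comp c0).measurable).aestronglyMeasurable
      (.of_forall fun x => ?_)
    rw [norm_mul]
    exact mul_le_mul (hsb _) (hD _) (norm_nonneg _) ((abs_nonneg _).trans (hsb 0))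
  rw [← integral_add i1 i2, hΩ.integral_eq]
  set f : ℝ × ℝ → ℝ := fun q => q.2 * stepDensity rm rp q.2 * dx 1 Ψ (pt q.1 q.2, 0)
      + stepDensity rm rp q.2 * Ψ (pt q.1 q.2, 0) with hf
  have hi : IntegrableOn f (Ioo 0 1 ×ˢ Ioo l m) := by
    have := measurePreserving_planeCoords.integrableOn_comp_preimage
      planeCoords.measurableEmbedding (f := fun x : Plane => x 1 * stepDensity rm rp (x 1)
        * dx 1 Ψ (x, 0) + stepDensity rm rp (x 1) * Ψ (x, 0)) (s := (Ω : Set Plane)) |>.2 (i1.add i2)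
    rwa [hΩ.preimage] at this
  simp only [pt_one]
  change ∫ q in Ioo 0 1 ×ˢ Ioo l m, f q = 0
  rw [Measure.volume_eq_prod, setIntegral_prod _ hi]
  refine integral_eq_zero_of_ae (.of_forall fun x₁ => ?_)
  have cx : Continuous fun x₂ => (pt x₁ x₂, (0 : ℝ)) :=
    (continuous_pt.comp (Continuous.prodMk_right x₁)).prodMk continuous_const
  have cmax := continuous_mul_stepDensity rm rp
  have hd : ∀ x₂ ∈ Ioo (min l m) (max l m) \ {(0 : ℝ)},
      HasDerivAt (fun x => x * stepDensity rm rp x * Ψ (pt x₁ x, 0)) (f (x₁, x₂)) x₂ := by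
    rintro x₂ ⟨-, h0⟩
    have e := stepDensity_eventually_eq rm rp h0
    have h1 := ((hasDerivAt_id x₂).mul_const (stepDensity rm rp x₂)).mul
      (hΨ.hasDerivAt_x₂ x₁ x₂ 0)
    refine (h1.congr_of_eventuallyEq ?_).congr_deriv ?_
    · filter_upwards [e] with x hx
      simp [hx]
    · simp only [hf, id]; ring
  change ∫ x₂ in Ioo l m, f (x₁, x₂) = 0
  rw [← integral_Ioc_eq_integral_Ioo, ← intervalIntegral.integral_of_le hlm,
    integral_eq_of_hasDerivAt_off_countable (fun x => x * stepDensity rm rp x * Ψ (pt x₁ x, 0)) _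
      (countable_singleton 0) (cmax.mul (hΨ.smooth.continuous.comp cx)).continuousOn hd,
    hΨ.eq_zero, hΨ.eq_zero]
  · simp
  · rintro ⟨h, -⟩; exact ((hΩ _).1 h).2.1.false
  · rintro ⟨h, -⟩; exact ((hΩ _).1 h).2.2.false
  · refine IntervalIntegrable.add ?_ ?_
    · exact (cmax.mul ((hΨ.dx 1).smooth.continuous.comp cx)).intervalIntegrable _ _
    · have hs : IntervalIntegrable (stepDensity rm rp) volume l m := by
        rw [intervalIntegrable_iff_integrableOn_Ioc_of_le hlm]
        exact IntegrableOn.of_bound (C := max |rm| |rp|) (by simp) hstep.aestronglyMeasurable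
          (.of_forall hsb)
      exact hs.mul_continuousOn (hΨ.smooth.continuous.comp cx).continuousOn

namespace IsProfile

/-- The continuity equation. -/
theorem weak_continuity (h : IsProfile a b g r H) (hb : 0 < b) (hab : b < a) (hg : 0 < g)
    (hΩ : IsBox Ω l m) (hlm : l ≤ m) (hT : 0 < T) {Ψ : Plane × ℝ → ℝ}
    (hΨ : IsTest ((Ω : Set Plane) ×ˢ Iio T) Ψ) :
    (∫ p in (cylinder Ω T : Set (Plane × ℝ)), (r (p.1 1 / p.2 ^ 2) * dt Ψ p
        - p.2 * flux r H (p.1 1 / p.2 ^ 2) * dx 1 Ψ p))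
      + ∫ x in (Ω : Set Plane), stepDensity (b ^ 2) (a ^ 2) (x 1) * Ψ (x, 0) = 0 := by
  have h1 := (h.isStream_massStream (l := l) (m := m) hb hab hg hT).integral_eq hΩ hlm hT hΨ
  have h2 := integral_initial hΩ hlm hΨ (b ^ 2) (a ^ 2)
  simp only [massStream, lt_irrefl, if_false] at h1
  rw [h1]; exact h2

lemma exists_bound_pressure (h : IsProfile a b g r H) (hb : 0 < b) (hab : b < a) (hg : 0 < g)
    (hT : 0 < T) : ∃ C, ∀ x ∈ Ioo l m, ∀ t ∈ Ioo 0 T,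
      |t ^ 2 * pressureProfile a b g r H (x / t ^ 2)| ≤ C := by
  obtain ⟨CV, hCV⟩ := (h.isStream_fluxStream (l := l) (m := m) hT).bdd
  obtain ⟨CW, hCW⟩ := (h.isStream_massStream (l := l) (m := m) hb hab hg hT).bdd
  obtain ⟨CS, hCS⟩ := h.exists_bound_stress hb hab hg
  refine ⟨CV + g * CW + T ^ 2 * CS, fun x hx t ht => ?_⟩
  have t0 : 0 < t := ht.1
  have tT : t ≤ T := ht.2.le
  have b1 := (hCV x hx t ht).2.2
  have b2 := (hCW x hx t ht).1
  simp only [massStream, t0, if_true] at b2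
  have e : t ^ 2 * pressureProfile a b g r H (x / t ^ 2)
      = t ^ 2 * (3 * fluxPrimitive r H (x / t ^ 2) - 2 * (x / t ^ 2 * flux r H (x / t ^ 2)))
        - g * (1 / 2 * t ^ 2 * H (x / t ^ 2)) - t ^ 2 * stress a b r H (x / t ^ 2) := by
    unfold pressureProfile; ring
  rw [e]
  refine (abs_sub _ _).trans (add_le_add ((abs_sub _ _).trans (add_le_add b1 ?_)) ?_)
  · rw [abs_mul, abs_of_pos hg]; gcongr
  · rw [abs_mul, abs_of_pos (pow_pos t0 2)]; gcongr; exact hCS _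

/-- The momentum equation with the pressure, tested with fields that need not vanish at `t = 0`. -/
theorem weak_momentum (h : IsProfile a b g r H) (hb : 0 < b) (hab : b < a) (hg : 0 < g)
    (hΩ : IsBox Ω l m) (hlm : l ≤ m) (hT : 0 < T) {φ₀ φ₁ : Plane × ℝ → ℝ}
    (h₀ : IsTest ((Ω : Set Plane) ×ˢ Iio T) φ₀) (h₁ : IsTest ((Ω : Set Plane) ×ˢ Iio T) φ₁) :
    (∫ p in (cylinder Ω T : Set (Plane × ℝ)),
      (-(p.2 * flux r H (p.1 1 / p.2 ^ 2)) * dt φ₁ p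
        + p.2 ^ 2 * stress a b r H (p.1 1 / p.2 ^ 2) * (dx 1 φ₁ p - dx 0 φ₀ p)
        - g * r (p.1 1 / p.2 ^ 2) * φ₁ p))
      + ∫ p in (cylinder Ω T : Set (Plane × ℝ)),
        p.2 ^ 2 * pressureProfile a b g r H (p.1 1 / p.2 ^ 2) * (dx 0 φ₀ p + dx 1 φ₁ p) = 0 := by
  have sV := h.isStream_fluxStream (l := l) (m := m) hT
  have sW := h.isStream_massStream (l := l) (m := m) hb hab hg hT
  have e1 := sV.integral_eq hΩ hlm hT h₁
  have e2 := integral_deriv_x_mul (F₂ := fun z => r (z.1 / z.2 ^ 2)) hΩ hlm h₁ sW.deriv_x fun t _ =>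
    h.cont.comp (continuous_id.div_const (t ^ 2))
  have e3 := integral_mul_dx_zero hΩ h₀ (fun z : ℝ × ℝ => z.2 ^ 2 *
    (pressureProfile a b g r H (z.1 / z.2 ^ 2) - stress a b r H (z.1 / z.2 ^ 2)))
  obtain ⟨CV, hCV⟩ := sV.bdd
  obtain ⟨CW, hCW⟩ := sW.bdd
  obtain ⟨CS, hCS⟩ := h.exists_bound_stress hb hab hg
  have hS : ∀ x, ∀ t ∈ Ioo 0 T, |t ^ 2 * stress a b r H (x / t ^ 2)| ≤ T ^ 2 * CS := by
    intro x t ht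
    have t0 : 0 < t := ht.1
    have tT : t ≤ T := ht.2.le
    rw [abs_mul, abs_of_pos (pow_pos t0 2)]; gcongr; exact hCS _
  have mflux := measurable_selfSimilar h.continuous_flux.measurable
  have mr := measurable_selfSimilar h.cont.measurable
  have mH := measurable_selfSimilar h.continuous_potential.measurable
  have mS := measurable_selfSimilar h.measurable_stress
  have mP := measurable_selfSimilar (h.measurable_pressureProfile)
  have mh := measurable_selfSimilar h.continuous_fluxPrimitive.measurable
  have myf := measurable_selfSimilar (measurable_id.mul h.continuous_flux.measurable)
  simp only [Pi.mul_apply, id] at myf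
  have mW : Measurable fun z : ℝ × ℝ => 1 / 2 * z.2 ^ 2 * H (z.1 / z.2 ^ 2) :=
    (measurable_const.mul (measurable_snd.pow_const 2)).mul mH
  have hWeq : ∀ x t : ℝ, 0 < t → massStream a b H (x, t) = 1 / 2 * t ^ 2 * H (x / t ^ 2) :=
    fun x t ht => by simp only [massStream, ht, if_true]
  have i1 := hΩ.integrableOn_mul (T := T) h₁.dt (f := fun z => z.2 * flux r H (z.1 / z.2 ^ 2))
    (by fun_prop) ⟨CV, fun x hx t ht => (hCV x hx t ht).2.1⟩
  have i2 := hΩ.integrableOn_mul (T := T) (h₁.dx 1) (f := fun z : ℝ × ℝ =>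
    z.2 ^ 2 * (3 * fluxPrimitive r H (z.1 / z.2 ^ 2)
        - 2 * (z.1 / z.2 ^ 2 * flux r H (z.1 / z.2 ^ 2))))
    (by fun_prop) ⟨CV, fun x hx t ht => (hCV x hx t ht).2.2⟩
  have i3 := hΩ.integrableOn_mul (T := T) h₁ (f := fun z => r (z.1 / z.2 ^ 2))
    mr ⟨CW, fun x hx t ht => (hCW x hx t ht).2.1⟩
  have i4 := hΩ.integrableOn_mul (T := T) (h₁.dx 1)
    (f := fun z : ℝ × ℝ => 1 / 2 * z.2 ^ 2 * H (z.1 / z.2 ^ 2)) mW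
    ⟨CW, fun x hx t ht => by rw [← hWeq x t ht.1]; exact (hCW x hx t ht).1⟩
  have iS {χ : Plane × ℝ → ℝ} (hχ : IsTest ((Ω : Set Plane) ×ˢ Iio T) χ) :=
    hΩ.integrableOn_mul (T := T) hχ (f := fun z : ℝ × ℝ => z.2 ^ 2 * stress a b r H (z.1 / z.2 ^ 2))
      (by fun_prop) ⟨T ^ 2 * CS, fun x _ t ht => hS x t ht⟩
  have iP {χ : Plane × ℝ → ℝ} (hχ : IsTest ((Ω : Set Plane) ×ˢ Iio T) χ) :=
    hΩ.integrableOn_mul (T := T) hχ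
      (f := fun z : ℝ × ℝ => z.2 ^ 2 * pressureProfile a b g r H (z.1 / z.2 ^ 2))
      (by fun_prop) (h.exists_bound_pressure hb hab hg hT)
  have i5 := (iP (h₀.dx 0)).sub (iS (h₀.dx 0))
  have z1 : ∫ x in (Ω : Set Plane), fluxStream r H (x 1, 0) * dx 1 φ₁ (x, 0) = 0 := by
    simp [fluxStream]
  rw [z1] at e1
  have e2' : ∫ p in (cylinder Ω T : Set (Plane × ℝ)), (r (p.1 1 / p.2 ^ 2) * φ₁ p
      + 1 / 2 * p.2 ^ 2 * H (p.1 1 / p.2 ^ 2) * dx 1 φ₁ p) = 0 := by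
    rw [← e2]
    refine setIntegral_congr_fun (cylinder Ω T).isOpen.measurableSet fun p hp => ?_
    simp only [hWeq _ _ hp.2.1]
  have e3' : ∫ p in (cylinder Ω T : Set (Plane × ℝ)),
      (p.2 ^ 2 * pressureProfile a b g r H (p.1 1 / p.2 ^ 2) * dx 0 φ₀ p
        - p.2 ^ 2 * stress a b r H (p.1 1 / p.2 ^ 2) * dx 0 φ₀ p) = 0 := by
    rw [← e3]
    exact integral_congr_ae (.of_forall fun p => by ring)
  have key := integral_add (((i1.sub i2).neg).sub ((i3.add i4).const_mul g)) i5
  have key2 := integral_sub ((i1.sub i2).neg) ((i3.add i4).const_mul g)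
  simp only [Pi.sub_apply, Pi.neg_apply, Pi.add_apply] at key key2
  rw [key2, integral_neg, e1, integral_const_mul, e2', e3'] at key
  rw [show (-0 - g * 0 + 0 : ℝ) = 0 by ring] at key
  have iA := (i1.neg.add ((iS (h₁.dx 1)).sub (iS (h₀.dx 0)))).sub (i3.const_mul g)
  have iB := (iP (h₀.dx 0)).add (iP (h₁.dx 1))
  have key3 := integral_add iA iB
  simp only [Pi.sub_apply, Pi.neg_apply, Pi.add_apply] at key3
  calc _ = _ := by
        congr 1 <;> refine integral_congr_ae (.of_forall fun p => ?_)
        exacts [by ring, by ring]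
    _ = _ := key3.symm
    _ = _ := integral_congr_ae (.of_forall fun p => by simp only [pressureProfile]; ring)
    _ = 0 := key

end IsProfile

end

section

variable {a b g δ : ℝ} {r H : ℝ → ℝ}
variable {Ω : Opens Plane} {l m T : ℝ}

/-! ### The subsolution of a profile -/

/-- The distribution given by a locally integrable function. -/
def distributionOf (U : Opens (Plane × ℝ)) (f : Plane × ℝ → ℝ) : 𝓓'(U, ℝ) where
  toFun ψ := TestFunction.integralAgainstBilinCLM (𝕜 := ℝ) (ContinuousLinearMap.mul ℝ ℝ) volume f ψ
  map_add' _ _ := map_add _ _ _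
  map_smul' _ _ := map_smul _ _ _
  cont := (TestFunction.integralAgainstBilinCLM (𝕜 := ℝ)
    (ContinuousLinearMap.mul ℝ ℝ) volume f).continuous

lemma distributionOf_apply {U : Opens (Plane × ℝ)} {f : Plane × ℝ → ℝ}
    (hf : LocallyIntegrableOn f U) (ψ : 𝓓(U, ℝ)) :
    distributionOf U f ψ = ∫ p in (U : Set (Plane × ℝ)), f p * ψ p := by
  have h1 : distributionOf U f ψ = ∫ p, ψ p * f p :=
    TestFunction.integralAgainstBilinCLM_eq_integral hf
  rw [h1, setIntegral_eq_integral_of_forall_compl_eq_zero]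
  · exact integral_congr_ae (.of_forall fun p => mul_comm _ _)
  · intro p hp
    rw [image_eq_zero_of_notMem_tsupport fun h => hp (ψ.tsupport_subset h), mul_zero]

/-- The self-similar state of a profile. -/
def profileState (a b g : ℝ) (r H : ℝ → ℝ) (Ω : Opens Plane) (T : ℝ) : State Ω T where
  rho p := r (p.1 1 / p.2 ^ 2)
  v _ := 0
  u p := p.2 • (-flux r H (p.1 1 / p.2 ^ 2) • e2)
  S p := p.2 ^ 2 • Matrix.diagonal ![-stress a b r H (p.1 1 / p.2 ^ 2),
    stress a b r H (p.1 1 / p.2 ^ 2)]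
  P := distributionOf _ fun p => p.2 ^ 2 * pressureProfile a b g r H (p.1 1 / p.2 ^ 2)

/-- The mixing zone: over the mixing interval in `x₂ / t²`. -/
def mixZone (a b g T : ℝ) : Set (Plane × ℝ) :=
  {p | (0 < p.1 0 ∧ p.1 0 < 1) ∧ p.2 ∈ Ioo 0 T ∧ p.1 1 / p.2 ^ 2 ∈ mixInterval a b g}

open Classical in
/-- The energy bound `e`: slightly above what the constraints ask for in the mixing zone, and the
value forced by the constraint set of the Euler equations outside. -/
def energyBound (a b g T δ : ℝ) (r H : ℝ → ℝ) (p : Plane × ℝ) : ℝ :=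
  if p ∈ mixZone a b g T then p.2 ^ 2 * (kinBound a b g r H (p.1 1 / p.2 ^ 2) + δ)
  else 1 / 2 * r (p.1 1 / p.2 ^ 2) * g ^ 2 * p.2 ^ 2

@[simp] lemma e2_zero : e2 0 = 0 := by simp [e2]
@[simp] lemma e2_one : e2 1 = 1 := by simp [e2]

lemma norm_smul_e2_sq (c : ℝ) : ‖c • e2‖ ^ 2 = c ^ 2 := by
  rw [norm_smul, e2, PiLp.norm_single, norm_one, mul_one, Real.norm_eq_abs, sq_abs]

lemma lambdaMax_smul_one (c : ℝ) : lambdaMax (c • (1 : Matrix (Fin 2) (Fin 2) ℝ)) = c := by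
  rw [lambdaMax, ← Algebra.algebraMap_eq_smul_one, spectrum.scalar_eq, csSup_singleton]

lemma matA_eq {rm rp ρ u τ t : ℝ}
    (hτ : τ = 1 / 2 * (rp + rm - ρ) * u ^ 2 / ((rp - ρ) * (ρ - rm))) :
    matA rm rp ρ 0 (t • (-u • e2)) (t ^ 2 • Matrix.diagonal ![-τ, τ])
      = (t ^ 2 * τ) • (1 : Matrix (Fin 2) (Fin 2) ℝ) := by
  ext i j
  fin_cases i <;> fin_cases j <;> simp [matA, tensor]
  rw [hτ]
  simp only [div_eq_mul_inv, mul_inv]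
  ring

lemma mem_mixZone_iff {p : Plane × ℝ} : p ∈ mixZone a b g T ↔ (0 < p.1 0 ∧ p.1 0 < 1) ∧
    p.2 ∈ Ioo 0 T ∧ -edgeMinus a b g * p.2 ^ 2 < p.1 1 ∧ p.1 1 < edgePlus a b g * p.2 ^ 2 := by
  refine and_congr_right fun _ => and_congr_right fun ht => ?_
  have : 0 < p.2 ^ 2 := pow_pos ht.1 2
  rw [mixInterval, mem_Ioo, lt_div_iff₀ this, div_lt_iff₀ this]

lemma isOpen_mixZone : IsOpen (mixZone a b g T) := by
  have : mixZone a b g T = {p | (0 < p.1 0 ∧ p.1 0 < 1) ∧ (0 < p.2 ∧ p.2 < T) ∧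
      -edgeMinus a b g * p.2 ^ 2 < p.1 1 ∧ p.1 1 < edgePlus a b g * p.2 ^ 2} := by
    ext p; exact mem_mixZone_iff
  rw [this]
  have h0 : Continuous fun p : Plane × ℝ => p.1 0 := by fun_prop
  have h1 : Continuous fun p : Plane × ℝ => p.1 1 := by fun_prop
  have h2 : Continuous fun p : Plane × ℝ => p.2 := continuous_snd
  exact ((isOpen_lt continuous_const h0).inter (isOpen_lt h0 continuous_const)).inter
    (((isOpen_lt continuous_const h2).inter (isOpen_lt h2 continuous_const)).inter
      ((isOpen_lt (continuous_const.mul (h2.pow 2)) h1).inter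
        (isOpen_lt h1 (continuous_const.mul (h2.pow 2)))))

lemma continuousOn_ratio : ContinuousOn (fun p : Plane × ℝ => p.1 1 / p.2 ^ 2)
    (mixZone a b g T) := by
  refine ContinuousOn.div (by fun_prop) (by fun_prop) fun p hp => ?_
  exact (pow_pos hp.2.1.1 2).ne'

lemma measurable_ratio {f : ℝ → ℝ} (hf : Measurable f) :
    Measurable fun p : Plane × ℝ => f (p.1 1 / p.2 ^ 2) := by
  have : Measurable fun p : Plane × ℝ => p.1 1 := by fun_prop
  fun_prop

/-- The domain is the final cross-section of the mixing zone. -/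
def IsFinalBox (a b g T : ℝ) (Ω : Opens Plane) : Prop :=
  IsBox Ω (-edgeMinus a b g * T ^ 2) (edgePlus a b g * T ^ 2)

lemma IsFinalBox.mixZone_subset (hΩ : IsFinalBox a b g T Ω) (hb : 0 < b) (hab : b < a)
    (hg : 0 < g) : mixZone a b g T ⊆ (cylinder Ω T : Set (Plane × ℝ)) := by
  intro p hp
  obtain ⟨h0, ht, h1, h2⟩ := mem_mixZone_iff.1 hp
  have e1 := edgeMinus_pos hb hab hg
  have e2 := edgePlus_pos hb hab hg
  have ht2 : p.2 ^ 2 ≤ T ^ 2 := pow_le_pow_left₀ ht.1.le ht.2.le 2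
  refine ⟨(hΩ _).2 ⟨h0, ?_, ?_⟩, ht⟩
  · nlinarith
  · nlinarith

lemma IsBox.mem_mixZone_iff' (hΩ : IsBox Ω l m) {p : Plane × ℝ} (hp : p ∈ cylinder Ω T) :
    p ∈ mixZone a b g T ↔ p.1 1 / p.2 ^ 2 ∈ mixInterval a b g :=
  ⟨fun h => h.2.2, fun h => ⟨((hΩ _).1 hp.1).1, hp.2, h⟩⟩

namespace IsProfile

lemma locallyIntegrableOn_pressure (h : IsProfile a b g r H) (hb : 0 < b) (hab : b < a)
    (hg : 0 < g) (hT : 0 < T) (hΩ : IsBox Ω l m) :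
    LocallyIntegrableOn (fun p : Plane × ℝ => p.2 ^ 2 * pressureProfile a b g r H (p.1 1 / p.2 ^ 2))
      (cylinder Ω T : Set (Plane × ℝ)) := by
  obtain ⟨C, hC⟩ := h.exists_bound_pressure (l := l) (m := m) hb hab hg hT
  refine IntegrableOn.locallyIntegrableOn (IntegrableOn.of_bound (C := C)
    hΩ.cylinder_volume_lt_top ?_ ?_)
  · exact ((measurable_snd.pow_const 2).mul
      (measurable_ratio h.measurable_pressureProfile)).aestronglyMeasurable
  · refine (ae_restrict_iff' (cylinder Ω T).isOpen.measurableSet).2 (.of_forall fun p hp => ?_)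
    exact hC _ (hΩ.cylinder_mem hp).1 _ (hΩ.cylinder_mem hp).2

/-- The integrand of the momentum equation for the state of a profile. -/
lemma momentum_integrand {Φ : Plane × ℝ → Plane} {A : Set (Plane × ℝ)} (hΦ : IsTest A Φ)
    (p : Plane × ℝ) :
    (∑ i, (profileState a b g r H Ω T).u p i * dt Φ p i)
        + (∑ i, ∑ j, (profileState a b g r H Ω T).S p i j * dx j Φ p i)
        - g * (profileState a b g r H Ω T).rho p * Φ p 1
      = -(p.2 * flux r H (p.1 1 / p.2 ^ 2)) * dt (fun p => Φ p 1) p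
        + p.2 ^ 2 * stress a b r H (p.1 1 / p.2 ^ 2)
          * (dx 1 (fun p => Φ p 1) p - dx 0 (fun p => Φ p 0) p)
        - g * r (p.1 1 / p.2 ^ 2) * Φ p 1 := by
  have e1 : dt Φ p 1 = dt (fun p => Φ p 1) p := hΦ.fderiv_coord 1 p _
  have e2 : dx 1 Φ p 1 = dx 1 (fun p => Φ p 1) p := hΦ.fderiv_coord 1 p _
  have e3 : dx 0 Φ p 0 = dx 0 (fun p => Φ p 0) p := hΦ.fderiv_coord 0 p _
  rw [← e1, ← e2, ← e3]
  simp [profileState, Fin.sum_univ_two]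
  ring

lemma divx_eq {Φ : Plane × ℝ → Plane} {A : Set (Plane × ℝ)} (hΦ : IsTest A Φ) (p : Plane × ℝ) :
    divx Φ p = dx 0 (fun p => Φ p 0) p + dx 1 (fun p => Φ p 1) p := by
  rw [divx, Fin.sum_univ_two]
  exact congrArg₂ _ (hΦ.fderiv_coord 0 p _) (hΦ.fderiv_coord 1 p _)

theorem solves (h : IsProfile a b g r H) (hb : 0 < b) (hab : b < a) (hg : 0 < g)
    (hT : 0 < T) (hΩ : IsBox Ω l m) (hlm : l ≤ m) :
    SolvesLinearSystem g (profileState a b g r H Ω T) (rtDensity (b ^ 2) (a ^ 2)) fun _ => 0 where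
  div_free Ψ _ := by simp [profileState]
  momentum Φ hΦ hdiv := by
    have key := h.weak_momentum hb hab hg hΩ hlm hT (hΦ.coord 0) (hΦ.coord 1)
    simp only [momentum_integrand hΦ, PiLp.zero_apply, zero_mul, Finset.sum_const_zero, mul_zero,
      integral_zero, add_zero]
    refine (add_eq_left.2 ?_).symm.trans key
    refine setIntegral_eq_zero_of_forall_eq_zero fun p hp => ?_
    rw [← divx_eq hΦ, hdiv p ⟨hp.1, hp.2.1.le, hp.2.2⟩, mul_zero]
  pressure Φ hΦ ψ hψ := by
    have hΦ' : IsTest ((Ω : Set Plane) ×ˢ Iio T) Φ :=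
      ⟨hΦ.smooth, hΦ.compact, hΦ.support.trans (prod_mono le_rfl fun _ h => h.2)⟩
    have key := h.weak_momentum hb hab hg hΩ hlm hT (hΦ'.coord 0) (hΦ'.coord 1)
    simp only [momentum_integrand hΦ]
    have e : (profileState a b g r H Ω T).P ψ = _ :=
      distributionOf_apply (h.locallyIntegrableOn_pressure hb hab hg hT hΩ) ψ
    rw [e]
    simp only [hψ, divx_eq hΦ]
    exact key
  continuity Ψ hΨ := by
    have key := h.weak_continuity hb hab hg hΩ hlm hT hΨ
    refine Eq.trans (congrArg₂ _ ?_ rfl) key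
    refine integral_congr_ae (.of_forall fun p => ?_)
    simp [profileState, Fin.sum_univ_two]
    ring

lemma inU (h : IsProfile a b g r H) (hb : 0 < b) (hg : 0 < g) (hδ : 0 < δ)
    {t y : ℝ} (ht : 0 < t) (hy : y ∈ mixInterval a b g) :
    InU (b ^ 2) (a ^ 2) g t (t ^ 2 * (kinBound a b g r H y + δ)) (r y) 0
      (t • (-flux r H y • e2))
      (t ^ 2 • Matrix.diagonal ![-stress a b r H y, stress a b r H y]) := by
  have hm := h.mem y hy
  have hα : 0 < r y - b ^ 2 := by linarith
  have hβ : 0 < a ^ 2 - r y := by linarith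
  have ht2 : 0 < t ^ 2 := by positivity
  refine ⟨hm, ?_, ?_, ?_⟩
  · have e : t • (-flux r H y • e2) - b ^ 2 • (0 : Plane) + ((r y - b ^ 2) * g * t) • e2
        = (t * ((r y - b ^ 2) * g - flux r H y)) • e2 := by
      rw [smul_zero, sub_zero, smul_smul, ← add_smul]; congr 1; ring
    rw [e, norm_smul_e2_sq]
    have e' : a ^ 2 / 2 * ((t * ((r y - b ^ 2) * g - flux r H y)) ^ 2 / (r y - b ^ 2) ^ 2)
        = t ^ 2 * kinBound a b g r H y := by
      unfold kinBound; field_simp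
    rw [e']; gcongr; linarith
  · have e : t • (-flux r H y • e2) - a ^ 2 • (0 : Plane) + ((r y - a ^ 2) * g * t) • e2
        = (t * ((r y - a ^ 2) * g - flux r H y)) • e2 := by
      rw [smul_zero, sub_zero, smul_smul, ← add_smul]; congr 1; ring
    rw [e, norm_smul_e2_sq]
    have e' : b ^ 2 / 2 * ((t * ((r y - a ^ 2) * g - flux r H y)) ^ 2 / (r y - a ^ 2) ^ 2)
        = t ^ 2 * (1 / 2 * b ^ 2 * (g + flux r H y / (a ^ 2 - r y)) ^ 2) := by
      rw [show (r y - a ^ 2) ^ 2 = (a ^ 2 - r y) ^ 2 by ring]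
      field_simp; ring
    rw [e']
    have := h.upper_kinBound_le hb hg hy
    gcongr; linarith
  · rw [matA_eq (by rw [stress]), lambdaMax_smul_one]
    have h1 := h.stress_le hb hg hy
    simp only [PiLp.smul_apply, e2_one, smul_eq_mul]
    have h2 : t ^ 2 * stress a b r H y
        < t ^ 2 * (kinBound a b g r H y + δ + g * flux r H y - 1 / 2 * r y * g ^ 2) := by
      gcongr; linarith
    linarith

lemma inK (h : IsProfile a b g r H) {t y : ℝ} (hy : y ∉ mixInterval a b g) :
    InK (b ^ 2) (a ^ 2) g t (1 / 2 * r y * g ^ 2 * t ^ 2) (r y) 0 (t • (-flux r H y • e2))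
      (t ^ 2 • Matrix.diagonal ![-stress a b r H y, stress a b r H y]) := by
  refine ⟨?_, ?_, ?_⟩
  · rcases lt_or_ge (-edgeMinus a b g) y with h1 | h1
    · exact .inr (h.above y (not_lt.1 fun h2 => hy ⟨h1, h2⟩)).1
    · exact .inl (h.below y h1).1
  · rw [h.flux_eq_zero hy]; simp
  · rw [h.stress_eq_zero hy]
    have e : 1 / 2 * r y * g ^ 2 * t ^ 2 - r y * g * t * (0 : Plane) 1
        - 1 / 2 * r y * g ^ 2 * t ^ 2 = 0 := by simp
    rw [e]
    ext i j
    fin_cases i <;> fin_cases j <;> simp [tensor]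

end IsProfile

lemma isInitialData (rm rp : ℝ) :
    IsInitialData rm rp Ω (rtDensity rm rp) fun _ => 0 where
  rho_bdd := by
    have hm : Measurable (rtDensity rm rp) :=
      Measurable.ite (measurableSet_lt measurable_const (by fun_prop)) measurable_const
        measurable_const
    refine memLp_top_of_bound hm.aestronglyMeasurable (max |rm| |rp|) (.of_forall fun x => ?_)
    unfold rtDensity; split_ifs
    · exact le_max_right _ _
    · exact le_max_left _ _
  v_sq := MemLp.zero'
  div_free ψ _ _ _ := by simp
  two_phase := .of_forall fun x => by unfold rtDensity; split_ifs <;> simp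

theorem IsProfile.isSubsolution (h : IsProfile a b g r H) (hb : 0 < b) (hab : b < a) (hg : 0 < g)
    (hT : 0 < T) (hδ : 0 < δ) (hΩ : IsFinalBox a b g T Ω) :
    IsSubsolution (b ^ 2) (a ^ 2) g (energyBound a b g T δ r H) (profileState a b g r H Ω T)
      (rtDensity (b ^ 2) (a ^ 2)) (fun _ => 0) (mixZone a b g T) := by
  have hbox : IsBox Ω _ _ := hΩ
  have e1 := edgeMinus_pos hb hab hg
  have e2 := edgePlus_pos hb hab hg
  have hlm : -edgeMinus a b g * T ^ 2 ≤ edgePlus a b g * T ^ 2 := by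
    gcongr; linarith
  have hr := h.sq_le_density hb hab
  have hcyl : MeasurableSet (cylinder Ω T : Set (Plane × ℝ)) :=
    (cylinder Ω T).isOpen.measurableSet
  obtain ⟨Cf, hCf⟩ := h.exists_bound_flux
  obtain ⟨CS, hCS⟩ := h.exists_bound_stress hb hab hg
  have mf := measurable_ratio h.continuous_flux.measurable
  have mS := measurable_ratio h.measurable_stress
  have cf := h.continuous_flux.comp_continuousOn
    (continuousOn_ratio (a := a) (b := b) (g := g) (T := T))
  have cS := h.continuousOn_stress.comp
    (continuousOn_ratio (a := a) (b := b) (g := g) (T := T)) fun p hp => hp.2.2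
  exact {
    initial := isInitialData _ _
    e_nonneg := fun p _ => by
      have := (sq_nonneg b).trans (hr (p.1 1 / p.2 ^ 2)).1
      have := IsProfile.kinBound_nonneg (a := a) (b := b) (g := g) (r := r) (H := H)
        (p.1 1 / p.2 ^ 2)
      unfold energyBound
      split_ifs <;> positivity
    e_bdd := by
      refine ⟨T ^ 2 * (1 / 2 * a ^ 2 * g ^ 2 + δ), fun p hp => ?_⟩
      have ht0 : 0 ≤ p.2 := hp.2.1
      have ht2 : p.2 ^ 2 ≤ T ^ 2 := pow_le_pow_left₀ ht0 hp.2.2.le 2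
      unfold energyBound
      split_ifs with hm
      · have := h.kinBound_le hb hab hg hm.2.2
        have := IsProfile.kinBound_nonneg (a := a) (b := b) (g := g) (r := r) (H := H)
          (p.1 1 / p.2 ^ 2)
        gcongr
      · have := (sq_nonneg b).trans (hr (p.1 1 / p.2 ^ 2)).1
        calc 1 / 2 * r (p.1 1 / p.2 ^ 2) * g ^ 2 * p.2 ^ 2 ≤ 1 / 2 * a ^ 2 * g ^ 2 * T ^ 2 := by
              gcongr; exact (hr _).2
          _ ≤ T ^ 2 * (1 / 2 * a ^ 2 * g ^ 2 + δ) := by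
              have : 0 ≤ T ^ 2 * δ := by positivity
              linarith
    S_symm := fun p _ => by
      refine ⟨?_, ?_⟩
      · exact (Matrix.isSymm_diagonal _).smul _
      · simp [profileState]
    rho_bdd := by
      refine memLp_top_of_bound (measurable_ratio h.cont.measurable).aestronglyMeasurable (a ^ 2)
        (.of_forall fun p => ?_)
      exact h.abs_density_le hb hab _
    v_bdd := MemLp.zero'
    u_bdd := by
      refine memLp_top_of_bound (C := T * Cf * ‖RayleighTaylor.e2‖)
        (measurable_snd.smul (mf.neg.smul_const _)).aestronglyMeasurable
        ((ae_restrict_iff' hcyl).2 (.of_forall fun p hp => ?_))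
      have ht := hp.2
      change ‖p.2 • (-flux r H (p.1 1 / p.2 ^ 2) • RayleighTaylor.e2)‖ ≤ _
      rw [norm_smul, norm_smul, norm_neg, ← mul_assoc]
      have h1 : ‖p.2‖ ≤ T := by rw [Real.norm_of_nonneg ht.1.le]; exact ht.2.le
      have h2 : ‖flux r H (p.1 1 / p.2 ^ 2)‖ ≤ Cf := hCf _
      gcongr
    S_bdd := fun i j => by
      have hmeas : Measurable fun p : Plane × ℝ => (profileState a b g r H Ω T).S p i j := by
        fin_cases i <;> fin_cases j <;> simp [profileState] <;> fun_prop
      refine memLp_top_of_bound (C := T ^ 2 * CS) hmeas.aestronglyMeasurable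
        ((ae_restrict_iff' hcyl).2 (.of_forall fun p hp => ?_))
      have ht := hp.2
      have h1 : p.2 ^ 2 ≤ T ^ 2 := pow_le_pow_left₀ ht.1.le ht.2.le 2
      have h2 := hCS (p.1 1 / p.2 ^ 2)
      have h3 : 0 ≤ CS := (abs_nonneg _).trans h2
      fin_cases i <;> fin_cases j <;> simp [profileState] <;> first | positivity | gcongr
    solves := h.solves hb hab hg hT hbox hlm
    mix_open := isOpen_mixZone
    mix_subset := hΩ.mixZone_subset hb hab hg
    e_cont := by
      refine ContinuousOn.congr (f := fun p : Plane × ℝ => p.2 ^ 2 *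
        (kinBound a b g r H (p.1 1 / p.2 ^ 2) + δ)) ?_ fun p hp => by simp [energyBound, hp]
      exact (continuous_snd.pow 2).continuousOn.mul
        ((h.continuousOn_kinBound.comp continuousOn_ratio fun p hp => hp.2.2).add
          continuousOn_const)
    rho_cont := h.cont.comp_continuousOn continuousOn_ratio
    v_cont := continuousOn_const
    u_cont := continuous_snd.continuousOn.smul (cf.neg.smul continuousOn_const)
    S_cont := by
      refine continuousOn_pi.2 fun i => continuousOn_pi.2 fun j => ?_
      have c2 : ContinuousOn (fun p : Plane × ℝ => p.2 ^ 2) (mixZone a b g T) := by fun_prop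
      have c3 := c2.mul cS
      have c4 := c3.neg
      simp only [Function.comp_def] at c3 c4
      fin_cases i <;> fin_cases j <;> simp [profileState] <;>
        first | exact continuousOn_const | exact c3 | exact c4
    in_mix := fun p hp => by
      have := h.inU hb hg hδ hp.2.1.1 hp.2.2
      rw [show energyBound a b g T δ r H p = _ from if_pos hp]
      exact this
    off_mix := by
      refine (ae_restrict_iff' (hcyl.diff isOpen_mixZone.measurableSet)).2
        (.of_forall fun p hp => ?_)
      have hy : p.1 1 / p.2 ^ 2 ∉ mixInterval a b g := fun hy =>
        hp.2 ((hbox.mem_mixZone_iff' hp.1).2 hy)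
      rw [show energyBound a b g T δ r H p = _ from if_neg hp.2]
      exact h.inK (t := p.2) hy }

lemma IsProfile.isSelfSimilar (h : IsProfile a b g r H) (hb : 0 < b) (hab : b < a) (hg : 0 < g)
    (hT : 0 < T) (hΩ : IsBox Ω l m) : IsSelfSimilar (profileState a b g r H Ω T) := by
  have hloc := h.locallyIntegrableOn_pressure hb hab hg hT hΩ
  exact ⟨r, fun y => -flux r H y • e2, fun y => Matrix.diagonal ![-stress a b r H y,
    stress a b r H y], pressureProfile a b g r H, fun p _ => ⟨rfl, rfl, rfl, rfl⟩, hloc,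
    fun ψ => distributionOf_apply hloc ψ⟩

end

section

variable {a b g δ : ℝ} {r H : ℝ → ℝ}
variable {Ω : Opens Plane} {l m T : ℝ}

/-! ### Admissibility -/

/-- The rescaled gap between the energy density of the subsolution and that of the initial
state. -/
def energyGap (a b g δ : ℝ) (r H : ℝ → ℝ) (y : ℝ) : ℝ :=
  energyDensity a b g r H y + δ - g * (y * stepDensity (b ^ 2) (a ^ 2) y)

lemma measurable_stepDensity (rm rp : ℝ) : Measurable (stepDensity rm rp) :=
  Measurable.ite measurableSet_Ioi measurable_const measurable_const

lemma integral_mul_stepDensity (hb : 0 < b) (hab : b < a) (hg : 0 < g) :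
    ∫ y in mixInterval a b g, y * stepDensity (b ^ 2) (a ^ 2) y
      = 1 / 2 * (a ^ 2 * edgePlus a b g ^ 2 - b ^ 2 * edgeMinus a b g ^ 2) := by
  have e1 := edgeMinus_pos hb hab hg
  have e2 := edgePlus_pos hb hab hg
  have hle : -edgeMinus a b g ≤ edgePlus a b g := by linarith
  have c := continuous_mul_stepDensity (b ^ 2) (a ^ 2)
  rw [mixInterval, ← integral_Ioc_eq_integral_Ioo, ← intervalIntegral.integral_of_le hle,
    integral_eq_of_hasDerivAt_off_countable
      (fun y => 1 / 2 * y * (y * stepDensity (b ^ 2) (a ^ 2) y)) _ (countable_singleton 0)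
      (by fun_prop) ?_ (c.intervalIntegrable _ _)]
  · simp only [stepDensity, e2, if_true, show ¬ 0 < -edgeMinus a b g by linarith, if_false]
    ring
  · rintro y ⟨-, h0⟩
    have h1 := (((hasDerivAt_id y).const_mul (1 / 2)).mul
      ((hasDerivAt_id y).mul_const (stepDensity (b ^ 2) (a ^ 2) y)))
    refine (h1.congr_of_eventuallyEq ?_).congr_deriv ?_
    · filter_upwards [stepDensity_eventually_eq (b ^ 2) (a ^ 2) h0] with z hz
      simp [hz]
    · simp only [id]; ring

namespace IsProfile

lemma measurable_energyGap (h : IsProfile a b g r H) : Measurable (energyGap a b g δ r H) := by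
  have h1 := h.continuous_flux.measurable
  have h2 := h.cont.measurable
  have h3 := measurable_stepDensity (b ^ 2) (a ^ 2)
  unfold energyGap energyDensity kinBound
  fun_prop

lemma exists_bound_energyGap (h : IsProfile a b g r H) (hb : 0 < b) (hab : b < a) (hg : 0 < g) :
    ∃ C, ∀ y ∈ mixInterval a b g, |energyGap a b g δ r H y| ≤ C := by
  have h1 := h.continuous_flux
  have h2 := h.cont
  have h3 := continuous_mul_stepDensity (b ^ 2) (a ^ 2)
  have hc : Continuous fun y => g * flux r H y - 1 / 2 * g ^ 2 * r y + g * y * r y + δ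
      - g * (y * stepDensity (b ^ 2) (a ^ 2) y) := by fun_prop
  obtain ⟨C, hC⟩ := (isCompact_Icc (a := -edgeMinus a b g) (b := edgePlus a b g)
    ).exists_bound_of_continuousOn hc.continuousOn
  refine ⟨1 / 2 * a ^ 2 * g ^ 2 + C, fun y hy => ?_⟩
  have e : energyGap a b g δ r H y = kinBound a b g r H y
      + (g * flux r H y - 1 / 2 * g ^ 2 * r y + g * y * r y + δ
        - g * (y * stepDensity (b ^ 2) (a ^ 2) y)) := by
    unfold energyGap energyDensity; ring
  rw [e]
  refine (abs_add_le _ _).trans (add_le_add ?_ (hC y (Ioo_subset_Icc_self hy)))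
  rw [abs_of_nonneg (kinBound_nonneg y)]
  exact h.kinBound_le hb hab hg hy

/-- For small `δ` the subsolution has less energy than the initial state. -/
lemma exists_energyGap_neg (h : IsProfile a b g r H) (hb : 0 < b) (hab : b < a) (hg : 0 < g)
    (hE : ∫ y in mixInterval a b g, energyDensity a b g r H y
      < g / 2 * (a ^ 2 * edgePlus a b g ^ 2 - b ^ 2 * edgeMinus a b g ^ 2)) :
    ∃ δ, 0 < δ ∧ ∫ y in mixInterval a b g, energyGap a b g δ r H y < 0 := by
  have e1 := edgeMinus_pos hb hab hg
  have e2 := edgePlus_pos hb hab hg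
  have hle : -edgeMinus a b g ≤ edgePlus a b g := by linarith
  set gap := g / 2 * (a ^ 2 * edgePlus a b g ^ 2 - b ^ 2 * edgeMinus a b g ^ 2)
    - ∫ y in mixInterval a b g, energyDensity a b g r H y with hgap
  have hgap0 : 0 < gap := sub_pos.2 hE
  set len := edgePlus a b g + edgeMinus a b g with hlen
  have hlen0 : 0 < len := by linarith
  refine ⟨gap / (2 * len), by positivity, ?_⟩
  have integ {f : ℝ → ℝ} (hf : Continuous f) : IntegrableOn f (mixInterval a b g) :=
    (hf.continuousOn.integrableOn_compact isCompact_Icc).mono_set Ioo_subset_Icc_self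
  have i1 := h.integrableOn_energyDensity hb hab hg
  have i2 : IntegrableOn (fun _ => gap / (2 * len)) (mixInterval a b g) := integ continuous_const
  have i3 := integ ((continuous_mul_stepDensity (b ^ 2) (a ^ 2)).const_mul g)
  have key := integral_sub (i1.add i2) i3
  have key2 := integral_add i1 i2
  simp only [Pi.add_apply] at key
  have hvol : volume.real (mixInterval a b g) = len := by
    rw [mixInterval, Real.volume_real_Ioo_of_le hle, hlen]; ring
  rw [key2, integral_const_mul, integral_mul_stepDensity hb hab hg, setIntegral_const, hvol,
    smul_eq_mul] at key
  unfold energyGap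
  rw [key]
  have e3 : len * (gap / (2 * len)) = gap / 2 := by field_simp
  rw [e3]
  linarith

/-- The energy density exceeds that of the initial state by the rescaled gap, in the mixing zone
only. -/
lemma energySub_eq (h : IsProfile a b g r H) (hb : 0 < b) (hab : b < a) (hg : 0 < g)
    (hΩ : IsBox Ω l m) {x : Plane} {t : ℝ} (hx : x ∈ Ω) (ht : t ∈ Ioo 0 T) :
    energySub g (energyBound a b g T δ r H) (profileState a b g r H Ω T) x t
      = t ^ 2 * (mixInterval a b g).indicator (energyGap a b g δ r H) (x 1 / t ^ 2)
        + rtDensity (b ^ 2) (a ^ 2) x * g * x 1 := by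
  have ht0 : 0 < t := ht.1
  have hp : (x, t) ∈ cylinder Ω T := ⟨hx, ht⟩
  have hs : rtDensity (b ^ 2) (a ^ 2) x = stepDensity (b ^ 2) (a ^ 2) (x 1 / t ^ 2) := by
    have : 0 < x 1 / t ^ 2 ↔ 0 < x 1 := div_pos_iff_of_pos_right (by positivity)
    simp only [stepDensity, rtDensity, this]
  by_cases hm : x 1 / t ^ 2 ∈ mixInterval a b g
  · have hm' : (x, t) ∈ mixZone a b g T := (hΩ.mem_mixZone_iff' hp).2 hm
    rw [indicator_of_mem hm, hs]
    simp only [energySub, energyBound, hm', if_true, profileState, PiLp.smul_apply, e2_one,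
      smul_eq_mul, energyGap, energyDensity]
    field_simp
    ring
  · have hm' : (x, t) ∉ mixZone a b g T := fun h' => hm ((hΩ.mem_mixZone_iff' hp).1 h')
    have hr : x 1 / t ^ 2 ≤ -edgeMinus a b g ∨ edgePlus a b g ≤ x 1 / t ^ 2 := by
      rcases lt_or_ge (-edgeMinus a b g) (x 1 / t ^ 2) with h1 | h1
      · exact .inr (not_lt.1 fun h2 => hm ⟨h1, h2⟩)
      · exact .inl h1
    rw [indicator_of_notMem hm]
    simp only [energySub, energyBound, hm', if_false, profileState, PiLp.smul_apply, e2_one,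
      smul_eq_mul, h.flux_eq_zero hm]
    have : r (x 1 / t ^ 2) * x 1 = rtDensity (b ^ 2) (a ^ 2) x * x 1 := by
      have e1 := edgeMinus_pos hb hab hg
      have e2 := edgePlus_pos hb hab hg
      rw [hs]
      rcases hr with h1 | h1
      · rw [(h.below _ h1).1, stepDensity, if_neg (by linarith)]
      · rw [(h.above _ h1).1, stepDensity, if_pos (by linarith)]
    linear_combination g * this

theorem isStrictlyAdmissible (h : IsProfile a b g r H) (hb : 0 < b) (hab : b < a) (hg : 0 < g)
    (hΩ : IsFinalBox a b g T Ω)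
    (hδ : ∫ y in mixInterval a b g, energyGap a b g δ r H y < 0) :
    IsStrictlyAdmissible g (energyBound a b g T δ r H) (profileState a b g r H Ω T)
      (rtDensity (b ^ 2) (a ^ 2)) fun _ => 0 := by
  have hbox : IsBox Ω _ _ := hΩ
  set l := -edgeMinus a b g * T ^ 2 with hl
  set m := edgePlus a b g * T ^ 2 with hm
  have hΩm : MeasurableSet (Ω : Set Plane) := Ω.isOpen.measurableSet
  have hx1 : Measurable fun x : Plane => x 1 := by fun_prop
  have hzero : ∀ x : Plane, energyBound a b g T δ r H (x, 0) = 0 := by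
    intro x
    have : (x, (0 : ℝ)) ∉ mixZone a b g T := fun h => lt_irrefl _ h.2.1.1
    simp [energyBound, this]
  have hrm : Measurable (rtDensity (b ^ 2) (a ^ 2)) :=
    (measurable_stepDensity (b ^ 2) (a ^ 2)).comp hx1
  have hinit : IntegrableOn (fun x : Plane => rtDensity (b ^ 2) (a ^ 2) x * g * x 1)
      (Ω : Set Plane) := by
    refine IntegrableOn.of_bound (C := a ^ 2 * g * max |l| |m|) hbox.volume_lt_top
      ((hrm.mul_const g).mul hx1).aestronglyMeasurable
      ((ae_restrict_iff' hΩm).2 (.of_forall fun x hx => ?_))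
    have hx' := ((hbox x).1 hx).2
    have h1 : |x 1| ≤ max |l| |m| := abs_le_max_abs_abs hx'.1.le hx'.2.le
    have h2 : |rtDensity (b ^ 2) (a ^ 2) x| ≤ a ^ 2 := by
      have := pow_le_pow_left₀ hb.le hab.le 2
      unfold rtDensity
      split_ifs
      · rw [abs_of_nonneg (sq_nonneg a)]
      · rwa [abs_of_nonneg (sq_nonneg b)]
    rw [norm_mul, norm_mul, Real.norm_eq_abs, Real.norm_eq_abs, Real.norm_eq_abs, abs_of_pos hg]
    gcongr
  have hgap (t : ℝ) : IntegrableOn (fun x : Plane =>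
      t ^ 2 * (mixInterval a b g).indicator (energyGap a b g δ r H) (x 1 / t ^ 2))
      (Ω : Set Plane) := by
    obtain ⟨C, hC⟩ := h.exists_bound_energyGap (δ := δ) hb hab hg
    have hmeas : Measurable ((mixInterval a b g).indicator (energyGap a b g δ r H)) :=
      h.measurable_energyGap.indicator measurableSet_Ioo
    refine IntegrableOn.of_bound (C := t ^ 2 * max C 0) hbox.volume_lt_top
      ((hmeas.comp (hx1.div_const _)).const_mul _).aestronglyMeasurable
      (.of_forall fun x => ?_)
    rw [norm_mul, Real.norm_of_nonneg (sq_nonneg t)]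
    gcongr
    by_cases hy : x 1 / t ^ 2 ∈ mixInterval a b g
    · rw [indicator_of_mem hy]; exact (hC _ hy).trans (le_max_left _ _)
    · rw [indicator_of_notMem hy, norm_zero]; exact le_max_right _ _
  have hcongr {t : ℝ} (ht : t ∈ Ioo 0 T) := fun x (hx : x ∈ (Ω : Set Plane)) =>
    h.energySub_eq (δ := δ) hb hab hg hbox hx ht
  refine ⟨fun x _ => by simp [hzero], ?_, fun t ht => ?_, fun t ht => ?_⟩
  · simpa only [hzero, zero_add] using hinit
  · exact ((hgap t).add hinit).congr_fun (fun x hx => (hcongr ht x hx).symm) hΩm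
  · rw [setIntegral_congr_fun hΩm (hcongr ht), integral_add (hgap t) hinit]
    simp only [hzero, zero_add]
    refine add_lt_of_neg_left _ ?_
    rw [integral_const_mul]
    have ht0 : 0 < t := ht.1
    have ht2 : 0 < t ^ 2 := by positivity
    refine mul_neg_of_pos_of_neg ht2 ?_
    rw [hbox.integral_eq]
    simp only [pt_one]
    have e1 := setIntegral_prod_mul (μ := (volume : Measure ℝ)) (ν := (volume : Measure ℝ))
      (fun _ : ℝ => (1 : ℝ))
      (fun s : ℝ => (mixInterval a b g).indicator (energyGap a b g δ r H) (s / t ^ 2))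
      (Ioo 0 1) (Ioo l m)
    simp only [one_mul] at e1
    rw [Measure.volume_eq_prod, e1, setIntegral_const,
      setIntegral_eq_integral_of_forall_compl_eq_zero,
      Measure.integral_comp_div (fun y => (mixInterval a b g).indicator (energyGap a b g δ r H) y),
      integral_indicator (show MeasurableSet (mixInterval a b g) from measurableSet_Ioo)]
    · simp only [Real.volume_real_Ioo_of_le zero_le_one, smul_eq_mul, abs_of_pos ht2]
      have := mul_neg_of_pos_of_neg ht2 hδ
      linarith
    · intro s hs
      refine indicator_of_notMem (fun hy => hs ?_) _
      have htT : t ^ 2 ≤ T ^ 2 := pow_le_pow_left₀ ht0.le ht.2.le 2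
      have p1 := edgeMinus_pos hb hab hg
      have p2 := edgePlus_pos hb hab hg
      have q1 := (lt_div_iff₀ ht2).1 hy.1
      have q2 := (div_lt_iff₀ ht2).1 hy.2
      constructor
      · nlinarith
      · nlinarith

end IsProfile

lemma cMinus_eq (hb : 0 < b) (ha : 0 < a) (t : ℝ) :
    cMinus (b ^ 2) (a ^ 2) g t = edgeMinus a b g * t ^ 2 := by
  rw [cMinus, ← div_pow, Real.sqrt_sq (by positivity), edgeMinus]

lemma cPlus_eq (hb : 0 < b) (ha : 0 < a) (t : ℝ) :
    cPlus (b ^ 2) (a ^ 2) g t = edgePlus a b g * t ^ 2 := by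
  rw [cPlus, ← div_pow, Real.sqrt_sq (by positivity), edgePlus]

lemma mem_rect_iff (hb : 0 < b) (ha : 0 < a) {t : ℝ} {x : Plane} :
    x ∈ rect (b ^ 2) (a ^ 2) g t ↔ (0 < x 0 ∧ x 0 < 1) ∧
      -edgeMinus a b g * t ^ 2 < x 1 ∧ x 1 < edgePlus a b g * t ^ 2 := by
  have : x ∈ rect (b ^ 2) (a ^ 2) g t ↔ (0 < x 0 ∧ x 0 < 1) ∧
    -cMinus (b ^ 2) (a ^ 2) g t < x 1 ∧ x 1 < cPlus (b ^ 2) (a ^ 2) g t := Iff.rfl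
  rw [this, cMinus_eq hb ha, cPlus_eq hb ha, neg_mul]

/-- The bound on the density ratio, in terms of the square roots of the densities. -/
lemma threshold_of_ratio (hb : 0 < b) (hk : (4 + 2 * √10) / 3 * b < a) :
    8 * a * b + 8 * b ^ 2 < 3 * a ^ 2 := by
  have h10 : √10 ^ 2 = 10 := Real.sq_sqrt (by norm_num)
  have h3 : 2 < √10 := by
    rw [show (2 : ℝ) = √(2 ^ 2) by rw [Real.sqrt_sq (by norm_num)]]
    exact Real.sqrt_lt_sqrt (by norm_num) (by norm_num)
  have ha : 0 < a := lt_trans (by positivity) hk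
  have e : 3 * a ^ 2 - (8 * a * b + 8 * b ^ 2)
      = 3 * ((a - (4 + 2 * √10) / 3 * b) * (a + (2 * √10 - 4) / 3 * b)) := by
    linear_combination (4 / 3 * b ^ 2) * h10
  have h4 : 0 < a + (2 * √10 - 4) / 3 * b := by
    have : 0 < (2 * √10 - 4) / 3 * b := by
      apply mul_pos _ hb; linarith
    linarith
  have := mul_pos (sub_pos.2 hk) h4
  linarith

end

end RayleighTaylor

end

open RayleighTaylor

theorem theorem2p7 (rm rp g T : ℝ) (hrm : 0 < rm) (hg : 0 < g) (hT : 0 < T)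
    (hr : ((4 + 2 * √10) / 3) ^ 2 * rm < rp) :
    ∃ (e : RayleighTaylor.Plane × ℝ → ℝ) (z : RayleighTaylor.State (RayleighTaylor.rect rm rp g T) T)
      (mix : Set (RayleighTaylor.Plane × ℝ)),
      RayleighTaylor.IsRTSubsolution rm rp g e z mix ∧
      RayleighTaylor.IsSelfSimilar z ∧
      ∀ t ∈ Set.Ioo 0 T,
        {x : RayleighTaylor.Plane | x ∈ RayleighTaylor.rect rm rp g T ∧ (x, t) ∈ mix}
          = (RayleighTaylor.rect rm rp g t : Set RayleighTaylor.Plane) := by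
  obtain ⟨b, hb, rfl⟩ : ∃ b, 0 < b ∧ rm = b ^ 2 := ⟨√rm, by positivity, (Real.sq_sqrt hrm.le).symm⟩
  have hrp : 0 < rp := lt_trans (by positivity) hr
  obtain ⟨a, ha, rfl⟩ : ∃ a, 0 < a ∧ rp = a ^ 2 := ⟨√rp, by positivity, (Real.sq_sqrt hrp.le).symm⟩
  have hk : (4 + 2 * √10) / 3 * b < a := by
    rw [← mul_pow] at hr
    exact lt_of_pow_lt_pow_left₀ 2 ha.le hr
  have hab : b < a := by
    refine lt_of_le_of_lt (le_mul_of_one_le_left hb.le ?_) hk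
    have := Real.sqrt_nonneg 10
    linarith
  obtain ⟨r, H, h, hE⟩ := exists_profile hb hab hg (threshold_of_ratio hb hk)
  obtain ⟨δ, hδ, hgap⟩ := h.exists_energyGap_neg hb hab hg hE
  have hΩ : IsFinalBox a b g T (rect (b ^ 2) (a ^ 2) g T) := fun x => mem_rect_iff hb ha
  refine ⟨energyBound a b g T δ r H, profileState a b g r H _ T, mixZone a b g T,
    ⟨h.isSubsolution hb hab hg hT hδ hΩ, h.isStrictlyAdmissible hb hab hg hΩ hgap⟩,
    h.isSelfSimilar hb hab hg hT hΩ, fun t ht => ?_⟩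
  ext x
  constructor
  · rintro ⟨-, hx⟩
    obtain ⟨h0, -, h1⟩ := mem_mixZone_iff.1 hx
    exact (mem_rect_iff hb ha).2 ⟨h0, h1⟩
  · intro hx
    have hx' := (mem_rect_iff hb ha).1 hx
    have hm : (x, t) ∈ mixZone a b g T := mem_mixZone_iff.2 ⟨hx'.1, ht, hx'.2⟩
    exact ⟨(hΩ.mixZone_subset hb hab hg hm).1, hm⟩
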